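/- There are finitely many players. Player $i$ has an unknown state vector $\theta^i\in\mathbb R^K$ ($K\ge 1$) and access to $K$ signals $X^i_k=\langle c^i_k,\theta^i\rangle+\epsilon^i_k$ with standard normal noise. Let $V^i$ be a positive definite matrix (the prior covariance of $\theta^i$) and $C^i$ the matrix with rows $c^i_k$. Assume that $C^i$ is invertible and that the first row of $(C^i)^{-1}$ has no zero entry. For $q\in\mathbb Z_+^K$ let $f^i(q)=\big[((V^i)^{-1}+(C^i)'\,\mathrm{diag}(q)\,C^i)^{-1}\big]_{11}$ be the posterior variance of $\theta^i_1$ after $q_k$ observations of each signal $X^i_k$. The environment $(V^i,C^i)$ is separable if $f^i(q)=F(g_1(q_1)+\dots+g_K(q_K))$ for some convex functions $g_1,\dots,g_K$ of the signal counts, with values in $(-\infty,+\infty]$, and some function $F$ that is strictly increasing on the values of the sum. Given the environments, there is a $B_0$ such that the following holds for every $B\ge 1$ with $B\ge B_0$, and for every $B\ge1$ if the environments of all players are separable. Let $\omega\in\mathbb R$ and $(\theta^i)_i$ have any common prior under which each $\theta^i$ is Gaussian with covariance $V^i$ and, for each $i$, conditional on $\theta^i_1$, the pair $(\omega,(\theta^j)_{j\neq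 i})$ is independent of $\theta^i$. In each of the periods $1,2,\dots$ up to and including a random final period, each player privately chooses $B$ of his signals (repetitions allowed), as a measurable function of his past realizations, and privately observes independent realizations of them. The final period has an arbitrary exogenous distribution on $\{1,2,\dots\}$, independent of everything else. In the final period each player $i$ chooses an action $a^i$ in a measurable space $A_i$, as a measurable function of his realizations, and receives $u_i(a,\omega)$, where $u_i$ is measurable and $a$ is the action profile. All choices may also depend on a private, independent, uniform randomization device. Acquisition is myopic if after every history the next $B$ signals minimize $f^i$ of the resulting counts among all multisets of $B$ signals. Expected payoffs take values in $[-\infty,\infty]$, those that do not exist counting as $-\infty$; in an equilibrium they are required to be finite. Then: 1. (Dominance) For each player $i$, each myopic acquisition strategy $S$ of $i$, all strategies of the opponents and each strategy of $i$, there is a decision strategy of $i$ which together with $S$ gives $i$ at least the same expected payoff against these opponents. 2. If all players acquire information myopically and no player gains by changing his decision strategy alone (that is, the decision strategies form an equilibrium of the game in which this myopic information is exogenous), then the strategies form a Nash equilibrium of the game, in which acquisition can be changed as well. 3. If all $A_i$ are finite and nonempty (with all subsets measurable) and $u_i(a,\omega)$ is integrable for all $i$ and all $a$, then there exists a Nash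 equilibrium in which every player acquires information myopically. -/

import Mathlib

open MeasureTheory ProbabilityTheory
open scoped Matrix

noncomputable section

namespace InfoGame

/-- The prior covariance matrix of one player's state vector and the matrix of signal coefficients.
Signal `k` is `⟨coeff k, θ⟩ + ε` with standard normal noise `ε`. The coordinate `0` of the state
vector is the state of interest (called `θ₁` on paper). -/
structure Environment (K : ℕ) where
  /-- Prior covariance matrix of the state vector. -/
  cov : Matrix (Fin K) (Fin K) ℝ
  /-- Coefficient matrix, with the signals as rows. -/
  coeff : Matrix (Fin K) (Fin K) ℝ

namespace Environment

variable {K : ℕ} [NeZero K]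

/-- The prior is nondegenerate, the coefficient matrix is invertible, and the first row of its
inverse has no zero entry (non-redundancy). -/
structure Regular (E : Environment K) : Prop where
  posDef : E.cov.PosDef
  invertible : IsUnit E.coeff.det
  nonredundant : ∀ k, E.coeff⁻¹ 0 k ≠ 0

/-- The posterior variance of `θ₁` after `q k` observations of each signal `k`: the entry `(0, 0)`
of the inverse of the posterior precision matrix `V⁻¹ + Cᵀ diag(q) C`. -/
def posteriorVariance (E : Environment K) (q : Fin K → ℕ) : ℝ :=
  (E.cov⁻¹ + E.coeffᵀ * Matrix.diagonal (fun k => (q k : ℝ)) * E.coeff)⁻¹ 0 0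

/-- For positive counts this is the usual conditional variance formula for Gaussian vectors,
where `q k` observations amount to one observation with noise variance `1 / q k`. -/
theorem posteriorVariance_eq (E : Environment K) (hE : E.Regular) (q : Fin K → ℕ)
    (hq : ∀ k, 0 < q k) :
    E.posteriorVariance q =
      (E.cov - E.cov * E.coeffᵀ * (E.coeff * E.cov * E.coeffᵀ
        + Matrix.diagonal (fun k => ((q k : ℝ))⁻¹))⁻¹ * E.coeff * E.cov) 0 0 := by
  have hV : IsUnit E.cov := hE.posDef.isUnit
  have hD : (Matrix.diagonal (fun k => (q k : ℝ))⁻¹).PosDef :=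
    Matrix.PosDef.diagonal fun k => by
      have := hq k
      simp only [Pi.inv_apply]
      positivity
  have hD' : (Matrix.diagonal (fun k => (q k : ℝ)))⁻¹ = Matrix.diagonal (fun k => (q k : ℝ))⁻¹ := by
    refine Matrix.inv_eq_right_inv ?_
    rw [Matrix.diagonal_mul_diagonal, ← Matrix.diagonal_one]
    congr 1
    ext k
    have : (q k : ℝ) ≠ 0 := by exact_mod_cast (hq k).ne'
    simp [this]
  have hU : IsUnit (Matrix.diagonal (fun k => (q k : ℝ))) := by
    have h := hD.isUnit
    rw [← hD'] at h
    exact Matrix.isUnit_nonsing_inv_iff.mp h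
  have hS : (E.coeff * E.cov * E.coeffᵀ).PosSemidef := by
    simpa [Matrix.conjTranspose_eq_transpose_of_trivial] using
      hE.posDef.posSemidef.mul_mul_conjTranspose_same E.coeff
  have hVV : (E.cov⁻¹)⁻¹ = E.cov :=
    Matrix.nonsing_inv_nonsing_inv _ ((Matrix.isUnit_iff_isUnit_det _).mp hV)
  have hW : IsUnit ((Matrix.diagonal (fun k => (q k : ℝ)))⁻¹
      + E.coeff * (E.cov⁻¹)⁻¹ * E.coeffᵀ) := by
    rw [hVV, hD']
    exact (hD.add_posSemidef hS).isUnit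
  rw [posteriorVariance, Matrix.add_mul_mul_inv_eq_sub _ _ _ _
    (Matrix.isUnit_nonsing_inv_iff.mpr hV) hU hW, hVV, hD', add_comm]
  rfl

/-- The environment is separable: the posterior variance function is a strictly increasing function
of a sum of convex functions of the individual signal counts. The convex functions may take the
value `+∞` (as does `σ² / q` at `q = 0`), and the outer function has to be defined and strictly
increasing only on the values that the sum takes. -/
def Separable (E : Environment K) : Prop :=
  ∃ (g : Fin K → ℕ → WithTop ℝ) (F : WithTop ℝ → ℝ),
    (∀ k n, g k (n + 1) + g k (n + 1) ≤ g k n + g k (n + 2)) ∧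
    StrictMonoOn F (Set.range fun q : Fin K → ℕ => ∑ k, g k (q k)) ∧
    ∀ q : Fin K → ℕ, E.posteriorVariance q = F (∑ k, g k (q k))

end Environment

/-- What a player has observed in `t` periods: `B` real signal realizations per period. -/
abbrev History (B t : ℕ) : Type := Fin t → Fin B → ℝ

/-- An information acquisition strategy: before each period, as a measurable function of the past
realizations (and of a private randomization device with values in `[0, 1]`, which a pure strategy
ignores), it names the `B` signals that are observed next; repetitions are allowed.
`choose t` is applied after `t` periods have passed. The player's own past choices
are themselves functions of these data. -/
structure Acquisition (K B : ℕ) where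
  choose : (t : ℕ) → unitInterval → History B t → Fin B → Fin K
  measurable_choose : ∀ t, Measurable fun p : unitInterval × History B t => choose t p.1 p.2

/-- A decision strategy: the action to be taken if period `t` is the final one, as a measurable
function of the realizations of periods `1, …, t` and of the randomization device. -/
structure Decision (B : ℕ) (A : Type*) [MeasurableSpace A] where
  act : (t : ℕ) → unitInterval → History B t → A
  measurable_act : ∀ t, Measurable fun p : unitInterval × History B t => act t p.1 p.2

/-- A strategy of a player in the dynamic game. -/
structure Strategy (K B : ℕ) (A : Type*) [MeasurableSpace A] where
  acquisition : Acquisition K B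
  decision : Decision B A

namespace Acquisition

variable {K B : ℕ}

/-- How often each signal occurs in a list of `B` signals. -/
def count (c : Fin B → Fin K) (k : Fin K) : ℕ := (Finset.univ.filter fun b => c b = k).card

/-- The division vector after the history `h`: how often each signal has been acquired. -/
def division (S : Acquisition K B) {t : ℕ} (r : unitInterval) (h : History B t) (k : Fin K) : ℕ :=
  ∑ s : Fin t, count (S.choose s r fun j => h (Fin.castLE s.isLt.le j)) k

/-- Myopic acquisition: after every history, the next `B` signals minimize, among all multisets of
`B` signals, the posterior variance of the state of interest at the end of the next period. -/
def IsMyopic [NeZero K] (E : Environment K) (S : Acquisition K B) : Prop :=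
  ∀ (t : ℕ) (r : unitInterval) (h : History B t) (c : Fin B → Fin K),
    E.posteriorVariance (S.division r h + count (S.choose t r h)) ≤
      E.posteriorVariance (S.division r h + count c)

/-- The history of the first `t` periods when the state vector is `θ`, the randomization device
shows `r`, and the noise terms are `e`; `e (t, b)` is the noise of the `b`-th observation in
period `t + 1`. -/
def history (S : Acquisition K B) (E : Environment K) (θ : EuclideanSpace ℝ (Fin K))
    (r : unitInterval) (e : ℕ × Fin B → ℝ) : (t : ℕ) → History B t
  | 0 => Fin.elim0
  | t + 1 => Fin.snoc (α := fun _ => Fin B → ℝ) (history S E θ r e t) fun b =>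
      (∑ l, E.coeff (S.choose t r (history S E θ r e t) b) l * θ l) + e (t, b)

end Acquisition

/-- All states: the payoff-relevant state `ω` and the state vectors of the players. -/
abbrev States (ι : Type*) (K : ℕ) : Type _ := ℝ × (ι → EuclideanSpace ℝ (Fin K))

/-- A common prior: a probability measure over all states under which the state vector of each
player `i` is Gaussian with the covariance matrix of the environment of `i`, and under which,
conditional on the state of interest `θ₁` of player `i`, the pair of `ω` and the other players'
state vectors is independent of the state vector of `i`. -/
structure IsCommonPrior {ι : Type*} [Fintype ι] {K : ℕ} [NeZero K] (E : ι → Environment K)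
    (P : Measure (States ι K)) [IsProbabilityMeasure P] : Prop where
  gaussian : ∀ i, ∃ m : EuclideanSpace ℝ (Fin K),
    P.map (fun x => x.2 i) = multivariateGaussian m (E i).cov
  condIndep : ∀ i, CondIndepFun
    (MeasurableSpace.comap (fun x : States ι K => x.2 i 0) inferInstance)
    (Measurable.comap_le (by fun_prop))
    (fun x : States ι K => (x.1, fun j : {j // j ≠ i} => x.2 j))
    (fun x : States ι K => x.2 i) P

/-- The data of the game that are not informational: the distribution of the final period and the
payoffs of the one-shot game played in that period. -/
structure Payoffs {ι : Type*} (A : ι → Type*) [∀ i, MeasurableSpace (A i)] where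
  /-- Distribution of the final period. -/
  final : PMF ℕ
  /-- The periods are numbered `1, 2, …`. -/
  final_zero : final 0 = 0
  /-- The payoff of player `i` from an action profile, given `ω`. -/
  u : ι → (∀ i, A i) → ℝ → ℝ
  measurable_u : ∀ i, Measurable fun p : (∀ i, A i) × ℝ => u i p.1 p.2

/-- The outcomes of nature: the final period, the states, and for each player the outcome of the
randomization device and the noise terms. -/
abbrev Outcome (ι : Type*) (K B : ℕ) : Type _ :=
  ℕ × States ι K × (ι → unitInterval × (ℕ × Fin B → ℝ))

/-- The final period, the states, the randomization devices (uniform) and the noise terms (standard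
normal) are all independent. -/
def nature {ι : Type*} [Fintype ι] {K : ℕ} (B : ℕ) (final : PMF ℕ) (P : Measure (States ι K)) :
    Measure (Outcome ι K B) :=
  final.toMeasure.prod (P.prod (Measure.pi fun _ : ι =>
    (volume : Measure unitInterval).prod
      (Measure.infinitePi fun _ : ℕ × Fin B => gaussianReal 0 1)))

section Game

variable {ι : Type*} [Fintype ι] [DecidableEq ι] {K B : ℕ} [NeZero K]
  {A : ι → Type*} [∀ i, MeasurableSpace (A i)]

/-- The action that player `i` takes in the final period. -/
def finalAction (E : ι → Environment K) (σ : ∀ i, Strategy K B (A i)) (x : Outcome ι K B) (i : ι) :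
    A i :=
  (σ i).decision.act x.1 (x.2.2 i).1
    ((σ i).acquisition.history (E i) (x.2.1.2 i) (x.2.2 i).1 (x.2.2 i).2 x.1)

/-- The realized payoff of player `i`. -/
def realizedPayoff (E : ι → Environment K) (G : Payoffs A) (σ : ∀ i, Strategy K B (A i)) (i : ι)
    (x : Outcome ι K B) : ℝ :=
  G.u i (finalAction E σ x) x.2.1.1

/-- The expected payoff of player `i`, with values in `[-∞, ∞]`: the integral of the positive part
minus that of the negative part. By the convention `∞ - ∞ = -∞`, a profile at which the expected
payoff does not exist counts as worst. -/
def expectedPayoff (E : ι → Environment K) (P : Measure (States ι K)) (G : Payoffs A)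
    (σ : ∀ i, Strategy K B (A i)) (i : ι) : EReal :=
  ((∫⁻ x, ENNReal.ofReal (realizedPayoff E G σ i x) ∂(nature B G.final P) : ENNReal) : EReal) -
    ((∫⁻ x, ENNReal.ofReal (-realizedPayoff E G σ i x) ∂(nature B G.final P) : ENNReal) : EReal)

/-- Nash equilibrium: all expected payoffs are finite, and no player gains by a change of his
strategy (acquisition and decisions). -/
def IsNash (E : ι → Environment K) (P : Measure (States ι K)) (G : Payoffs A)
    (σ : ∀ i, Strategy K B (A i)) : Prop :=
  ∀ i, Integrable (realizedPayoff E G σ i) (nature B G.final P) ∧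
    ∀ τ : Strategy K B (A i),
      expectedPayoff E P G (Function.update σ i τ) i ≤ expectedPayoff E P G σ i

/-- Equilibrium in decisions, the acquisition strategies being exogenous: all expected payoffs are
finite, and no player gains by a change of his decision strategy alone. -/
def IsDecisionEquilibrium (E : ι → Environment K) (P : Measure (States ι K)) (G : Payoffs A)
    (σ : ∀ i, Strategy K B (A i)) : Prop :=
  ∀ i, Integrable (realizedPayoff E G σ i) (nature B G.final P) ∧
    ∀ δ : Decision B (A i),
      expectedPayoff E P G (Function.update σ i ⟨(σ i).acquisition, δ⟩) i ≤
        expectedPayoff E P G σ i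

/-- The acquisition strategy `S` is dominant for player `i`: whatever strategies the opponents use,
every strategy of `i` (the `i`-th entry of `σ`) can be replaced by one that acquires information
according to `S`, without a loss for `i`. -/
def IsDominant (E : ι → Environment K) (P : Measure (States ι K)) (G : Payoffs A) (i : ι)
    (S : Acquisition K B) : Prop :=
  ∀ σ : ∀ j, Strategy K B (A j), ∃ δ : Decision B (A i),
    expectedPayoff E P G σ i ≤ expectedPayoff E P G (Function.update σ i ⟨S, δ⟩) i

end Game

end InfoGame

end

open InfoGame

/-! In the coordinates `Cθ` every signal observes one coordinate, and the posterior variance becomes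
`wᵀ (P + diag q)⁻¹ w`, with `P` positive definite and `w` the first row of `C⁻¹`. The crux is that
myopic acquisition is optimal at all dates at once: its division vector after `t` periods minimizes
the posterior variance among all vectors with total `t * B`. This follows by induction once every
optimal vector of total `t * B` lies below some optimal vector of total `(t + 1) * B`
(`Environment.Regular.exists_optimalCount_ge`). For large `B`, optimal counts are proportional to
`|w k|` up to an error that does not grow with the total, so a block of `B` observations outweighs
the errors (`exists_forall_optimalCount_le`); this needs all `w k ≠ 0`. In separable environments an
exchange argument works for every `B` (`exists_optimalCount_ge_of_separable`).

Dominance is then a comparison of experiments. Under any acquisition strategy, even an adaptive one,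
the posterior of `θ₁` is Gaussian with the variance given by the division vector. For the myopic
strategy this variance is a constant `f`; for a rival strategy it is some `v ≥ f`. Adding noise of
variance `v - f` to the rival's posterior mean yields, by deconvolution, the law of the myopic
posterior mean. Disintegrating along it, the rival's data can be simulated from the myopic posterior
mean and the uniform device, with the right joint law with `θ₁` (`exists_garbling`). Conditional
independence given `θ₁` carries this over to `ω` and the opponents' states, and opponents do not see
what is acquired. Hence the rival's decisions, applied to simulated data, reproduce the rival's
payoff, and deviations in acquisition reduce to deviations in decisions.

For existence, a myopic strategy can be taken to be a deterministic path. For each final period the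
decisions then form a Bayesian game whose signals are independent given the states and have square
integrable densities. Behavior strategies form a weak-* compact convex set on which payoffs are
continuous, so a Ky Fan type theorem, deduced from Scarf's lemma, gives an equilibrium
(`exists_signal_equilibrium`), which the randomization device implements. -/

/-! ### Scarf's lemma on primitive sets -/

namespace Scarf

open Finset

variable {I Y : Type*} [Fintype I] [DecidableEq I] [Fintype Y] [DecidableEq Y]

/-- A set of `card I` points is primitive for the rankings `ρ` if no point lies strictly above the
minimum of the set in all rankings. -/
def Primitive (ρ : I → Y → ℕ) (P : Finset Y) : Prop :=
  P.card = Fintype.card I ∧ ∀ y, ∃ i, ∀ x ∈ P, ρ i y ≤ ρ i x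

instance (ρ : I → Y → ℕ) : DecidablePred (Primitive ρ) := fun P => by
  unfold Primitive
  infer_instance

omit [Fintype Y] in
-- In a primitive set each point is the minimum of some ranking, and by counting this is a bijection
-- between points and rankings. The added point `y` takes the ranking `j`; it is the `ρ j`-largest
-- point above `τ` in all other rankings, so `j` determines `y`.
theorem exists_role {ρ : I → Y → ℕ} (hρ : ∀ i, Function.Injective (ρ i))
    {τ : Finset Y} {m : I → Y} (hm : ∀ i, m i ∈ τ ∧ ∀ x ∈ τ, ρ i (m i) ≤ ρ i x)
    {y : Y} (hy : y ∉ τ) (hP : Primitive ρ (insert y τ)) :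
    ∃ j, (∀ x ∈ τ, ∃ i, i ≠ j ∧ m i = x) ∧ (∀ i, i ≠ j → ρ i (m i) < ρ i y) ∧
      ∀ z, (∀ i, i ≠ j → ρ i (m i) < ρ i z) → ρ j z ≤ ρ j y := by
  choose a ha using fun x : (insert y τ : Finset Y) => hP.2 x
  have hinj : Function.Injective a := by
    intro x x' h
    have h1 := ha x x' x'.2
    have h2 := ha x' x x.2
    rw [h] at h1
    exact Subtype.ext (hρ _ (le_antisymm h1 h2))
  have hbij : Function.Bijective a := by
    rw [Fintype.bijective_iff_injective_and_card]
    exact ⟨hinj, by rw [Fintype.card_coe]; exact hP.1⟩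
  have hma : ∀ x : (insert y τ : Finset Y), x.1 ∈ τ → m (a x) = x := by
    intro x hx
    exact hρ (a x) (le_antisymm ((hm _).2 _ hx) (ha x _ (mem_insert_of_mem (hm _).1)))
  have key : ∀ i, i ≠ a ⟨y, mem_insert_self _ _⟩ → ρ i (m i) < ρ i y := by
    intro i hi
    obtain ⟨x, rfl⟩ := hbij.2 i
    have hxy : x.1 ≠ y := fun h => hi (congrArg a (Subtype.ext h))
    have hx : x.1 ∈ τ := (mem_insert.1 x.2).resolve_left hxy
    rw [hma x hx]
    exact lt_of_le_of_ne (ha x y (mem_insert_self _ _)) fun h => hxy (hρ _ h)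
  refine ⟨a ⟨y, mem_insert_self _ _⟩, ?_, key, ?_⟩
  · intro x hx
    refine ⟨a ⟨x, mem_insert_of_mem hx⟩, fun h => ?_, hma ⟨x, mem_insert_of_mem hx⟩ hx⟩
    have := congrArg Subtype.val (hinj h)
    simp only at this
    exact hy (this ▸ hx)
  · intro z hz
    obtain ⟨i, hi⟩ := hP.2 z
    by_cases hij : i = a ⟨y, mem_insert_self _ _⟩
    · rw [← hij]; exact hi y (mem_insert_self _ _)
    · exact absurd (hi _ (mem_insert_of_mem (hm i).1)) (not_le.2 (hz i hij))

/-- Converse of `exists_role`: a point above all of the completed set would be above `τ` in the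
rankings other than `j`, hence no higher than `y` in `ρ j`. -/
theorem primitive_of_role {ρ : I → Y → ℕ} {τ : Finset Y} (hτ : τ.card + 1 = Fintype.card I) {m : I → Y}
    (hm : ∀ i, m i ∈ τ ∧ ∀ x ∈ τ, ρ i (m i) ≤ ρ i x) (hd : ∀ y, ∃ i, ρ i y ≤ ρ i (m i))
    {y : Y} {j : I} (hs : ∀ x ∈ τ, ∃ i, i ≠ j ∧ m i = x) (hy : ∀ i, i ≠ j → ρ i (m i) < ρ i y)
    (hmax : ∀ z, (∀ i, i ≠ j → ρ i (m i) < ρ i z) → ρ j z ≤ ρ j y) :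
    y ∉ τ ∧ Primitive ρ (insert y τ) := by
  have hyτ : y ∉ τ := by
    intro h
    obtain ⟨i, hi, rfl⟩ := hs y h
    exact lt_irrefl _ (hy i hi)
  have hyj : ρ j y ≤ ρ j (m j) := by
    obtain ⟨i, hi⟩ := hd y
    by_cases hij : i = j
    · rwa [← hij]
    · exact absurd hi (not_le.2 (hy i hij))
  refine ⟨hyτ, by rw [card_insert_of_notMem hyτ, hτ], fun z => ?_⟩
  by_contra! hcon
  have hz : ∀ i, i ≠ j → ρ i (m i) < ρ i z := by
    intro i hi
    obtain ⟨x, hx, hxz⟩ := hcon i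
    rcases mem_insert.1 hx with rfl | hx
    · exact (hy i hi).trans hxz
    · exact ((hm i).2 x hx).trans_lt hxz
  obtain ⟨x, hx, hxz⟩ := hcon j
  have := hmax z hz
  rcases mem_insert.1 hx with rfl | hx
  · omega
  · have := (hm j).2 x hx
    omega

/-- A set that can be completed to a primitive set and does not consist of slack points only has
exactly two completions. -/
theorem card_completions {ρ : I → Y → ℕ} (hρ : ∀ i, Function.Injective (ρ i))
    {s : I → Y} (hmin : ∀ i y, ρ i (s i) ≤ ρ i y)
    (hlarge : ∀ i j y, y ∉ Set.range s → j ≠ i → ρ i y < ρ i (s j))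
    {τ : Finset Y} (hτ : τ.card + 1 = Fintype.card I) (hns : ∃ x ∈ τ, x ∉ Set.range s)
    {x₀ : Y} (hx₀ : x₀ ∉ τ) (hP₀ : Primitive ρ (insert x₀ τ)) :
    (univ.filter fun y => y ∉ τ ∧ Primitive ρ (insert y τ)).card = 2 := by
  obtain ⟨v, hvτ, hvs⟩ := hns
  have hex : ∀ i, ∃ x, x ∈ τ ∧ ∀ x' ∈ τ, ρ i x ≤ ρ i x' := fun i =>
    let ⟨x, h1, h2⟩ := exists_min_image τ (ρ i) ⟨v, hvτ⟩
    ⟨x, h1, h2⟩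
  choose m hm using hex
  have hd : ∀ y, ∃ i, ρ i y ≤ ρ i (m i) := fun y =>
    let ⟨i, hi⟩ := hP₀.2 y
    ⟨i, hi _ (mem_insert_of_mem (hm i).1)⟩
  obtain ⟨j, hsj, hyj, -⟩ := exists_role hρ hm hx₀ hP₀
  -- Since `τ` has one point fewer than there are rankings, exactly one of its points is the minimum
  -- of two rankings, `j` and `k`. A completing point takes over one of these two, which accounts
  -- for the two completions.
  obtain ⟨k, hkj, hk⟩ := hsj (m j) (hm j).1
  have hinj : ∀ i i', i ≠ j → i' ≠ j → m i = m i' → i = i' := by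
    have hsurj : Set.SurjOn m ↑(univ.erase j) (τ : Set Y) := by
      intro x hx
      obtain ⟨i, hi, h⟩ := hsj x hx
      exact ⟨i, by simp [hi], h⟩
    have := Finset.injOn_of_surjOn_of_card_le m (s := univ.erase j) (t := τ)
      (fun i _ => (hm i).1) hsurj (by rw [card_erase_of_mem (mem_univ _), card_univ]; omega)
    intro i i' hi hi' h
    exact this (by simp [hi]) (by simp [hi']) h
  have hsk : ∀ x ∈ τ, ∃ i, i ≠ k ∧ m i = x := by
    intro x hx
    obtain ⟨i, hi, h⟩ := hsj x hx
    by_cases hik : i = k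
    · exact ⟨j, hkj.symm, by rw [← hk, ← hik, h]⟩
    · exact ⟨i, hik, h⟩
  have hroles : ∀ l, (∀ x ∈ τ, ∃ i, i ≠ l ∧ m i = x) → l = j ∨ l = k := by
    intro l hl
    by_contra! hlc
    obtain ⟨i, hil, hi⟩ := hl (m l) (hm l).1
    by_cases hij : i = j
    · rw [hij, ← hk] at hi
      exact hlc.2 (hinj _ _ hlc.1 hkj hi.symm)
    · exact hil (hinj _ _ hij hlc.1 hi)
  -- The role `k` can be filled, because the slack point `s k` qualifies; the nonslack point `v` of
  -- `τ` is what keeps the minima below it.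
  have hslack : ∀ i, i ≠ k → ρ i (m i) < ρ i (s k) := by
    intro i hi
    by_cases h : m i ∈ Set.range s
    · obtain ⟨l, hl⟩ := h
      by_cases hli : l = i
      · rw [← hl, hli]
        refine lt_of_le_of_ne (hmin _ _) fun h => ?_
        have h' : s i = s k := hρ _ h
        rw [hli, h'] at hl
        by_cases hvk : ρ k v = ρ k (s k)
        · exact hvs ⟨k, (hρ _ hvk).symm⟩
        · have h1 := hlarge k i v hvs hi
          rw [h'] at h1
          exact absurd (hmin k v) (not_le.2 h1)
      · have h1 := hlarge i l v hvs hli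
        rw [hl] at h1
        exact absurd ((hm i).2 v hvτ) (not_le.2 h1)
    · exact hlarge i k _ h (Ne.symm hi)
  have hmaxex : ∀ l, (∃ y, ∀ i, i ≠ l → ρ i (m i) < ρ i y) → ∃ y,
      (∀ i, i ≠ l → ρ i (m i) < ρ i y) ∧
        ∀ z, (∀ i, i ≠ l → ρ i (m i) < ρ i z) → ρ l z ≤ ρ l y := by
    rintro l ⟨y, hy⟩
    obtain ⟨y', h1, h2⟩ := exists_max_image
      (univ.filter fun y => ∀ i, i ≠ l → ρ i (m i) < ρ i y) (ρ l) ⟨y, by simpa using hy⟩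
    exact ⟨y', by simpa using h1, fun z hz => h2 z (by simpa using hz)⟩
  obtain ⟨y₁, hy₁, hmax₁⟩ := hmaxex j ⟨x₀, hyj⟩
  obtain ⟨y₂, hy₂, hmax₂⟩ := hmaxex k ⟨s k, hslack⟩
  have hne : y₁ ≠ y₂ := by
    rintro rfl
    obtain ⟨i, hi⟩ := hd y₁
    by_cases hij : i = j
    · exact absurd hi (not_le.2 (hy₂ i (by rw [hij]; exact hkj.symm)))
    · exact absurd hi (not_le.2 (hy₁ i hij))
  rw [card_eq_two]
  refine ⟨y₁, y₂, hne, ?_⟩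
  ext y
  simp only [mem_filter, mem_univ, true_and, mem_insert, mem_singleton]
  constructor
  · rintro ⟨hyτ, hP⟩
    obtain ⟨l, h1, h2, h3⟩ := exists_role hρ hm hyτ hP
    rcases hroles l h1 with rfl | rfl
    · exact Or.inl (hρ _ (le_antisymm (hmax₁ y h2) (h3 _ hy₁)))
    · exact Or.inr (hρ _ (le_antisymm (hmax₂ y h2) (h3 _ hy₂)))
  · rintro (rfl | rfl)
    · exact primitive_of_role hτ hm hd hsj hy₁ hmax₁
    · exact primitive_of_role hτ hm hd hsk hy₂ hmax₂

/-- The slack points other than `s i₀` have exactly one completion. -/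
theorem card_completions_slack {ρ : I → Y → ℕ} (hρ : ∀ i, Function.Injective (ρ i))
    {s : I → Y} (hs : Function.Injective s)
    (hmin : ∀ i y, ρ i (s i) ≤ ρ i y)
    (hlarge : ∀ i j y, y ∉ Set.range s → j ≠ i → ρ i y < ρ i (s j))
    (hns : ∃ v, v ∉ Set.range s) (i₀ : I) :
    (univ.filter fun y => y ∉ (univ.erase i₀).image s ∧
      Primitive ρ (insert y ((univ.erase i₀).image s))).card = 1 := by
  obtain ⟨v, hv⟩ := hns
  -- The only completion is the nonslack point that `i₀` ranks highest: every other ranking already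
  -- has its minimum at its own slack point.
  obtain ⟨y₀, hy₀, hmax⟩ := exists_max_image (univ.filter fun y => y ∉ Set.range s) (ρ i₀)
    ⟨v, by simpa using hv⟩
  have hy₀' : y₀ ∉ Set.range s := (mem_filter.1 hy₀).2
  have hcard : ((univ.erase i₀).image s).card + 1 = Fintype.card I := by
    rw [card_image_of_injective _ hs, card_erase_of_mem (mem_univ _), card_univ]
    have : 0 < Fintype.card I := Fintype.card_pos_iff.2 ⟨i₀⟩
    omega
  have hnot : ∀ y, y ∉ Set.range s → y ∉ (univ.erase i₀).image s := by
    intro y hy h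
    obtain ⟨i, -, rfl⟩ := mem_image.1 h
    exact hy ⟨i, rfl⟩
  have hlt : ∀ i y, y ∉ Set.range s → ρ i (s i) < ρ i y := fun i y hy =>
    lt_of_le_of_ne (hmin i y) fun h => hy ⟨i, hρ _ h⟩
  rw [card_eq_one]
  refine ⟨y₀, ?_⟩
  ext y
  simp only [mem_filter, mem_univ, true_and, mem_singleton]
  constructor
  · rintro ⟨hy, hP⟩
    have hy' : y ∉ Set.range s := by
      rintro ⟨i, rfl⟩
      have hi : i = i₀ := by
        by_contra h
        exact hy (mem_image_of_mem _ (by simp [h]))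
      subst hi
      obtain ⟨j, hj⟩ := hP.2 v
      have : s j ∈ insert (s i) ((univ.erase i).image s) := by
        by_cases h : j = i
        · rw [h]; exact mem_insert_self _ _
        · exact mem_insert_of_mem (mem_image_of_mem _ (by simp [h]))
      exact absurd (hj _ this) (not_le.2 (hlt j v hv))
    obtain ⟨j, hj⟩ := hP.2 y₀
    have hji : j = i₀ := by
      by_contra h
      exact absurd (hj (s j) (mem_insert_of_mem (mem_image_of_mem _ (by simp [h]))))
        (not_le.2 (hlt j y₀ hy₀'))
    subst hji
    exact hρ _ (le_antisymm (hmax y (by simpa using hy')) (hj y (mem_insert_self _ _)))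
  · rintro rfl
    refine ⟨hnot _ hy₀', by rw [card_insert_of_notMem (hnot _ hy₀'), hcard], fun z => ?_⟩
    by_cases hz : z ∈ Set.range s
    · obtain ⟨j, rfl⟩ := hz
      exact ⟨j, fun x _ => hmin j x⟩
    · refine ⟨i₀, fun x hx => ?_⟩
      have hzy := hmax z (by simpa using hz)
      rcases mem_insert.1 hx with rfl | hx
      · exact hzy
      · obtain ⟨i, hi, rfl⟩ := mem_image.1 hx
        exact (hlarge i₀ i z hz (by simpa using hi)).le

omit [Fintype Y] in
/-- In a set with as many points as labels, the number of points whose removal leaves exactly the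
labels other than `i₀` is odd if and only if all labels occur. -/
theorem odd_card_removals (ℓ : Y → I) (i₀ : I) {P : Finset Y} (hP : P.card = Fintype.card I) :
    Odd (P.filter fun x => (P.erase x).image ℓ = univ.erase i₀).card ↔ P.image ℓ = univ := by
  have hinjE : ∀ x ∈ P, (P.erase x).image ℓ = univ.erase i₀ → Set.InjOn ℓ ↑(P.erase x) := by
    intro x hx h
    rw [← card_image_iff, h, card_erase_of_mem (mem_univ _), card_erase_of_mem hx, hP, card_univ]
  constructor
  · intro hodd
    obtain ⟨x, hx⟩ := card_pos.1 hodd.pos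
    by_contra hne
    obtain ⟨hxP, hxe⟩ := mem_filter.1 hx
    have hins : P.image ℓ = insert (ℓ x) (univ.erase i₀) := by
      rw [← hxe, ← image_insert, insert_erase hxP]
    have hxi : ℓ x ≠ i₀ := by
      intro h
      rw [h, insert_erase (mem_univ _)] at hins
      exact hne hins
    -- Here `i₀` is missing, so one label occurs twice, at `x` and `x'`. Exactly these two points
    -- can be removed, an even number.
    have : ℓ x ∈ (P.erase x).image ℓ := by rw [hxe]; simp [hxi]
    obtain ⟨x', hx', hxx⟩ := mem_image.1 this
    have hinj := hinjE x hxP hxe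
    have hx'P := mem_of_mem_erase hx'
    have hx'x : x' ≠ x := ne_of_mem_erase hx'
    have himg : (P.erase x').image ℓ = univ.erase i₀ := by
      rw [← hxe]
      ext l
      simp only [mem_image, mem_erase]
      constructor
      · rintro ⟨z, ⟨hz, hzP⟩, rfl⟩
        by_cases hzx : z = x
        · exact ⟨x', ⟨hx'x, hx'P⟩, by rw [hxx, hzx]⟩
        · exact ⟨z, ⟨hzx, hzP⟩, rfl⟩
      · rintro ⟨z, ⟨hz, hzP⟩, rfl⟩
        by_cases hzx : z = x'
        · exact ⟨x, ⟨hx'x.symm, hxP⟩, by rw [hzx, hxx]⟩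
        · exact ⟨z, ⟨hzx, hzP⟩, rfl⟩
    have h2 : (P.filter fun x => (P.erase x).image ℓ = univ.erase i₀) = {x, x'} := by
      ext z
      simp only [mem_filter, mem_insert, mem_singleton]
      constructor
      · rintro ⟨hzP, hz⟩
        by_contra! hzc
        have h1 : ℓ z ∈ (P.erase z).image ℓ := by
          rw [hz, ← hxe]
          exact mem_image_of_mem _ (mem_erase.2 ⟨hzc.1, hzP⟩)
        obtain ⟨w, hw, hwz⟩ := mem_image.1 h1
        have hwz' := ne_of_mem_erase hw
        by_cases hwx : w = x
        · rw [hwx, ← hxx] at hwz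
          exact hzc.2 (hinj hx' (mem_erase.2 ⟨hzc.1, hzP⟩) hwz).symm
        · exact hwz' (hinj (mem_erase.2 ⟨hwx, mem_of_mem_erase hw⟩)
            (mem_erase.2 ⟨hzc.1, hzP⟩) hwz)
      · rintro (rfl | rfl)
        · exact ⟨hxP, hxe⟩
        · exact ⟨hx'P, himg⟩
    rw [h2, card_pair hx'x.symm] at hodd
    exact absurd hodd (by decide)
  · intro h
    have hinj : Set.InjOn ℓ ↑P := by
      rw [← card_image_iff, h, hP, card_univ]
    obtain ⟨x, hx, hxi⟩ := mem_image.1 (h ▸ mem_univ i₀ : i₀ ∈ P.image ℓ)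
    have : (P.filter fun x => (P.erase x).image ℓ = univ.erase i₀) = {x} := by
      ext z
      simp only [mem_filter, mem_singleton]
      constructor
      · rintro ⟨hz, he⟩
        by_contra hzx
        have : i₀ ∈ (P.erase z).image ℓ := mem_image.2 ⟨x, mem_erase.2 ⟨Ne.symm hzx, hx⟩, hxi⟩
        rw [he] at this
        simp at this
      · rintro rfl
        refine ⟨hx, ?_⟩
        ext l
        simp only [mem_image, mem_erase, mem_univ, and_true]
        constructor
        · rintro ⟨w, ⟨hw, hwP⟩, rfl⟩ hc
          exact hw (hinj hwP hx (hc.trans hxi.symm))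
        · intro hl
          obtain ⟨w, hw, hwl⟩ := mem_image.1 (h ▸ mem_univ l : l ∈ P.image ℓ)
          exact ⟨w, ⟨fun hc => hl (by rw [← hwl, hc, hxi]), hw⟩, hwl⟩
    rw [this]
    simp

/-- **Scarf's lemma**: some primitive set carries all labels. -/
theorem exists_primitive_image_eq_univ [Nonempty I] {ρ : I → Y → ℕ} (hρ : ∀ i, Function.Injective (ρ i))
    {s : I → Y} (hs : Function.Injective s)
    (hmin : ∀ i y, ρ i (s i) ≤ ρ i y)
    (hlarge : ∀ i j y, y ∉ Set.range s → j ≠ i → ρ i y < ρ i (s j))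
    (hns : ∃ v, v ∉ Set.range s) (ℓ : Y → I) (hℓ : ∀ i, ℓ (s i) = i) :
    ∃ P, Primitive ρ P ∧ P.image ℓ = univ := by
  classical
  obtain ⟨i₀⟩ := ‹Nonempty I›
  -- Incidences between primitive sets (rooms) and sets with all labels but `i₀` (doors) are counted
  -- twice. The slack door `τ₀` opens to one room, any other door to none or two; so the total is
  -- odd, and some room has an odd number of doors.
  set rooms : Finset (Finset Y) := univ.filter (Primitive ρ)
  set doors : Finset (Finset Y) := univ.filter fun τ =>
    τ.card + 1 = Fintype.card I ∧ τ.image ℓ = univ.erase i₀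
  have hcount := sum_card_bipartiteAbove_eq_sum_card_bipartiteBelow (s := rooms) (t := doors)
    (fun P τ => ∃ x ∈ P, P.erase x = τ)
  have hroom : ∀ P ∈ rooms, (bipartiteAbove (fun P τ => ∃ x ∈ P, P.erase x = τ) doors P).card =
      (P.filter fun x => (P.erase x).image ℓ = univ.erase i₀).card := by
    intro P hP
    have hP' : Primitive ρ P := (mem_filter.1 hP).2
    symm
    refine card_bij (fun x _ => P.erase x) ?_ ?_ ?_
    · intro x hx
      obtain ⟨hxP, hxe⟩ := mem_filter.1 hx
      refine mem_filter.2 ⟨mem_filter.2 ⟨mem_univ _, ?_, hxe⟩, x, hxP, rfl⟩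
      rw [card_erase_add_one hxP, hP'.1]
    · intro x hx x' hx' h
      by_contra hne
      have : x ∈ P.erase x' := mem_erase.2 ⟨hne, (mem_filter.1 hx).1⟩
      rw [← h] at this
      simp at this
    · intro τ hτ
      obtain ⟨hτ1, x, hx, rfl⟩ := mem_filter.1 hτ
      exact ⟨x, mem_filter.2 ⟨hx, (mem_filter.1 hτ1).2.2⟩, rfl⟩
  have hdoor : ∀ τ ∈ doors, (bipartiteBelow (fun P τ => ∃ x ∈ P, P.erase x = τ) rooms τ).card =
      (univ.filter fun y => y ∉ τ ∧ Primitive ρ (insert y τ)).card := by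
    intro τ hτ
    symm
    refine card_bij (fun y _ => insert y τ) ?_ ?_ ?_
    · intro y hy
      obtain ⟨-, hyτ, hP⟩ := mem_filter.1 hy
      exact mem_filter.2 ⟨mem_filter.2 ⟨mem_univ _, hP⟩, y, mem_insert_self _ _,
        erase_insert hyτ⟩
    · intro y hy y' hy' h
      have : y ∈ insert y' τ := h ▸ mem_insert_self y τ
      exact (mem_insert.1 this).resolve_right (mem_filter.1 hy).2.1
    · intro P hP
      obtain ⟨hP1, x, hx, rfl⟩ := mem_filter.1 hP
      refine ⟨x, mem_filter.2 ⟨mem_univ _, notMem_erase _ _, ?_⟩, insert_erase hx⟩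
      rw [insert_erase hx]
      exact (mem_filter.1 hP1).2
  rw [sum_congr rfl hroom, sum_congr rfl hdoor] at hcount
  set τ₀ : Finset Y := (univ.erase i₀).image s
  have hcard₀ : τ₀.card + 1 = Fintype.card I := by
    rw [card_image_of_injective _ hs, card_erase_of_mem (mem_univ _), card_univ]
    have : 0 < Fintype.card I := Fintype.card_pos_iff.2 ⟨i₀⟩
    omega
  have hτ₀ : τ₀ ∈ doors := by
    refine mem_filter.2 ⟨mem_univ _, hcard₀, ?_⟩
    rw [image_image]
    have : ℓ ∘ s = id := funext hℓ
    rw [this, image_id]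
  have hdoor_even : ∀ τ ∈ doors.erase τ₀,
      Even (univ.filter fun y => y ∉ τ ∧ Primitive ρ (insert y τ)).card := by
    intro τ hτ
    obtain ⟨hne, hτd⟩ := mem_erase.1 hτ
    obtain ⟨-, hc, himg⟩ := mem_filter.1 hτd
    rcases Finset.eq_empty_or_nonempty (univ.filter fun y => y ∉ τ ∧ Primitive ρ (insert y τ))
      with h | ⟨x₀, hx₀⟩
    · rw [h]; simp
    · have hns' : ∃ x ∈ τ, x ∉ Set.range s := by
        by_contra! hall
        apply hne
        refine eq_of_subset_of_card_le ?_ (by omega)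
        intro x hx
        obtain ⟨i, rfl⟩ := hall x hx
        have : ℓ (s i) ∈ τ.image ℓ := mem_image_of_mem _ hx
        rw [himg, hℓ] at this
        exact mem_image_of_mem _ this
      rw [card_completions hρ hmin hlarge hc hns' (mem_filter.1 hx₀).2.1 (mem_filter.1 hx₀).2.2]
      exact even_two
  have hodd : Odd (∑ P ∈ rooms,
      (P.filter fun x => (P.erase x).image ℓ = univ.erase i₀).card) := by
    rw [hcount, ← add_sum_erase _ _ hτ₀, card_completions_slack hρ hs hmin hlarge hns i₀]
    exact odd_one.add_even (even_sum _ hdoor_even)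
  by_contra! hnone
  refine (Nat.not_odd_iff_even.2 (even_sum _ fun P hP => ?_)) hodd
  have hP' : Primitive ρ P := (mem_filter.1 hP).2
  rw [← Nat.not_odd_iff_even, odd_card_removals ℓ i₀ hP'.1]
  exact hnone P hP'

end Scarf

/-! ### From Scarf's lemma to fixed points and a Ky Fan type theorem -/

open Filter Topology in
/-- A Brouwer type theorem on the standard simplex: approximate solutions on fine grids. -/
theorem Scarf.exists_approx {I : Type*} [Fintype I] [DecidableEq I] [Nonempty I]
    (H : (I → ℝ) → I → ℝ) (hH : ∀ x ∈ stdSimplex ℝ I, ∃ i, 0 ≤ H x i) (m : ℕ) (hm : 0 < m) :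
    ∃ z ∈ stdSimplex ℝ I, ∀ i, z i ≤ Fintype.card I / m ∨
      ∃ w ∈ stdSimplex ℝ I, dist w z ≤ Fintype.card I / m ∧ 0 ≤ H w i := by
  classical
  have hm' : (0 : ℝ) < m := by exact_mod_cast hm
  let X := {x : I → ℕ // x ∈ Finset.piAntidiag Finset.univ m}
  have hX : ∀ x : X, ∑ i, x.1 i = m := fun x => (Finset.mem_piAntidiag.1 x.2).1
  let pt : X → I → ℝ := fun x i => x.1 i / m
  have hpt : ∀ x, pt x ∈ stdSimplex ℝ I := by
    intro x
    refine ⟨fun i => by positivity, ?_⟩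
    simp only [pt]
    rw [← Finset.sum_div, ← Nat.cast_sum, hX]
    field_simp
  choose lab hlab using fun x : X => hH (pt x) (hpt x)
  let _ : Fintype X := Finset.fintypeCoeSort _
  let Y := X ⊕ I
  let _ : Fintype Y := instFintypeSum X I
  let e : Y ≃ Fin (Fintype.card Y) := Fintype.equivFin Y
  set N := Fintype.card Y with hN
  -- Ranking `i` orders grid points by coordinate `i`; slack point `i` is at its bottom, and the
  -- other slack points, at `m + 2`, are above every grid point. In `ρ` the summand `e y < N` breaks
  -- ties.
  let v : I → Y → ℕ := fun i => Sum.elim (fun x => x.1 i + 1) (fun j => if j = i then 0 else m + 2)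
  let ρ : I → Y → ℕ := fun i y => v i y * N + e y
  have hρv : ∀ i y y', v i y < v i y' → ρ i y < ρ i y' := by
    intro i y y' h
    have h1 := (e y).2
    have : (v i y + 1) * N ≤ v i y' * N := Nat.mul_le_mul_right _ h
    simp only [ρ]
    rw [Nat.add_mul, one_mul] at this
    omega
  have hvρ : ∀ i y y', ρ i y ≤ ρ i y' → v i y ≤ v i y' := fun i y y' h => by
    by_contra! hc
    exact absurd h (not_le.2 (hρv _ _ _ hc))
  have hρ : ∀ i, Function.Injective (ρ i) := by
    intro i y y' h
    have h1 := congrArg (· % N) h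
    simp only [ρ, Nat.mul_add_mod_self_right, Nat.mod_eq_of_lt (e y).2,
      Nat.mod_eq_of_lt (e y').2] at h1
    exact e.injective (Fin.ext h1)
  have hxm : ∀ (x : X) i, x.1 i ≤ m := fun x i => by
    exact (Finset.single_le_sum (f := x.1) (fun _ _ => Nat.zero_le _) (Finset.mem_univ i)).trans
      (hX x).le
  obtain ⟨c₀⟩ := ‹Nonempty I›
  let x₀ : X := ⟨Pi.single c₀ m, by simp [Finset.mem_piAntidiag]⟩
  obtain ⟨P, hP, himg⟩ := Scarf.exists_primitive_image_eq_univ hρ (s := (Sum.inr : I → Y))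
    Sum.inr_injective (by
      intro i y
      by_cases h : y = Sum.inr i
      · rw [h]
      · refine (hρv _ _ _ ?_).le
        rcases y with x | j
        · simp [v]
        · have : j ≠ i := fun hj => h (by rw [hj])
          simp [v, this])
    (by
      intro i j y hy hji
      rcases y with x | k
      · refine hρv _ _ _ ?_
        simp only [v, Sum.elim_inl, Sum.elim_inr, if_neg hji]
        have := hxm x i
        omega
      · exact absurd ⟨k, rfl⟩ hy)
    ⟨Sum.inl x₀, by simp⟩ (Sum.elim lab id) (fun i => rfl)
  have hlabP : ∀ i, Sum.inr i ∉ P → ∃ x : X, Sum.inl x ∈ P ∧ lab x = i := by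
    intro i hi
    obtain ⟨y, hy, h⟩ := Finset.mem_image.1 (himg ▸ Finset.mem_univ i : i ∈ P.image _)
    rcases y with x | j
    · exact ⟨x, hy, h⟩
    · exact absurd ((show j = i from h) ▸ hy) hi
  have hgrid : ∃ i, (Sum.inr i : Y) ∉ P := by
    by_contra! hall
    obtain ⟨i, hi⟩ := hP.2 (Sum.inl x₀)
    have := hvρ _ _ _ (hi _ (hall i))
    simp [v] at this
  obtain ⟨c, hc⟩ := hgrid
  set C : Finset I := Finset.univ.filter fun i => (Sum.inr i : Y) ∉ P with hCdef
  have hcC : c ∈ C := by simp [hCdef, hc]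
  obtain ⟨x₁, hx₁, -⟩ := hlabP c hc
  have hmin : ∀ i, ∃ x : X, Sum.inl x ∈ P ∧ ∀ x' : X, Sum.inl x' ∈ P → x.1 i ≤ x'.1 i := by
    intro i
    obtain ⟨x, hx, h⟩ := Finset.exists_min_image (Finset.univ.filter fun x : X => Sum.inl x ∈ P)
      (fun x => x.1 i) ⟨x₁, by simpa using hx₁⟩
    exact ⟨x, by simpa using hx, fun x' hx' => h x' (by simpa using hx')⟩
  choose μ hμP hμ using hmin
  -- Otherwise the minima with `i ∈ C` can all be raised by one; putting the rest of the mass on `c`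
  -- gives a grid point strictly above the minimum of `P` in every ranking.
  have hsum : m < ∑ i ∈ C, ((μ i).1 i + 1) := by
    by_contra! hle
    let y : I → ℕ := fun i => (if i ∈ C then (μ i).1 i + 1 else 0) +
      if i = c then m - ∑ i ∈ C, ((μ i).1 i + 1) else 0
    have hy : ∑ i, y i = m := by
      simp only [y, Finset.sum_add_distrib, Finset.sum_ite_mem, Finset.univ_inter,
        Finset.sum_ite_eq', Finset.mem_univ, if_true] at hle ⊢
      omega
    obtain ⟨i, hi⟩ := hP.2 (Sum.inl ⟨y, by simp [Finset.mem_piAntidiag, hy]⟩)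
    by_cases hiC : i ∈ C
    · have := hvρ _ _ _ (hi _ (hμP i))
      simp only [v, Sum.elim_inl, y, if_pos hiC] at this
      omega
    · have hiP : (Sum.inr i : Y) ∈ P := by simpa [hCdef] using hiC
      have := hvρ _ _ _ (hi _ hiP)
      simp [v] at this
  -- By `hsum`, a grid point of `P` exceeds the minima by less than `card I` in total, so all grid
  -- points of `P` are close together.
  have hbound : ∀ x : X, Sum.inl x ∈ P →
      ∀ i, x.1 i ≤ (if i ∈ C then (μ i).1 i else 0) + Fintype.card I := by
    intro x hx i
    have h1 : ∀ j, (if j ∈ C then (μ j).1 j else 0) ≤ x.1 j := by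
      intro j
      split_ifs
      · exact hμ j x hx
      · exact Nat.zero_le _
    have h2 : ∑ j ∈ Finset.univ.erase i, (if j ∈ C then (μ j).1 j else 0) ≤
        ∑ j ∈ Finset.univ.erase i, x.1 j := Finset.sum_le_sum fun j _ => h1 j
    have h3 := Finset.add_sum_erase Finset.univ x.1 (Finset.mem_univ i)
    have h4 := Finset.add_sum_erase Finset.univ (fun j => if j ∈ C then (μ j).1 j else 0)
      (Finset.mem_univ i)
    rw [hX] at h3
    have h6 : ∑ j, (if j ∈ C then (μ j).1 j else 0) = ∑ j ∈ C, (μ j).1 j := by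
      rw [Finset.sum_ite_mem, Finset.univ_inter]
    rw [Finset.sum_add_distrib, Finset.sum_const, smul_eq_mul, mul_one] at hsum
    have h5 : C.card ≤ Fintype.card I := Finset.card_le_univ C
    omega
  refine ⟨pt x₁, hpt x₁, fun i => ?_⟩
  by_cases hiC : i ∈ C
  · right
    obtain ⟨x, hx, hxi⟩ := hlabP i (by simpa [hCdef] using hiC)
    refine ⟨pt x, hpt x, ?_, hxi ▸ hlab x⟩
    rw [dist_pi_le_iff (by positivity)]
    intro j
    simp only [pt]
    rw [Real.dist_eq, ← sub_div, abs_div, abs_of_pos hm']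
    gcongr
    have b1 := hbound x hx j
    have b2 := hbound x₁ hx₁ j
    have h1 : (if j ∈ C then (μ j).1 j else 0) ≤ x.1 j := by
      split_ifs
      · exact hμ j x hx
      · exact Nat.zero_le _
    have h2 : (if j ∈ C then (μ j).1 j else 0) ≤ x₁.1 j := by
      split_ifs
      · exact hμ j x₁ hx₁
      · exact Nat.zero_le _
    rw [abs_le]
    constructor
    · have : x₁.1 j ≤ x.1 j + Fintype.card I := by omega
      have : (x₁.1 j : ℝ) ≤ x.1 j + Fintype.card I := by exact_mod_cast this
      linarith
    · have : x.1 j ≤ x₁.1 j + Fintype.card I := by omega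
      have : (x.1 j : ℝ) ≤ x₁.1 j + Fintype.card I := by exact_mod_cast this
      linarith
  · left
    have b := hbound x₁ hx₁ i
    rw [if_neg hiC, zero_add] at b
    simp only [pt]
    gcongr

open Filter Topology in
-- A limit point of the approximate solutions works: where its coordinate is positive, the
-- coordinate eventually exceeds the mesh bound, so points with `H · i ≥ 0` converge to it.
theorem Scarf.exists_simplex {I : Type*} [Fintype I] [Nonempty I]
    (H : (I → ℝ) → I → ℝ) (hc : ContinuousOn H (stdSimplex ℝ I))
    (hH : ∀ x ∈ stdSimplex ℝ I, ∃ i, 0 ≤ H x i) :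
    ∃ z ∈ stdSimplex ℝ I, ∀ i, z i = 0 ∨ 0 ≤ H z i := by
  classical
  choose z hz hzi using fun m : ℕ => Scarf.exists_approx H hH (m + 1) m.succ_pos
  obtain ⟨a, ha, φ, hφ, hlim⟩ := (isCompact_stdSimplex ℝ I).tendsto_subseq hz
  have hsmall : Tendsto (fun m : ℕ => (Fintype.card I : ℝ) / ((m + 1 : ℕ) : ℝ)) atTop (𝓝 0) := by
    have := tendsto_const_div_atTop_nhds_zero_nat (Fintype.card I : ℝ)
    exact (tendsto_add_atTop_iff_nat 1).2 this
  refine ⟨a, ha, fun i => ?_⟩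
  by_contra! hcon
  have hpos : 0 < a i := lt_of_le_of_ne (ha.1 i) hcon.1.symm
  have hev : ∀ᶠ k in atTop, ∃ w ∈ stdSimplex ℝ I,
      dist w (z (φ k)) ≤ Fintype.card I / ((φ k + 1 : ℕ) : ℝ) ∧ 0 ≤ H w i := by
    have h1 : Tendsto (fun k => z (φ k) i) atTop (𝓝 (a i)) :=
      ((continuous_apply i).tendsto a).comp hlim
    have h2 := hsmall.comp hφ.tendsto_atTop
    filter_upwards [h2.eventually_lt h1 hpos] with k hk
    exact (hzi (φ k) i).resolve_left (not_le.2 hk)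
  -- Witnesses are known to exist only for large `k`; elsewhere `w` takes the default value `a`.
  have hch : ∀ k, ∃ w, (∃ w ∈ stdSimplex ℝ I,
      dist w (z (φ k)) ≤ Fintype.card I / ((φ k + 1 : ℕ) : ℝ) ∧ 0 ≤ H w i) →
      w ∈ stdSimplex ℝ I ∧
      dist w (z (φ k)) ≤ Fintype.card I / ((φ k + 1 : ℕ) : ℝ) ∧ 0 ≤ H w i := by
    intro k
    by_cases h : ∃ w ∈ stdSimplex ℝ I,
      dist w (z (φ k)) ≤ Fintype.card I / ((φ k + 1 : ℕ) : ℝ) ∧ 0 ≤ H w i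
    · obtain ⟨w, hw⟩ := h
      exact ⟨w, fun _ => hw⟩
    · exact ⟨a, fun h' => absurd h' h⟩
  choose w hw using hch
  have hwa : Tendsto w atTop (𝓝 a) := by
    have h2 := hsmall.comp hφ.tendsto_atTop
    have h3 : Tendsto (fun k => dist (w k) (z (φ k))) atTop (𝓝 0) := by
      refine tendsto_of_tendsto_of_tendsto_of_le_of_le' tendsto_const_nhds h2
        (Eventually.of_forall fun k => dist_nonneg) ?_
      filter_upwards [hev] with k hk
      exact (hw k hk).2.1
    refine tendsto_iff_dist_tendsto_zero.2 ?_
    have h4 := tendsto_iff_dist_tendsto_zero.1 hlim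
    refine squeeze_zero (fun k => dist_nonneg) (fun k => dist_triangle _ (z (φ k)) _) ?_
    simpa using h3.add h4
  have hwin : Tendsto w atTop (𝓝[stdSimplex ℝ I] a) := by
    refine tendsto_nhdsWithin_iff.2 ⟨hwa, ?_⟩
    filter_upwards [hev] with k hk
    exact (hw k hk).1
  have hHl : Tendsto (fun k => H (w k) i) atTop (𝓝 (H a i)) :=
    ((continuous_apply i).tendsto (H a)).comp ((hc a ha).tendsto.comp hwin)
  refine absurd (ge_of_tendsto hHl ?_) (not_le.2 hcon.2)
  filter_upwards [hev] with k hk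
  exact (hw k hk).2.2

/-- A finite-dimensional equilibrium theorem: if the average of the gains `F x i`, weighted with
`x i`, is never positive, then at some `x` no gain is positive. -/
theorem exists_forall_nonpos_of_sum_mul_nonpos {I : Type*} [Fintype I] [Nonempty I]
    (F : (I → ℝ) → I → ℝ) (hc : ContinuousOn F (stdSimplex ℝ I))
    (hF : ∀ x ∈ stdSimplex ℝ I, ∑ i, x i * F x i ≤ 0) :
    ∃ z ∈ stdSimplex ℝ I, ∀ i, F z i ≤ 0 := by
  -- Nash's construction: up to a positive factor, `H` is the displacement of the map that adds the
  -- positive gains to the weights and renormalizes. Its components sum to zero, so at `z`, where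
  -- all of them are nonnegative, they vanish.
  set T : (I → ℝ) → ℝ := fun x => ∑ i, max (F x i) 0
  set H : (I → ℝ) → I → ℝ := fun x i => max (F x i) 0 - x i * T x
  have hsum : ∀ x ∈ stdSimplex ℝ I, ∑ i, H x i = 0 := by
    intro x hx
    simp only [H, Finset.sum_sub_distrib, ← Finset.sum_mul, hx.2, one_mul]
    exact sub_self _
  have hFi : ∀ i, ContinuousOn (fun x => F x i) (stdSimplex ℝ I) := fun i =>
    (continuous_apply i).comp_continuousOn hc
  have hT : ContinuousOn T (stdSimplex ℝ I) :=
    continuousOn_finsetSum _ fun i _ => (hFi i).sup continuousOn_const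
  have hTn : ∀ x, 0 ≤ T x := fun x => Finset.sum_nonneg fun i _ => le_max_right _ _
  obtain ⟨z, hz, h⟩ := Scarf.exists_simplex H
    (continuousOn_pi.2 fun i => ((hFi i).sup continuousOn_const).sub
      ((continuous_apply i).continuousOn.mul hT))
    (fun x hx => by
      by_contra! hcon
      have := Finset.sum_lt_sum_of_nonempty (Finset.univ_nonempty (α := I))
        (fun i _ => hcon i)
      rw [hsum x hx] at this
      simp at this)
  have hH0 : ∀ i, H z i = 0 := by
    have hn : ∀ i ∈ Finset.univ, 0 ≤ H z i := by
      intro i _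
      rcases h i with h | h
      · simp [H, h]
      · exact h
    intro i
    exact (Finset.sum_eq_zero_iff_of_nonneg hn).1 (hsum z hz) i (Finset.mem_univ i)
  refine ⟨z, hz, ?_⟩
  by_contra! hcon
  obtain ⟨j, hj⟩ := hcon
  have hTpos : 0 < T z := lt_of_lt_of_le (lt_max_of_lt_left hj)
    (Finset.single_le_sum (f := fun i => max (F z i) 0) (fun i _ => le_max_right _ _)
      (Finset.mem_univ j))
  -- If some gain were positive, every gain with positive weight would equal `z i * T z`, and the
  -- weighted average would be positive.
  have hpos : ∀ i, z i * F z i = z i * (z i * T z) := by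
    intro i
    have h0 := hH0 i
    simp only [H] at h0
    rcases (hz.1 i).eq_or_lt with h1 | h1
    · rw [← h1]; simp
    · have : 0 < max (F z i) 0 := by
        have : 0 < z i * T z := mul_pos h1 hTpos
        linarith
      have h2 : max (F z i) 0 = F z i := by
        rcases max_choice (F z i) 0 with h3 | h3
        · exact h3
        · rw [h3] at this; exact absurd this (lt_irrefl _)
      rw [h2] at h0
      rw [show F z i = z i * T z by linarith]
  have h1 := hF z hz
  simp only [hpos] at h1
  have h2 : ∀ i ∈ Finset.univ, 0 ≤ z i * (z i * T z) := fun i _ =>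
    mul_nonneg (hz.1 i) (mul_nonneg (hz.1 i) (hTn z))
  have h3 := (Finset.sum_eq_zero_iff_of_nonneg h2).1 (le_antisymm h1 (Finset.sum_nonneg h2))
  have h4 : ∑ i, z i = 0 := Finset.sum_eq_zero fun i hi => by
    have := h3 i hi
    rcases mul_eq_zero.1 this with h | h
    · exact h
    · exact (mul_eq_zero.1 h).resolve_right hTpos.ne'
  rw [hz.2] at h4
  exact one_ne_zero h4

open Filter Topology in
/-- A Ky Fan type theorem: on a compact convex set, if `Φ x` is concave, `Φ · y` is continuous, and
`Φ x x ≤ 0`, then some `x` satisfies `Φ x y ≤ 0` for all `y`. -/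
theorem exists_forall_nonpos_of_concaveOn {V : Type*} [AddCommGroup V] [Module ℝ V]
    [TopologicalSpace V] [ContinuousAdd V] [ContinuousSMul ℝ V] {S : Set V} (hS : IsCompact S)
    (hconv : Convex ℝ S) (hne : S.Nonempty) (Φ : V → V → ℝ)
    (hcont : ∀ y ∈ S, ContinuousOn (fun x => Φ x y) S) (hconc : ∀ x ∈ S, ConcaveOn ℝ S (Φ x))
    (hdiag : ∀ x ∈ S, Φ x x ≤ 0) : ∃ x ∈ S, ∀ y ∈ S, Φ x y ≤ 0 := by
  classical
  have : CompactSpace S := isCompact_iff_compactSpace.1 hS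
  -- By compactness finitely many `y` suffice. Among the mixtures `c t` of these, the
  -- finite-dimensional theorem applies: concavity bounds the average of the gains by the diagonal
  -- value.
  have hfin : ∀ u : Finset S, (Set.univ ∩ ⋂ y ∈ u, {x : S | Φ x y ≤ 0}).Nonempty := by
    intro u
    rcases u.eq_empty_or_nonempty with rfl | hu
    · have := hne.to_subtype
      simp
    have : Nonempty u := hu.to_subtype
    let c : (u → ℝ) → V := fun t => ∑ y, t y • y.1.1
    have hcS : ∀ t ∈ stdSimplex ℝ u, c t ∈ S := fun t ht =>
      hconv.sum_mem (fun i _ => ht.1 i) ht.2 fun i _ => i.1.2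
    have hcc : Continuous c := continuous_finsetSum _ fun y _ =>
      (continuous_apply y).smul continuous_const
    obtain ⟨t, ht, h⟩ := exists_forall_nonpos_of_sum_mul_nonpos
      (fun t y => Φ (c t) y.1.1)
      (continuousOn_pi.2 fun y => (hcont y.1.1 y.1.2).comp hcc.continuousOn hcS)
      (fun t ht => by
        refine le_trans ?_ (hdiag (c t) (hcS t ht))
        have := (hconc (c t) (hcS t ht)).le_map_sum (t := Finset.univ) (w := t)
          (p := fun y : u => y.1.1) (fun i _ => ht.1 i) ht.2 (fun i _ => i.1.2)
        simpa only [smul_eq_mul] using this)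
    refine ⟨⟨c t, hcS t ht⟩, Set.mem_univ _, ?_⟩
    simp only [Set.mem_iInter, Set.mem_ofPred_eq]
    intro y hy
    exact h ⟨y, hy⟩
  obtain ⟨x, -, hx⟩ := isCompact_univ.inter_iInter_nonempty
    (fun y : S => {x : S | Φ x y ≤ 0})
    (fun y => isClosed_le (continuousOn_iff_continuous_domRestrict.1 (hcont y y.2))
      continuous_const) hfin
  refine ⟨x, x.2, fun y hy => ?_⟩
  exact Set.mem_iInter.1 hx ⟨y, hy⟩

/-! ### Behavior strategies as a weak-* compact convex set -/

/-- Behavior strategies as families of functionals on `L²`: the functionals of the single actions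
are positive and add up to integration. -/
def mixedFunctionals {T : Type*} [MeasurableSpace T] (lam : Measure T) (A : Type*) [Fintype A] :
    Set (A → WeakDual ℝ (Lp ℝ 2 lam)) :=
  {φ | (∀ a (g : Lp ℝ 2 lam), 0 ≤ g → 0 ≤ φ a g) ∧ ∀ g : Lp ℝ 2 lam, ∑ a, φ a g = ∫ x, g x ∂lam}

namespace mixedFunctionals

variable {T : Type*} [MeasurableSpace T] {lam : Measure T} [IsProbabilityMeasure lam]
  {A : Type*} [Fintype A]

omit [IsProbabilityMeasure lam] in
theorem apply_le {φ : A → WeakDual ℝ (Lp ℝ 2 lam)} (hφ : φ ∈ mixedFunctionals lam A) (a : A)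
    (g : Lp ℝ 2 lam) (hg : 0 ≤ g) : φ a g ≤ ∫ x, g x ∂lam := by
  rw [← hφ.2 g]
  exact Finset.single_le_sum (f := fun a => φ a g) (fun a _ => hφ.1 a g hg) (Finset.mem_univ a)

/-- Positivity gives `|φ a g| ≤ φ a |g| ≤ ∫ |g|`, and for a probability measure the `L¹` norm is at
most the `L²` norm. -/
theorem abs_apply_le {φ : A → WeakDual ℝ (Lp ℝ 2 lam)} (hφ : φ ∈ mixedFunctionals lam A) (a : A)
    (g : Lp ℝ 2 lam) : |φ a g| ≤ ‖g‖ := by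
  have h1 : |φ a g| ≤ φ a |g| := by
    rw [abs_le]
    have h2 := hφ.1 a (|g| - g) (sub_nonneg.2 (le_abs_self g))
    have h3 := hφ.1 a (|g| + g) (by
      have := add_le_add_left (neg_le_abs g) g
      simpa [add_comm] using this)
    rw [map_sub] at h2
    rw [map_add] at h3
    constructor <;> linarith
  refine h1.trans ((apply_le hφ a _ (abs_nonneg g)).trans ?_)
  have h4 : ∫ x, (|g| : Lp ℝ 2 lam) x ∂lam = ∫ x, ‖g x‖ ∂lam :=
    integral_congr_ae (by
      filter_upwards [Lp.coeFn_abs g] with x hx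
      rw [hx, Real.norm_eq_abs])
  rw [h4, integral_norm_eq_lintegral_enorm (Lp.aestronglyMeasurable g), Lp.norm_def]
  refine ENNReal.toReal_mono (Lp.eLpNorm_ne_top g) ?_
  rw [← eLpNorm_one_eq_lintegral_enorm]
  exact eLpNorm_le_eLpNorm_of_exponent_le (by norm_num) (Lp.aestronglyMeasurable g)

theorem mem_closedBall {φ : A → WeakDual ℝ (Lp ℝ 2 lam)} (hφ : φ ∈ mixedFunctionals lam A)
    (a : A) : φ a ∈ WeakDual.toStrongDual ⁻¹' Metric.closedBall
      (0 : StrongDual ℝ (Lp ℝ 2 lam)) 1 := by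
  rw [Set.mem_preimage, mem_closedBall_zero_iff]
  refine ContinuousLinearMap.opNorm_le_bound _ zero_le_one fun g => ?_
  rw [one_mul]
  exact abs_apply_le hφ a g

/-- Banach–Alaoglu: the defining conditions are weak-* closed, and the functionals lie in the unit
ball. -/
theorem isCompact : IsCompact (mixedFunctionals lam A) := by
  have hK : IsCompact (Set.univ.pi fun _ : A => (WeakDual.toStrongDual ⁻¹' Metric.closedBall
      (0 : StrongDual ℝ (Lp ℝ 2 lam)) 1)) :=
    isCompact_univ_pi fun _ => WeakDual.isCompact_closedBall _ _
  refine hK.of_isClosed_subset ?_ fun φ hφ a _ => mem_closedBall hφ a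
  have hev : ∀ (a : A) (g : Lp ℝ 2 lam),
      Continuous fun φ : A → WeakDual ℝ (Lp ℝ 2 lam) => φ a g := fun a g =>
    (WeakDual.eval_continuous g).comp (continuous_apply a)
  refine IsClosed.inter (s₁ := {φ : A → WeakDual ℝ (Lp ℝ 2 lam) | ∀ a (g : Lp ℝ 2 lam), 0 ≤ g → 0 ≤ φ a g}) ?_ ?_
  · simp only [Set.ofPred_forall]
    exact isClosed_iInter fun a => isClosed_iInter fun g => isClosed_iInter fun _ =>
      isClosed_le continuous_const (hev a g)
  · change IsClosed {φ : A → WeakDual ℝ (Lp ℝ 2 lam) |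
      ∀ g : Lp ℝ 2 lam, ∑ a, φ a g = ∫ x, g x ∂lam}
    simp only [Set.ofPred_forall]
    exact isClosed_iInter fun g =>
      isClosed_eq (continuous_finsetSum _ fun a _ => hev a g) continuous_const

omit [IsProbabilityMeasure lam] in
theorem convex : Convex ℝ (mixedFunctionals lam A) := by
  intro φ hφ ψ hψ s t hs ht hst
  refine ⟨fun a g hg => ?_, fun g => ?_⟩
  · exact add_nonneg (mul_nonneg hs (hφ.1 a g hg)) (mul_nonneg ht (hψ.1 a g hg))
  · change ∑ a, (s * φ a g + t * ψ a g) = _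
    rw [Finset.sum_add_distrib, ← Finset.mul_sum, ← Finset.mul_sum, hφ.2, hψ.2, ← add_mul, hst,
      one_mul]

/-- The functionals of a behavior strategy. -/
theorem exists_of_behavior (s : T → A → ℝ) (hs : Measurable s) (h0 : ∀ x a, 0 ≤ s x a)
    (h1 : ∀ x, ∑ a, s x a = 1) :
    ∃ φ ∈ mixedFunctionals lam A, ∀ a (g : Lp ℝ 2 lam), φ a g = ∫ x, s x a * g x ∂lam := by
  have hle : ∀ x a, s x a ≤ 1 := fun x a => by
    rw [← h1 x]
    exact Finset.single_le_sum (f := s x) (fun a _ => h0 x a) (Finset.mem_univ a)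
  have hL : ∀ a, MemLp (fun x => s x a) 2 lam := fun a =>
    MemLp.of_bound ((measurable_pi_iff.1 hs a).aestronglyMeasurable) 1
      (ae_of_all _ fun x => by rw [Real.norm_eq_abs, abs_of_nonneg (h0 x a)]; exact hle x a)
  let φ : A → WeakDual ℝ (Lp ℝ 2 lam) := fun a =>
    StrongDual.toWeakDual (InnerProductSpace.toDual ℝ (Lp ℝ 2 lam) ((hL a).toLp _))
  have hφ : ∀ a (g : Lp ℝ 2 lam), φ a g = ∫ x, s x a * g x ∂lam := by
    intro a g
    change inner ℝ ((hL a).toLp _) g = _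
    rw [L2.inner_def]
    refine integral_congr_ae ?_
    filter_upwards [(hL a).coeFn_toLp] with x hx
    rw [hx]
    simp [mul_comm]
  have hint : ∀ g : Lp ℝ 2 lam, Integrable (fun x => g x) lam := fun g =>
    (Lp.memLp g).integrable (by norm_num)
  refine ⟨φ, ⟨fun a g hg => ?_, fun g => ?_⟩, hφ⟩
  · rw [hφ]
    refine integral_nonneg_of_ae ?_
    filter_upwards [(Lp.coeFn_nonneg g).2 hg] with x hx
    exact mul_nonneg (h0 x a) hx
  · simp only [hφ]
    rw [← integral_finsetSum]
    · refine integral_congr_ae (ae_of_all _ fun x => ?_)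
      simp only
      rw [← Finset.sum_mul, h1, one_mul]
    · intro a _
      refine (hint g).bdd_mul (c := 1) ((measurable_pi_iff.1 hs a).aestronglyMeasurable)
        (ae_of_all _ fun x => by
        rw [Real.norm_eq_abs, abs_of_nonneg (h0 x a)]; exact hle x a)

theorem nonempty [Nonempty A] : (mixedFunctionals lam A).Nonempty := by
  classical
  obtain ⟨a₀⟩ := ‹Nonempty A›
  obtain ⟨φ, hφ, -⟩ := exists_of_behavior (lam := lam) (fun _ => Pi.single a₀ (1 : ℝ))
    measurable_const (fun _ a => by
      by_cases h : a = a₀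
      · subst h; simp
      · simp [h])
    (fun _ => by simp)
  exact ⟨φ, hφ⟩

/-- Every family of functionals comes from a behavior strategy. -/
theorem exists_behavior [Nonempty A] {φ : A → WeakDual ℝ (Lp ℝ 2 lam)}
    (hφ : φ ∈ mixedFunctionals lam A) :
    ∃ s : T → A → ℝ, Measurable s ∧ (∀ x a, 0 ≤ s x a) ∧ (∀ x, ∑ a, s x a = 1) ∧
      ∀ a (g : Lp ℝ 2 lam), φ a g = ∫ x, s x a * g x ∂lam := by
  classical
  obtain ⟨a₀⟩ := ‹Nonempty A›
  -- The Riesz representatives are the action probabilities; testing on indicators makes them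
  -- nonnegative with sum one almost everywhere.
  let f : A → Lp ℝ 2 lam := fun a =>
    (InnerProductSpace.toDual ℝ (Lp ℝ 2 lam)).symm (WeakDual.toStrongDual (φ a))
  have hf : ∀ a (g : Lp ℝ 2 lam), φ a g = ∫ x, f a x * g x ∂lam := by
    intro a g
    have : φ a g = inner ℝ (f a) g := by
      simp only [f]
      rw [InnerProductSpace.toDual_symm_apply]
      rfl
    rw [this, L2.inner_def]
    exact integral_congr_ae (ae_of_all _ fun x => by simp [mul_comm])
  have hset : ∀ a {U : Set T} (hU : MeasurableSet U),
      φ a (indicatorConstLp 2 hU (measure_ne_top lam U) 1) = ∫ x in U, f a x ∂lam := by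
    intro a U hU
    rw [hf, ← integral_indicator hU]
    refine integral_congr_ae ?_
    filter_upwards [indicatorConstLp_coeFn (p := 2) (hs := hU) (hμs := measure_ne_top lam U)
      (c := (1 : ℝ))] with x hx
    rw [hx]
    by_cases h : x ∈ U <;> simp [h]
  have hint : ∀ g : Lp ℝ 2 lam, Integrable (fun x => g x) lam := fun g =>
    (Lp.memLp g).integrable (by norm_num)
  have h0 : ∀ a, 0 ≤ᵐ[lam] f a := by
    intro a
    refine ae_nonneg_of_forall_setIntegral_nonneg (hint _) fun U hU _ => ?_
    rw [← hset a hU]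
    refine hφ.1 a _ ((Lp.coeFn_nonneg _).1 ?_)
    filter_upwards [indicatorConstLp_coeFn (p := 2) (hs := hU) (hμs := measure_ne_top lam U)
      (c := (1 : ℝ))] with x hx
    rw [hx]
    exact Set.indicator_nonneg (fun _ _ => zero_le_one) _
  have h1 : (fun x => ∑ a, f a x) =ᵐ[lam] fun _ => (1 : ℝ) := by
    refine Integrable.ae_eq_of_forall_setIntegral_eq _ _
      (integrable_finsetSum _ fun a _ => hint (f a)) (integrable_const _) fun U hU _ => ?_
    rw [integral_finsetSum _ fun a _ => (hint (f a)).integrableOn]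
    simp only [← hset _ hU]
    rw [hφ.2]
    have : ∫ x, (indicatorConstLp 2 hU (measure_ne_top lam U) (1 : ℝ)) x ∂lam =
        ∫ x, U.indicator (fun _ => (1 : ℝ)) x ∂lam := integral_congr_ae indicatorConstLp_coeFn
    rw [this, integral_indicator hU]
  have hm : ∀ a, Measurable (f a) := fun a => (Lp.stronglyMeasurable (f a)).measurable
  -- Off the full set `G` the pure action `a₀` is prescribed, so that the constraints hold
  -- everywhere.
  let G : Set T := {x | (∀ a, 0 ≤ f a x) ∧ ∑ a, f a x = 1}
  have hG : MeasurableSet G := by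
    refine MeasurableSet.inter (s₁ := {x | ∀ a, 0 ≤ f a x}) ?_ ?_
    · simp only [Set.ofPred_forall]
      exact MeasurableSet.iInter fun a => measurableSet_le measurable_const (hm a)
    · exact measurableSet_eq_fun (Finset.measurable_fun_sum _ fun a _ => hm a) measurable_const
  have hGae : ∀ᵐ x ∂lam, x ∈ G := by
    filter_upwards [ae_all_iff.2 h0, h1] with x hx hx'
    exact ⟨hx, hx'⟩
  refine ⟨fun x a => G.piecewise (f a) (fun _ => (Pi.single a₀ (1 : ℝ) : A → ℝ) a) x, ?_, ?_, ?_,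
    ?_⟩
  · exact measurable_pi_iff.2 fun a => (hm a).piecewise hG measurable_const
  · intro x a
    beta_reduce
    by_cases hx : x ∈ G
    · rw [Set.piecewise_eq_of_mem _ _ _ hx]
      exact hx.1 a
    · rw [Set.piecewise_eq_of_notMem _ _ _ hx]
      by_cases h : a = a₀
      · subst h; simp
      · simp [h]
  · intro x
    by_cases hx : x ∈ G
    · simp only [Set.piecewise_eq_of_mem _ _ _ hx]
      exact hx.2
    · simp only [Set.piecewise_eq_of_notMem _ _ _ hx]
      simp
  · intro a g
    rw [hf]
    refine integral_congr_ae ?_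
    filter_upwards [hGae] with x hx
    rw [Set.piecewise_eq_of_mem _ _ _ hx]

end mixedFunctionals

/-! ### Equilibria of Bayesian games with conditionally independent signals -/

section BayesianGame

variable {ι : Type*} [Fintype ι] [DecidableEq ι] {A : ι → Type*} [∀ j, Fintype (A j)]
  {T : ι → Type*} [∀ j, MeasurableSpace (T j)] {lam : ∀ j, Measure (T j)}
  {Ω : Type*} [MeasurableSpace Ω]

/-- The expected payoff of player `i` in a game with private signals, when the signal of player `j`
has the density `ℓ j ω` in state `ω`, the opponents use `φ` and player `i` uses `χ`. -/
noncomputable def signalPayoff (P : Measure Ω) (ℓ : ∀ j, Ω → Lp ℝ 2 (lam j))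
    (g : ι → (∀ j, A j) → Ω → ℝ) (i : ι) (φ : ∀ j, A j → WeakDual ℝ (Lp ℝ 2 (lam j)))
    (χ : A i → WeakDual ℝ (Lp ℝ 2 (lam i))) : ℝ :=
  ∫ ω, ∑ a, g i a ω * (χ (a i) (ℓ i ω) * ∏ j ∈ Finset.univ.erase i, φ j (a j) (ℓ j ω)) ∂P

variable [∀ j, IsProbabilityMeasure (lam j)] {P : Measure Ω}
  {ℓ : ∀ j, Ω → Lp ℝ 2 (lam j)} {g : ι → (∀ j, A j) → Ω → ℝ}

omit [Fintype ι] [DecidableEq ι] [MeasurableSpace Ω] [∀ j, IsProbabilityMeasure (lam j)] in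
theorem abs_functional_le_one (h0 : ∀ j ω, 0 ≤ ℓ j ω) (h1 : ∀ j ω, ∫ x, ℓ j ω x ∂(lam j) = 1)
    {j : ι} {φ : A j → WeakDual ℝ (Lp ℝ 2 (lam j))} (hφ : φ ∈ mixedFunctionals (lam j) (A j))
    (a : A j) (ω : Ω) : |φ a (ℓ j ω)| ≤ 1 := by
  rw [abs_of_nonneg (hφ.1 a _ (h0 j ω)), ← h1 j ω]
  exact mixedFunctionals.apply_le hφ a _ (h0 j ω)

omit [MeasurableSpace Ω] [∀ j, IsProbabilityMeasure (lam j)] in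
theorem norm_signal_term_le (h0 : ∀ j ω, 0 ≤ ℓ j ω)
    (h1 : ∀ j ω, ∫ x, ℓ j ω x ∂(lam j) = 1) (i : ι)
    {φ : ∀ j, A j → WeakDual ℝ (Lp ℝ 2 (lam j))}
    (hφ : ∀ j, φ j ∈ mixedFunctionals (lam j) (A j))
    {χ : A i → WeakDual ℝ (Lp ℝ 2 (lam i))} (hχ : χ ∈ mixedFunctionals (lam i) (A i))
    (a : ∀ j, A j) (ω : Ω) :
    ‖g i a ω * (χ (a i) (ℓ i ω) * ∏ j ∈ Finset.univ.erase i, φ j (a j) (ℓ j ω))‖ ≤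
      |g i a ω| := by
  rw [Real.norm_eq_abs, abs_mul, abs_mul, Finset.abs_prod]
  refine mul_le_of_le_one_right (abs_nonneg _) (mul_le_one₀ (abs_functional_le_one h0 h1 hχ _ _)
    (Finset.prod_nonneg fun _ _ => abs_nonneg _) ?_)
  exact Finset.prod_le_one (fun _ _ => abs_nonneg _) fun j _ =>
    abs_functional_le_one h0 h1 (hφ j) _ _

omit [∀ j, Fintype (A j)] [∀ j, IsProbabilityMeasure (lam j)] in
theorem aestronglyMeasurable_signal_term
    (hm : ∀ j (ψ : WeakDual ℝ (Lp ℝ 2 (lam j))), Measurable fun ω => ψ (ℓ j ω))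
    (hg : ∀ i a, Integrable (g i a) P) (i : ι)
    (φ : ∀ j, A j → WeakDual ℝ (Lp ℝ 2 (lam j)))
    (χ : A i → WeakDual ℝ (Lp ℝ 2 (lam i))) (a : ∀ j, A j) :
    AEStronglyMeasurable (fun ω =>
      g i a ω * (χ (a i) (ℓ i ω) * ∏ j ∈ Finset.univ.erase i, φ j (a j) (ℓ j ω))) P :=
  (hg i a).aestronglyMeasurable.mul ((hm i _).mul
    (Finset.measurable_fun_prod _ fun j _ => hm j _)).aestronglyMeasurable

omit [∀ j, IsProbabilityMeasure (lam j)] in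
theorem integrable_signal_term (h0 : ∀ j ω, 0 ≤ ℓ j ω)
    (h1 : ∀ j ω, ∫ x, ℓ j ω x ∂(lam j) = 1)
    (hm : ∀ j (ψ : WeakDual ℝ (Lp ℝ 2 (lam j))), Measurable fun ω => ψ (ℓ j ω))
    (hg : ∀ i a, Integrable (g i a) P) (i : ι)
    {φ : ∀ j, A j → WeakDual ℝ (Lp ℝ 2 (lam j))}
    (hφ : ∀ j, φ j ∈ mixedFunctionals (lam j) (A j))
    {χ : A i → WeakDual ℝ (Lp ℝ 2 (lam i))} (hχ : χ ∈ mixedFunctionals (lam i) (A i))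
    (a : ∀ j, A j) :
    Integrable (fun ω =>
      g i a ω * (χ (a i) (ℓ i ω) * ∏ j ∈ Finset.univ.erase i, φ j (a j) (ℓ j ω))) P :=
  (hg i a).abs.mono' (aestronglyMeasurable_signal_term hm hg i φ χ a)
    (ae_of_all _ fun ω => norm_signal_term_le h0 h1 i hφ hχ a ω)

omit [∀ j, IsProbabilityMeasure (lam j)] in
theorem signalPayoff_smul_add_smul (h0 : ∀ j ω, 0 ≤ ℓ j ω)
    (h1 : ∀ j ω, ∫ x, ℓ j ω x ∂(lam j) = 1)
    (hm : ∀ j (ψ : WeakDual ℝ (Lp ℝ 2 (lam j))), Measurable fun ω => ψ (ℓ j ω))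
    (hg : ∀ i a, Integrable (g i a) P) (i : ι)
    {φ : ∀ j, A j → WeakDual ℝ (Lp ℝ 2 (lam j))}
    (hφ : ∀ j, φ j ∈ mixedFunctionals (lam j) (A j))
    {χ χ' : A i → WeakDual ℝ (Lp ℝ 2 (lam i))} (hχ : χ ∈ mixedFunctionals (lam i) (A i))
    (hχ' : χ' ∈ mixedFunctionals (lam i) (A i)) (s t : ℝ) :
    signalPayoff P ℓ g i φ (s • χ + t • χ') =
      s * signalPayoff P ℓ g i φ χ + t * signalPayoff P ℓ g i φ χ' := by
  have hi := fun a => integrable_signal_term h0 h1 hm hg i hφ hχ a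
  have hi' := fun a => integrable_signal_term h0 h1 hm hg i hφ hχ' a
  rw [signalPayoff, signalPayoff, signalPayoff, ← integral_const_mul, ← integral_const_mul,
    ← integral_add ((integrable_finsetSum _ fun a _ => hi a).const_mul _)
      ((integrable_finsetSum _ fun a _ => hi' a).const_mul _)]
  congr 1
  ext ω
  rw [Finset.mul_sum, Finset.mul_sum, ← Finset.sum_add_distrib]
  refine Finset.sum_congr rfl fun a _ => ?_
  have : (s • χ + t • χ') (a i) (ℓ i ω) = s * χ (a i) (ℓ i ω) + t * χ' (a i) (ℓ i ω) := rfl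
  rw [this]
  ring

omit [∀ j, IsProbabilityMeasure (lam j)] in
open Filter Topology in
-- For a fixed state the payoff is a polynomial in the numbers `φ j a (ℓ j ω)`, each weak-*
-- continuous because the density is a fixed vector of `L²`. Conditional independence thus makes
-- products of weakly convergent strategies converge; dominated convergence does the rest.
theorem tendsto_signalPayoff (h0 : ∀ j ω, 0 ≤ ℓ j ω)
    (h1 : ∀ j ω, ∫ x, ℓ j ω x ∂(lam j) = 1)
    (hm : ∀ j (ψ : WeakDual ℝ (Lp ℝ 2 (lam j))), Measurable fun ω => ψ (ℓ j ω))
    (hg : ∀ i a, Integrable (g i a) P) (i : ι)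
    {φ : ℕ → ∀ j, A j → WeakDual ℝ (Lp ℝ 2 (lam j))}
    (hφ : ∀ n j, φ n j ∈ mixedFunctionals (lam j) (A j))
    {χ : ℕ → A i → WeakDual ℝ (Lp ℝ 2 (lam i))}
    (hχ : ∀ n, χ n ∈ mixedFunctionals (lam i) (A i))
    {φ' : ∀ j, A j → WeakDual ℝ (Lp ℝ 2 (lam j))} {χ' : A i → WeakDual ℝ (Lp ℝ 2 (lam i))}
    (hφl : Tendsto φ atTop (𝓝 φ')) (hχl : Tendsto χ atTop (𝓝 χ')) :
    Tendsto (fun n => signalPayoff P ℓ g i (φ n) (χ n)) atTop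
      (𝓝 (signalPayoff P ℓ g i φ' χ')) := by
  refine tendsto_integral_of_dominated_convergence (fun ω => ∑ a, |g i a ω|)
    (fun n => ?_) (integrable_finsetSum _ fun a _ => (hg i a).abs) (fun n => ?_) ?_
  · exact Finset.aestronglyMeasurable_fun_sum _ fun a _ =>
      aestronglyMeasurable_signal_term hm hg i _ _ a
  · exact ae_of_all _ fun ω => (norm_sum_le _ _).trans
      (Finset.sum_le_sum fun a _ => norm_signal_term_le h0 h1 i (hφ n) (hχ n) a ω)
  · refine ae_of_all _ fun ω => tendsto_finsetSum _ fun a _ => ?_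
    refine tendsto_const_nhds.mul (Tendsto.mul ?_ (tendsto_finsetProd _ fun j _ => ?_))
    · exact ((WeakDual.eval_continuous (ℓ i ω)).tendsto _).comp
        (((continuous_apply (a i)).tendsto χ').comp hχl)
    · exact ((WeakDual.eval_continuous (ℓ j ω)).tendsto _).comp
        (((continuous_apply (a j)).tendsto (φ' j)).comp (((continuous_apply j).tendsto φ').comp hφl))

omit [DecidableEq ι] in
-- With countably generated signal spaces `L²` is separable, so weak-* compact sets are metrizable.
-- Continuity can then be checked along sequences, as dominated convergence requires.
theorem firstCountable_pi_mixedFunctionals [∀ j, MeasurableSpace.CountablyGenerated (T j)] :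
    FirstCountableTopology
      (Set.univ.pi fun j => mixedFunctionals (lam j) (A j) :
        Set (∀ j, A j → WeakDual ℝ (Lp ℝ 2 (lam j)))) := by
  let K : ∀ j, Set (WeakDual ℝ (Lp ℝ 2 (lam j))) := fun j =>
    WeakDual.toStrongDual ⁻¹' Metric.closedBall (0 : StrongDual ℝ (Lp ℝ 2 (lam j))) 1
  have h2 : Fact ((2 : ENNReal) ≠ ⊤) := ⟨by simp⟩
  have : ∀ j, TopologicalSpace.MetrizableSpace (K j) := fun j =>
    WeakDual.metrizable_of_isCompact ℝ (Lp ℝ 2 (lam j)) (K j) (WeakDual.isCompact_closedBall _ _)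
  let e : (Set.univ.pi fun j => mixedFunctionals (lam j) (A j) :
      Set (∀ j, A j → WeakDual ℝ (Lp ℝ 2 (lam j)))) → ∀ j, A j → K j := fun φ j a =>
    ⟨φ.1 j a, mixedFunctionals.mem_closedBall (φ.2 j (Set.mem_univ j)) a⟩
  have he : Topology.IsInducing e := by
    refine Topology.IsInducing.of_comp (g := fun q j a => (q j a).1) ?_ ?_
      Topology.IsInducing.subtypeVal
    · exact continuous_pi fun j => continuous_pi fun a =>
        continuous_induced_rng.2 ((continuous_apply a).comp
          ((continuous_apply j).comp continuous_subtype_val))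
    · exact continuous_pi fun j => continuous_pi fun a => continuous_subtype_val.comp
        ((continuous_apply a).comp (continuous_apply j))
  exact he.firstCountableTopology

/-- Existence of equilibria in behavior strategies, when the signals are independent conditional on
the state and have square integrable densities. -/
theorem exists_signal_equilibrium [∀ j, Nonempty (A j)]
    [∀ j, MeasurableSpace.CountablyGenerated (T j)] (h0 : ∀ j ω, 0 ≤ ℓ j ω)
    (h1 : ∀ j ω, ∫ x, ℓ j ω x ∂(lam j) = 1)
    (hm : ∀ j (ψ : WeakDual ℝ (Lp ℝ 2 (lam j))), Measurable fun ω => ψ (ℓ j ω))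
    (hg : ∀ i a, Integrable (g i a) P) :
    ∃ φ : ∀ j, A j → WeakDual ℝ (Lp ℝ 2 (lam j)),
      (∀ j, φ j ∈ mixedFunctionals (lam j) (A j)) ∧
      ∀ i, ∀ χ ∈ mixedFunctionals (lam i) (A i),
        signalPayoff P ℓ g i φ χ ≤ signalPayoff P ℓ g i φ (φ i) := by
  set S : Set (∀ j, A j → WeakDual ℝ (Lp ℝ 2 (lam j))) :=
    Set.univ.pi fun j => mixedFunctionals (lam j) (A j) with hS
  have hfc : FirstCountableTopology S := firstCountable_pi_mixedFunctionals
  have hmem : ∀ {φ}, φ ∈ S → ∀ j, φ j ∈ mixedFunctionals (lam j) (A j) := fun h j =>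
    h j (Set.mem_univ j)
  -- The Ky Fan function is the sum of the players' gains from unilateral deviations
  -- (Nikaido–Isoda); it is affine in the deviations and zero on the diagonal.
  obtain ⟨φ, hφ, h⟩ := exists_forall_nonpos_of_concaveOn (S := S)
    (isCompact_univ_pi fun j => mixedFunctionals.isCompact)
    (convex_pi fun j _ => mixedFunctionals.convex)
    (Set.univ_pi_nonempty_iff.2 fun j => mixedFunctionals.nonempty)
    (fun φ ψ => ∑ i, (signalPayoff P ℓ g i φ (ψ i) - signalPayoff P ℓ g i φ (φ i)))
    (by
      intro ψ hψ
      rw [continuousOn_iff_continuous_domRestrict, continuous_iff_seqContinuous]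
      intro u u' hu
      have hu' := (continuous_subtype_val.tendsto u').comp hu
      refine tendsto_finsetSum _ fun i _ => Filter.Tendsto.sub ?_ ?_
      · exact tendsto_signalPayoff h0 h1 hm hg i (fun n => hmem (u n).2) (fun _ => hmem hψ i) hu'
          tendsto_const_nhds
      · exact tendsto_signalPayoff h0 h1 hm hg i (fun n => hmem (u n).2)
          (fun n => hmem (u n).2 i) hu' (((continuous_apply i).tendsto _).comp hu'))
    (by
      intro φ hφ
      refine ⟨convex_pi fun j _ => mixedFunctionals.convex, ?_⟩
      intro ψ hψ ψ' hψ' s t hs ht hst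
      simp only [smul_eq_mul, Finset.mul_sum, ← Finset.sum_add_distrib]
      refine Finset.sum_le_sum fun i _ => ?_
      have := signalPayoff_smul_add_smul h0 h1 hm hg i (hmem hφ) (hmem hψ i) (hmem hψ' i) s t
      rw [show (s • ψ + t • ψ') i = s • ψ i + t • ψ' i from rfl, this]
      have e : t = 1 - s := by linarith
      subst e
      apply le_of_eq
      ring)
    (by intro φ _; simp)
  refine ⟨φ, hmem hφ, fun i χ hχ => ?_⟩
  -- A profile that deviates only at `i` isolates the gain of `i` in the sum.
  have hχS : Function.update φ i χ ∈ S := by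
    intro j _
    by_cases hji : j = i
    · subst hji; simpa using hχ
    · simpa [hji] using hmem hφ j
  have := h _ hχS
  rw [Finset.sum_eq_single i] at this
  · simpa using this
  · intro j _ hj
    simp [hj]
  · simp

end BayesianGame

/-! ### Optimal counts for large blocks -/

section QuadraticForm

open Matrix

variable {n : Type*} [Fintype n] [DecidableEq n] {P : Matrix n n ℝ}

omit [Fintype n] in
theorem posDef_add_diagonal (hP : P.PosDef) (q : n → ℕ) :
    (P + diagonal fun k => (q k : ℝ)).PosDef :=
  hP.add_posSemidef (PosSemidef.diagonal fun k => Nat.cast_nonneg (q k))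

theorem exists_solution (hP : P.PosDef) (q : n → ℕ) (w : n → ℝ) :
    ∃ y : n → ℝ, (P + diagonal fun k => (q k : ℝ)) *ᵥ y = w ∧
      (P + diagonal fun k => (q k : ℝ))⁻¹ *ᵥ w = y := by
  refine ⟨_, ?_, rfl⟩
  rw [mulVec_mulVec, mul_nonsing_inv _ ((isUnit_iff_isUnit_det _).1 (posDef_add_diagonal hP q).isUnit),
    one_mulVec]

/-- The value `wᵀ (P + diag q)⁻¹ w`. -/
noncomputable def residualVariance (P : Matrix n n ℝ) (w : n → ℝ) (q : n → ℕ) : ℝ :=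
  w ⬝ᵥ (P + diagonal fun k => (q k : ℝ))⁻¹ *ᵥ w

theorem residualVariance_eq (hP : P.PosDef) {q : n → ℕ} {w y : n → ℝ}
    (hy : (P + diagonal fun k => (q k : ℝ)) *ᵥ y = w) : residualVariance P w q = w ⬝ᵥ y := by
  rw [residualVariance]
  congr 1
  rw [← hy, mulVec_mulVec,
    nonsing_inv_mul _ ((isUnit_iff_isUnit_det _).1 (posDef_add_diagonal hP q).isUnit), one_mulVec]

omit [DecidableEq n] in
theorem dotProduct_mulVec_comm_of_posDef {A : Matrix n n ℝ} (hA : A.PosDef) (x y : n → ℝ) :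
    x ⬝ᵥ A *ᵥ y = (A *ᵥ x) ⬝ᵥ y := by
  have h : Aᵀ = A := by
    have := hA.isHermitian
    rwa [IsHermitian, conjTranspose_eq_transpose_of_trivial] at this
  rw [dotProduct_mulVec, ← mulVec_transpose, h]

omit [DecidableEq n] in
theorem dotProduct_mulVec_nonneg_of_posDef {A : Matrix n n ℝ} (hA : A.PosDef) (x : n → ℝ) :
    0 ≤ x ⬝ᵥ A *ᵥ x := by
  simpa using hA.posSemidef.dotProduct_mulVec_nonneg x

/-- The effect of one more observation. -/
theorem residualVariance_add_single (hP : P.PosDef) {q : n → ℕ} {w y z : n → ℝ} {k : n}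
    (hy : (P + diagonal fun k => (q k : ℝ)) *ᵥ y = w)
    (hz : (P + diagonal fun k => (q k : ℝ)) *ᵥ z = Pi.single k 1) :
    0 ≤ z k ∧
      residualVariance P w (q + Pi.single k 1) = residualVariance P w q - y k ^ 2 / (1 + z k) := by
  have hA := posDef_add_diagonal hP q
  have hzk : 0 ≤ z k := by
    have := dotProduct_mulVec_nonneg_of_posDef hA z
    rwa [hz, dotProduct_single_one] at this
  refine ⟨hzk, ?_⟩
  -- Sherman–Morrison: `y - c • z` solves the system with one more observation of `k`, by the choice
  -- `c * (1 + z k) = y k`.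
  set c := y k / (1 + z k) with hc
  have h1 : 1 + z k ≠ 0 := by positivity
  have hy' : (P + diagonal fun l => ((q + Pi.single k 1 : n → ℕ) l : ℝ)) *ᵥ (y - c • z) = w := by
    have hd : (diagonal fun l => ((q + Pi.single k 1 : n → ℕ) l : ℝ)) =
        (diagonal fun l => (q l : ℝ)) + diagonal (Pi.single k 1) := by
      rw [diagonal_add]
      congr 1
      ext l
      by_cases h : l = k
      · subst h; simp
      · simp [h]
    rw [hd, ← add_assoc, add_mulVec, mulVec_sub, mulVec_smul, hy, hz]
    ext l
    rw [Pi.add_apply, mulVec_diagonal]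
    by_cases h : l = k
    · subst h
      simp only [Pi.sub_apply, Pi.smul_apply, Pi.single_eq_same, smul_eq_mul, mul_one, one_mul]
      have : c * (1 + z l) = y l := by rw [hc]; field_simp
      linarith
    · simp [h]
  rw [residualVariance_eq hP hy', residualVariance_eq hP hy, dotProduct_sub, dotProduct_smul]
  have : w ⬝ᵥ z = y k := by
    rw [← hy, ← dotProduct_mulVec_comm_of_posDef hA, hz, dotProduct_single_one]
  rw [this, hc, smul_eq_mul]
  field_simp

theorem residualVariance_add_single_le (hP : P.PosDef) (w : n → ℝ) (q : n → ℕ) (k : n) :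
    residualVariance P w (q + Pi.single k 1) ≤ residualVariance P w q := by
  obtain ⟨y, hy, -⟩ := exists_solution hP q w
  obtain ⟨z, hz, -⟩ := exists_solution hP q (Pi.single k 1)
  obtain ⟨h0, h⟩ := residualVariance_add_single hP hy hz
  rw [h]
  have : 0 ≤ y k ^ 2 / (1 + z k) := by positivity
  linarith

/-- The solution `y` at `q = 0` is nonzero, and observing a coordinate with `y k ≠ 0` helps
strictly. In the separable case this rules out an infinite sum at a single observation. -/
theorem exists_residualVariance_single_lt (hP : P.PosDef) {w : n → ℝ} (hw : w ≠ 0) :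
    ∃ k, residualVariance P w (Pi.single k 1) < residualVariance P w 0 := by
  obtain ⟨y, hy, -⟩ := exists_solution hP 0 w
  have hy0 : y ≠ 0 := by
    rintro rfl
    rw [mulVec_zero] at hy
    exact hw hy.symm
  obtain ⟨k, hk⟩ := Function.ne_iff.1 hy0
  refine ⟨k, ?_⟩
  obtain ⟨z, hz, -⟩ := exists_solution hP 0 (Pi.single k 1)
  obtain ⟨h0, h⟩ := residualVariance_add_single hP hy hz
  rw [zero_add] at h
  rw [h]
  have h1 : y k ≠ 0 := hk
  have : 0 < y k ^ 2 / (1 + z k) := by positivity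
  linarith

/-- The form `A = P + diag q` is nonnegative at `A k k • y - Pi.single k (w k)`. The resulting lower
bound on the variance prevents optimal vectors from neglecting a signal with `w k ≠ 0`. -/
theorem sq_le_mul_residualVariance (hP : P.PosDef) (w : n → ℝ) (q : n → ℕ) (k : n) :
    w k ^ 2 ≤ (P k k + q k) * residualVariance P w q := by
  obtain ⟨y, hy, -⟩ := exists_solution hP q w
  rw [residualVariance_eq hP hy]
  have hA := posDef_add_diagonal hP q
  set A := P + diagonal fun k => (q k : ℝ) with hAdef
  have hAk : A k k = P k k + q k := by simp [hAdef]
  have hAkp : 0 < A k k := hA.diag_pos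
  rw [← hAk]
  have hn := dotProduct_mulVec_nonneg_of_posDef hA (A k k • y - Pi.single k (w k))
  have e1 : A *ᵥ (Pi.single k (w k)) = w k • A.col k := by
    rw [mulVec_single]; ext l; simp [mul_comm]
  have e2 : (A k k • y) ⬝ᵥ A *ᵥ Pi.single k (w k) = A k k * (w k * w k) := by
    rw [dotProduct_mulVec_comm_of_posDef hA, mulVec_smul, hy, dotProduct_single, Pi.smul_apply,
      smul_eq_mul]
    ring
  have e3 : (Pi.single k (w k) : n → ℝ) ⬝ᵥ A *ᵥ Pi.single k (w k) = A k k * (w k * w k) := by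
    rw [e1, single_dotProduct, Pi.smul_apply, smul_eq_mul, col_apply]
    ring
  have e4 : (Pi.single k (w k) : n → ℝ) ⬝ᵥ w = w k * w k := by rw [single_dotProduct]
  rw [mulVec_sub, dotProduct_sub, sub_dotProduct, sub_dotProduct, e2, e3, mulVec_smul, hy,
    dotProduct_smul, dotProduct_smul, e4, smul_dotProduct, dotProduct_comm y w, smul_eq_mul,
    smul_eq_mul, smul_eq_mul] at hn
  have : 0 ≤ A k k * (A k k * (w ⬝ᵥ y) - w k ^ 2) := by nlinarith
  have := nonneg_of_mul_nonneg_right this hAkp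
  linarith

/-- If all counts are at least `μ`, then solutions are of the order `1 / μ`. -/
theorem mul_abs_solution_le (hP : P.PosDef) {q : n → ℕ} {w y : n → ℝ}
    (hy : (P + diagonal fun k => (q k : ℝ)) *ᵥ y = w) {μ : ℝ} (hμ : 0 ≤ μ) (hq : ∀ k, μ ≤ q k)
    (k : n) : μ * |y k| ≤ ∑ l, |w l| := by
  -- The equation is tested against `y` itself; Cauchy–Schwarz then bounds the norm of `y`.
  have h1 : μ * ∑ l, y l ^ 2 ≤ ∑ l, w l * y l := by
    have h := dotProduct_mulVec_nonneg_of_posDef hP y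
    have h2 : y ⬝ᵥ (P + diagonal fun k => (q k : ℝ)) *ᵥ y = ∑ l, w l * y l := by
      rw [hy, dotProduct_comm]; rfl
    rw [add_mulVec, dotProduct_add] at h2
    have h3 : y ⬝ᵥ (diagonal fun k => (q k : ℝ)) *ᵥ y = ∑ l, (q l : ℝ) * y l ^ 2 := by
      refine Finset.sum_congr rfl fun l _ => ?_
      rw [mulVec_diagonal]
      ring
    have h4 : μ * ∑ l, y l ^ 2 ≤ ∑ l, (q l : ℝ) * y l ^ 2 := by
      rw [Finset.mul_sum]
      exact Finset.sum_le_sum fun l _ => mul_le_mul_of_nonneg_right (hq l) (sq_nonneg _)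
    linarith
  have h2 : (∑ l, w l * y l) ^ 2 ≤ (∑ l, w l ^ 2) * ∑ l, y l ^ 2 :=
    Finset.sum_mul_sq_le_sq_mul_sq _ _ _
  have h3 : ∑ l, w l ^ 2 ≤ (∑ l, |w l|) ^ 2 := by
    have := Finset.sum_sq_le_sq_sum_of_nonneg (s := Finset.univ) (f := fun l => |w l|)
      (fun l _ => abs_nonneg _)
    simpa using this
  have h4 : y k ^ 2 ≤ ∑ l, y l ^ 2 :=
    Finset.single_le_sum (f := fun l => y l ^ 2) (fun l _ => sq_nonneg _) (Finset.mem_univ k)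
  set s := ∑ l, y l ^ 2
  have hs : 0 ≤ s := Finset.sum_nonneg fun l _ => sq_nonneg _
  have hW : 0 ≤ ∑ l, |w l| := Finset.sum_nonneg fun l _ => abs_nonneg _
  refine abs_le_of_sq_le_sq' ?_ hW |>.2
  rw [mul_pow, sq_abs]
  rcases hs.eq_or_lt with h0 | h0
  · have : y k ^ 2 = 0 := le_antisymm (by rw [h0]; exact h4) (sq_nonneg _)
    rw [this, mul_zero]
    positivity
  · have h5 : (μ * s) ^ 2 ≤ (∑ l, w l ^ 2) * s :=
      (pow_le_pow_left₀ (by positivity) h1 2).trans h2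
    have h6 : μ ^ 2 * s ≤ ∑ l, w l ^ 2 := by
      refine le_of_mul_le_mul_right ?_ h0
      calc μ ^ 2 * s * s = (μ * s) ^ 2 := by ring
        _ ≤ _ := h5
    have h7 : μ ^ 2 * y k ^ 2 ≤ μ ^ 2 * s := mul_le_mul_of_nonneg_left h4 (sq_nonneg _)
    linarith

/-- Each coordinate of the solution is of order `1 / μ`. For balanced counts this is the upper bound
to be played against `sq_le_mul_residualVariance`. -/
theorem mul_residualVariance_le (hP : P.PosDef) (w : n → ℝ) (q : n → ℕ) {μ : ℝ} (hμ : 0 ≤ μ)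
    (hq : ∀ k, μ ≤ q k) : μ * residualVariance P w q ≤ (∑ l, |w l|) ^ 2 := by
  obtain ⟨y, hy, -⟩ := exists_solution hP q w
  rw [residualVariance_eq hP hy, dotProduct, Finset.mul_sum, sq, Finset.sum_mul]
  refine Finset.sum_le_sum fun l _ => ?_
  have h := mul_abs_solution_le hP hy hμ hq l
  calc μ * (w l * y l) ≤ μ * |w l * y l| := mul_le_mul_of_nonneg_left (le_abs_self _) hμ
    _ = |w l| * (μ * |y l|) := by rw [abs_mul]; ring
    _ ≤ _ := mul_le_mul_of_nonneg_left h (abs_nonneg _)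

/-- `q` minimizes `f` among the count vectors with sum `N`. -/
def IsOptimalCount (f : (n → ℕ) → ℝ) (N : ℕ) (q : n → ℕ) : Prop :=
  ∑ k, q k = N ∧ ∀ q' : n → ℕ, ∑ k, q' k = N → f q ≤ f q'

theorem exists_isOptimalCount [Nonempty n] (f : (n → ℕ) → ℝ) (N : ℕ) :
    ∃ q, IsOptimalCount f N q := by
  obtain ⟨k⟩ := ‹Nonempty n›
  obtain ⟨q, hq, h⟩ := Finset.exists_min_image (Finset.piAntidiag (Finset.univ : Finset n) N) f
    ⟨Pi.single k N, by simp [Finset.mem_piAntidiag]⟩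
  exact ⟨q, (Finset.mem_piAntidiag.1 hq).1, fun q' hq' =>
    h q' (by simp [Finset.mem_piAntidiag, hq'])⟩

/-- In an optimal count vector, the counts are proportional to the weights up to a constant. -/
theorem IsOptimalCount.mul_abs_sub_le (hP : P.PosDef) {w : n → ℝ} {N : ℕ} {q : n → ℕ}
    (hq : IsOptimalCount (residualVariance P w) N q) {μ : ℝ} (hμ : 1 ≤ μ)
    (hqμ : ∀ k, μ + 1 ≤ q k) (j k : n) :
    q j * |w k| - q k * |w j| ≤
      N * ((3 * (∑ l, ∑ m, |P l m|) + 1) * ∑ l, |w l|) / μ + ∑ l, |w l| := by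
  set W := ∑ l, |w l| with hWdef
  set p := ∑ l, ∑ m, |P l m| with hpdef
  have hW : 0 ≤ W := Finset.sum_nonneg fun l _ => abs_nonneg _
  have hp : 0 ≤ p := Finset.sum_nonneg fun l _ => Finset.sum_nonneg fun m _ => abs_nonneg _
  have hwW : ∀ l, |w l| ≤ W := fun l =>
    Finset.single_le_sum (f := fun l => |w l|) (fun l _ => abs_nonneg _) (Finset.mem_univ l)
  have hμ0 : 0 < μ := by linarith
  have hqN : ∀ l, (q l : ℝ) ≤ N := fun l => by
    rw [← hq.1]
    exact_mod_cast Finset.single_le_sum (f := q) (fun _ _ => Nat.zero_le _) (Finset.mem_univ l)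
  have hqj1 : 1 ≤ q j := by
    have := hqμ j
    have : (1 : ℝ) ≤ q j := by linarith
    exact_mod_cast this
  -- Optimality is tested by moving one observation from `j` to `k`: from the common base `q'`,
  -- adding `j` must do at least as well as adding `k`.
  set q' : n → ℕ := q - Pi.single j 1 with hq'def
  have hq' : q' + Pi.single j 1 = q := by
    ext l
    by_cases h : l = j
    · subst h; simp [hq'def, Nat.sub_add_cancel hqj1]
    · simp [hq'def, h]
  have hq'μ : ∀ l, μ ≤ q' l := by
    intro l
    have h1 := hqμ l
    have h2 : q l ≤ q' l + 1 := by
      rw [← hq']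
      simp only [Pi.add_apply, Pi.single_apply]
      split_ifs <;> omega
    have h3 : (q l : ℝ) ≤ q' l + 1 := by exact_mod_cast h2
    linarith
  have hq'q : ∀ l, (q' l : ℝ) ≤ q l := by
    intro l
    have : q' l ≤ q l := Nat.sub_le _ _
    exact_mod_cast this
  obtain ⟨y, hy, -⟩ := exists_solution hP q' w
  obtain ⟨z, hz, -⟩ := exists_solution hP q' (Pi.single j 1)
  obtain ⟨z', hz', -⟩ := exists_solution hP q' (Pi.single k 1)
  obtain ⟨hz0, hfj⟩ := residualVariance_add_single hP hy hz
  obtain ⟨hz0', hfk⟩ := residualVariance_add_single hP hy hz'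
  have hopt := hq.2 (q' + Pi.single k 1) (by
    have h1 := hq.1
    rw [← hq'] at h1
    simpa [Finset.sum_add_distrib] using h1)
  rw [← hq', hfj, hfk] at hopt
  have hyb : ∀ l, |y l| ≤ W / μ := fun l => by
    rw [le_div_iff₀ hμ0, mul_comm]
    exact mul_abs_solution_le hP hy hμ0.le hq'μ l
  have hzb : z' k ≤ 1 / μ := by
    rw [le_div_iff₀ hμ0, mul_comm]
    have h1 := mul_abs_solution_le hP hz' hμ0.le hq'μ k
    have h2 : ∑ l, |(Pi.single k 1 : n → ℝ) l| = 1 := by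
      rw [Finset.sum_eq_single k]
      · simp
      · intro l _ hl
        simp [hl]
      · simp
    rw [h2] at h1
    exact (mul_le_mul_of_nonneg_left (le_abs_self _) hμ0.le).trans h1
  -- For large counts the diagonal dominates `P`, so `y l` is nearly `w l / q' l`.
  have hres : ∀ l, |q' l * y l - w l| ≤ p * W / μ := by
    intro l
    have h1 := congrFun hy l
    rw [add_mulVec, Pi.add_apply, mulVec_diagonal] at h1
    have h2 : q' l * y l - w l = -(P *ᵥ y) l := by linarith
    rw [h2, abs_neg, mulVec, dotProduct]
    refine (Finset.abs_sum_le_sum_abs _ _).trans ?_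
    rw [mul_div_assoc, hpdef, Finset.sum_mul]
    refine le_trans ?_ (Finset.single_le_sum (f := fun l => (∑ m, |P l m|) * (W / μ))
      (fun l _ => mul_nonneg (Finset.sum_nonneg fun m _ => abs_nonneg _) (by positivity))
      (Finset.mem_univ l))
    rw [Finset.sum_mul]
    refine Finset.sum_le_sum fun m _ => ?_
    rw [abs_mul]
    exact mul_le_mul_of_nonneg_left (hyb m) (abs_nonneg _)
  have hyk : |y k| ≤ |y j| * (1 + 1 / μ) := by
    have h1 : y k ^ 2 / (1 + z' k) ≤ y j ^ 2 := by
      have : y j ^ 2 / (1 + z j) ≤ y j ^ 2 := div_le_self (sq_nonneg _) (by linarith)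
      linarith
    rw [div_le_iff₀ (by linarith)] at h1
    have h2 : 0 ≤ 1 / μ := by positivity
    rw [← abs_of_nonneg (show (0 : ℝ) ≤ 1 + 1 / μ by linarith), ← abs_mul]
    refine sq_le_sq.1 ?_
    rw [mul_pow]
    refine h1.trans (mul_le_mul_of_nonneg_left ?_ (sq_nonneg _))
    nlinarith
  set ε := p * W / μ with hε
  have hε0 : 0 ≤ ε := by positivity
  have hk : |w k| - ε ≤ q' k * |y k| := by
    have h1 := abs_sub_abs_le_abs_sub (w k) (q' k * y k)
    rw [abs_mul, abs_of_nonneg (Nat.cast_nonneg (α := ℝ) (q' k)), abs_sub_comm] at h1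
    have := hres k
    linarith
  have hj : q' j * |y j| ≤ |w j| + ε := by
    have h1 := abs_sub_abs_le_abs_sub (q' j * y j) (w j)
    rw [abs_mul, abs_of_nonneg (Nat.cast_nonneg (α := ℝ) (q' j))] at h1
    have := hres j
    linarith
  have hk0 : (0 : ℝ) ≤ q' k := Nat.cast_nonneg _
  have hj0 : (0 : ℝ) ≤ q' j := Nat.cast_nonneg _
  have hμ1 : 1 / μ ≤ 1 := by rw [div_le_one hμ0]; exact hμ
  have hμ2 : 0 ≤ 1 / μ := by positivity
  -- Up to errors, `q j |w k| ≈ q j q k |y k| ≤ q j q k |y j| ≈ q k |w j|`, where the inequality is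
  -- optimality.
  have main : q' j * (|w k| - ε) ≤ q' k * (|w j| + 2 * ε + W / μ) := by
    calc q' j * (|w k| - ε) ≤ q' j * (q' k * |y k|) := mul_le_mul_of_nonneg_left hk hj0
      _ ≤ q' j * (q' k * (|y j| * (1 + 1 / μ))) := by gcongr
      _ = q' k * ((q' j * |y j|) * (1 + 1 / μ)) := by ring
      _ ≤ q' k * ((|w j| + ε) * (1 + 1 / μ)) := by gcongr
      _ ≤ q' k * (|w j| + 2 * ε + W / μ) := by
        refine mul_le_mul_of_nonneg_left ?_ hk0
        have h1 : |w j| * (1 / μ) ≤ W * (1 / μ) := mul_le_mul_of_nonneg_right (hwW j) hμ2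
        have h2 : ε * (1 / μ) ≤ ε * 1 := mul_le_mul_of_nonneg_left hμ1 hε0
        have h3 : W * (1 / μ) = W / μ := by ring
        nlinarith
  have hWμ : 0 ≤ W / μ := by positivity
  have h1 : (q' j : ℝ) * ε ≤ N * ε := mul_le_mul_of_nonneg_right ((hq'q j).trans (hqN j)) hε0
  have h2 : (q' k : ℝ) * (2 * ε + W / μ) ≤ N * (2 * ε + W / μ) :=
    mul_le_mul_of_nonneg_right ((hq'q k).trans (hqN k)) (by positivity)
  have h3 : (q j : ℝ) = q' j + 1 := by
    rw [← hq']; simp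
  have h4 : (N : ℝ) * ((3 * p + 1) * W) / μ = N * (3 * ε + W / μ) := by
    rw [hε]; ring
  have h5 : (q' k : ℝ) * |w j| ≤ q k * |w j| :=
    mul_le_mul_of_nonneg_right (hq'q k) (abs_nonneg _)
  rw [h4, h3]
  have := hwW k
  nlinarith

/-- In an optimal count vector, all counts are of the order of their sum. -/
theorem IsOptimalCount.le_count [Nonempty n] (hP : P.PosDef) {w : n → ℝ} {N : ℕ} {q : n → ℕ}
    (hq : IsOptimalCount (residualVariance P w) N q) (hN : 2 * Fintype.card n ≤ N) (k : n) :
    w k ^ 2 * N ≤ (P k k + q k) * (2 * Fintype.card n * (∑ l, |w l|) ^ 2) := by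
  set m := N / Fintype.card n with hm
  have hK : 0 < Fintype.card n := Fintype.card_pos
  obtain ⟨k₀⟩ := ‹Nonempty n›
  have hdm := Nat.div_add_mod N (Fintype.card n)
  -- The comparison vector is the uniform one, with the remainder of the division put on `k₀`; its
  -- variance is of order `1 / N`.
  let b : n → ℕ := fun l => m + (Pi.single k₀ (N % Fintype.card n) : n → ℕ) l
  have hb : ∑ l, b l = N := by
    simp only [b, Finset.sum_add_distrib, Finset.sum_const, Finset.card_univ, smul_eq_mul,
      Finset.sum_pi_single', Finset.mem_univ, if_true]
    exact hdm
  have h1 := hq.2 b hb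
  have h2 := mul_residualVariance_le hP w b (μ := m) (Nat.cast_nonneg _) (fun l => by
    simp only [b]
    push_cast
    have : (0 : ℝ) ≤ ((Pi.single k₀ (N % Fintype.card n) : n → ℕ) l : ℝ) := Nat.cast_nonneg _
    linarith)
  have h3 : (N : ℝ) ≤ 2 * Fintype.card n * m := by
    have h4 : N % Fintype.card n < Fintype.card n := Nat.mod_lt _ hK
    have h6 : Fintype.card n * 1 ≤ Fintype.card n * m :=
      Nat.mul_le_mul_left _ ((Nat.le_div_iff_mul_le hK).2 (by omega))
    have h5 : N ≤ 2 * (Fintype.card n * m) := by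
      rw [← hm] at hdm
      omega
    have : N ≤ 2 * Fintype.card n * m := by rw [mul_assoc]; exact h5
    exact_mod_cast this
  have h4 := sq_le_mul_residualVariance hP w q k
  have hPk : 0 < P k k := hP.diag_pos
  have hf : 0 ≤ residualVariance P w q := by
    by_contra hneg
    have : (P k k + q k) * residualVariance P w q < 0 :=
      mul_neg_of_pos_of_neg (by positivity) (not_le.1 hneg)
    nlinarith [sq_nonneg (w k)]
  calc w k ^ 2 * N ≤ ((P k k + q k) * residualVariance P w q) * (2 * Fintype.card n * m) := by
        gcongr
    _ = (P k k + q k) * (2 * Fintype.card n * (m * residualVariance P w q)) := by ring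
    _ ≤ (P k k + q k) * (2 * Fintype.card n * (m * residualVariance P w b)) := by gcongr
    _ ≤ _ := by gcongr

/-- For large block sizes, optimal count vectors are increasing in their sums. -/
theorem exists_forall_optimalCount_le [Nonempty n] (hP : P.PosDef) {w : n → ℝ}
    (hw : ∀ k, w k ≠ 0) :
    ∃ B₀ : ℕ, ∀ N B : ℕ, B₀ ≤ N → B₀ ≤ B → ∀ q q' : n → ℕ,
      IsOptimalCount (residualVariance P w) N q →
      IsOptimalCount (residualVariance P w) (N + B) q' → q ≤ q' := by
  set W := ∑ l, |w l| with hWdef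
  set p := ∑ l, ∑ m, |P l m| with hpdef
  have hp : 0 ≤ p := Finset.sum_nonneg fun l _ => Finset.sum_nonneg fun m _ => abs_nonneg _
  have hwW : ∀ l, |w l| ≤ W := fun l =>
    Finset.single_le_sum (f := fun l => |w l|) (fun l _ => abs_nonneg _) (Finset.mem_univ l)
  obtain ⟨k₀, hk₀⟩ := Finite.exists_min fun k => |w k|
  set v := |w k₀| with hv
  have hv0 : 0 < v := abs_pos.2 (hw k₀)
  have hW : 0 < W := hv0.trans_le (hwW k₀)
  set K : ℝ := (Fintype.card n : ℝ) with hK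
  have hK0 : 0 < K := by
    rw [hK]; exact_mod_cast Fintype.card_pos
  -- By `IsOptimalCount.le_count`, all optimal counts are at least `c * N - p`. With `μ = c * N / 2`
  -- the error in `IsOptimalCount.mul_abs_sub_le` becomes the constant `R` below, free of `N`.
  set c := v ^ 2 / (2 * K * W ^ 2) with hc
  have hc0 : 0 < c := by positivity
  have hPp : ∀ k, P k k ≤ p := fun k => by
    refine (le_abs_self _).trans ?_
    refine le_trans ?_ (Finset.single_le_sum (f := fun l => ∑ m, |P l m|)
      (fun l _ => Finset.sum_nonneg fun m _ => abs_nonneg _) (Finset.mem_univ k))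
    exact Finset.single_le_sum (f := fun m => |P k m|) (fun m _ => abs_nonneg _)
      (Finset.mem_univ k)
  set R := 2 * ((3 * p + 1) * W) / c + W with hR
  have hR0 : 0 ≤ R := by positivity
  have key : ∀ N : ℕ, 2 * K ≤ N → 2 * (p + 1) / c ≤ N → 2 / c ≤ N → ∀ q : n → ℕ,
      IsOptimalCount (residualVariance P w) N q → ∀ j k, q j * |w k| - q k * |w j| ≤ R := by
    intro N h1 h2 h3 q hq j k
    rw [div_le_iff₀ hc0] at h2 h3
    have hqb : ∀ l, c * N - p ≤ q l := by
      intro l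
      have h4 := hq.le_count hP (by rw [hK] at h1; exact_mod_cast h1) l
      have h5 : v ^ 2 ≤ w l ^ 2 := by
        rw [hv, sq_abs]
        exact sq_le_sq.2 (hk₀ l)
      have h6 : v ^ 2 * N ≤ (p + q l) * (2 * K * W ^ 2) := by
        calc v ^ 2 * N ≤ w l ^ 2 * N := by gcongr
          _ ≤ (P l l + q l) * (2 * K * W ^ 2) := h4
          _ ≤ _ := by gcongr; exact hPp l
      rw [hc, sub_le_iff_le_add', div_mul_eq_mul_div, div_le_iff₀ (by positivity)]
      exact h6
    have h7 := hq.mul_abs_sub_le hP (μ := c * N / 2) (by linarith) (fun l => by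
      have := hqb l
      linarith) j k
    refine h7.trans (le_of_eq ?_)
    have hN : (N : ℝ) ≠ 0 := by
      intro h0
      rw [h0] at h3
      linarith
    rw [hR]
    field_simp
    rw [← hpdef, ← hWdef]
    ring
  -- Summing the pairwise bounds over one index compares `q k * W` with `N * |w k|`.
  have hlow : ∀ (N : ℕ) (q : n → ℕ), ∑ k, q k = N → (∀ j k, q j * |w k| - q k * |w j| ≤ R) →
      ∀ k, N * |w k| - q k * W ≤ K * R := by
    intro N q hq h k
    have := Finset.sum_le_sum (s := Finset.univ) fun j (_ : j ∈ Finset.univ) => h j k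
    rw [Finset.sum_sub_distrib, ← Finset.sum_mul, ← Finset.mul_sum, ← Nat.cast_sum, hq,
      Finset.sum_const, Finset.card_univ, nsmul_eq_mul] at this
    exact this
  have hupp : ∀ (N : ℕ) (q : n → ℕ), ∑ k, q k = N → (∀ j k, q j * |w k| - q k * |w j| ≤ R) →
      ∀ j, q j * W - N * |w j| ≤ K * R := by
    intro N q hq h j
    have := Finset.sum_le_sum (s := Finset.univ) fun k (_ : k ∈ Finset.univ) => h j k
    rw [Finset.sum_sub_distrib, ← Finset.sum_mul, ← Finset.mul_sum, ← Nat.cast_sum, hq,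
      Finset.sum_const, Finset.card_univ, nsmul_eq_mul] at this
    exact this
  -- The first three thresholds serve `key`; the last makes the growth `B * |w k|` cover the two
  -- errors `K * R`, one for each total.
  obtain ⟨B₀, hB₀⟩ := exists_nat_ge
    (max (max (2 * K) (2 * (p + 1) / c)) (max (2 / c) (2 * K * R / v)))
  refine ⟨B₀, fun N B hN hB q q' hq hq' k => ?_⟩
  have hN' : (B₀ : ℝ) ≤ N := by exact_mod_cast hN
  have hB' : (B₀ : ℝ) ≤ B := by exact_mod_cast hB
  have hNB : (N : ℝ) ≤ (N + B : ℕ) := by push_cast; linarith [Nat.cast_nonneg (α := ℝ) B]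
  have a1 := (le_max_left _ _).trans ((le_max_left _ _).trans hB₀)
  have a2 := (le_max_right _ _).trans ((le_max_left _ _).trans hB₀)
  have a3 := (le_max_left _ _).trans ((le_max_right _ _).trans hB₀)
  have a4 := (le_max_right _ _).trans ((le_max_right _ _).trans hB₀)
  have b1 := hupp N q hq.1 (key N (by linarith) (by linarith) (by linarith) q hq) k
  have b2 := hlow (N + B) q' hq'.1
    (key (N + B) (by linarith) (by linarith) (by linarith) q' hq') k
  rw [div_le_iff₀ hv0] at a4
  have hkv : v ≤ |w k| := hk₀ k
  have b3 : 2 * K * R ≤ B * |w k| := by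
    calc 2 * K * R ≤ B₀ * v := a4
      _ ≤ B * |w k| := by gcongr
  push_cast at b2
  have b4 : (q k : ℝ) * W ≤ q' k * W := by nlinarith
  have b5 := le_of_mul_le_mul_right b4 hW
  exact_mod_cast b5

end QuadraticForm

/-! ### Optimal counts in separable environments -/

/-- Increments of an antitone convex function: moving two arguments towards each other does not
increase the sum of the values. -/
theorem WithTop.add_le_add_of_convex {g : ℕ → WithTop ℝ} (hanti : ∀ n, g (n + 1) ≤ g n)
    (hconv : ∀ n, g (n + 1) + g (n + 1) ≤ g n + g (n + 2)) {a b : ℕ} (hab : a < b) :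
    g (a + 1) + g (b - 1) ≤ g a + g b := by
  by_cases htop : g a = ⊤
  · rw [htop, top_add]; exact le_top
  have hA : Antitone g := antitone_nat_of_succ_le hanti
  have hfin : ∀ n, g (a + n) ≠ ⊤ := fun n =>
    ne_top_of_le_ne_top htop (hA (Nat.le_add_right a n))
  choose γ hγ using fun n => WithTop.ne_top_iff_exists.1 (hfin n)
  have hc : ∀ n, γ (n + 1) - γ n ≤ γ (n + 2) - γ (n + 1) := by
    intro n
    have h := hconv (a + n)
    rw [show a + n + 1 = a + (n + 1) by ring, show a + n + 2 = a + (n + 2) by ring,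
      ← hγ, ← hγ, ← hγ] at h
    norm_cast at h
    linarith
  have hmono : Monotone fun n => γ (n + 1) - γ n := monotone_nat_of_le_succ hc
  obtain ⟨d, rfl⟩ : ∃ d, b = a + (d + 1) := ⟨b - a - 1, by omega⟩
  have h := hmono (Nat.zero_le d)
  simp only at h
  have h0 : g a = g (a + 0) := rfl
  rw [h0, show a + (d + 1) - 1 = a + d by omega, ← hγ, ← hγ, ← hγ, ← hγ]
  norm_cast
  norm_num at h
  linarith

section Separable

variable {n : Type*} [Fintype n] [DecidableEq n]

theorem sum_add_single (q : n → ℕ) (k : n) : ∑ l, (q + Pi.single k 1 : n → ℕ) l = ∑ l, q l + 1 := by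
  simp [Finset.sum_add_distrib]

/-- For an objective that is an increasing function of a sum of convex functions, optimal count
vectors can be completed to optimal count vectors. -/
theorem exists_optimalCount_ge_of_separable [Nonempty n] {f : (n → ℕ) → ℝ}
    {g : n → ℕ → WithTop ℝ} (hconv : ∀ k m, g k (m + 1) + g k (m + 1) ≤ g k m + g k (m + 2))
    (hfg : ∀ q q', f q ≤ f q' ↔ ∑ k, g k (q k) ≤ ∑ k, g k (q' k))
    (hmono : ∀ q k, f (q + Pi.single k 1) ≤ f q) (hlt : ∃ k, f (Pi.single k 1) < f 0)
    {N B : ℕ} (hN : 0 < N) {q : n → ℕ} (hq : IsOptimalCount f N q) :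
    ∃ q', IsOptimalCount f (N + B) q' ∧ q ≤ q' := by
  obtain ⟨k₀, hk₀⟩ := hlt
  -- The strict gain from the first observation of `k₀` keeps the sum there below `⊤`. Finite terms
  -- are needed for cancellation in `WithTop ℝ`.
  have hfin₁ : ∀ l, g l ((Pi.single k₀ 1 : n → ℕ) l) ≠ ⊤ := by
    have h1 : ∑ l, g l ((Pi.single k₀ 1 : n → ℕ) l) < ∑ l, g l ((0 : n → ℕ) l) := by
      rw [← not_le, ← hfg, not_le]
      exact hk₀
    intro l hl
    have := (WithTop.sum_lt_top.1 (h1.trans_le le_top)) l (Finset.mem_univ l)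
    rw [hl] at this
    exact lt_irrefl _ this
  have hanti : ∀ k m, g k (m + 1) ≤ g k m := by
    intro k m
    set x : n → ℕ := Function.update (Pi.single k₀ 1 : n → ℕ) k m with hx
    have h1 := (hfg _ _).1 (hmono x k)
    have hxk : x k = m := by simp [hx]
    have hxl : ∀ l, l ≠ k → x l = (Pi.single k₀ 1 : n → ℕ) l := fun l hl => by simp [hx, hl]
    rw [← Finset.add_sum_erase _ _ (Finset.mem_univ k),
      ← Finset.add_sum_erase _ (fun l => g l (x l)) (Finset.mem_univ k)] at h1
    have h2 : ∑ l ∈ Finset.univ.erase k, g l ((x + Pi.single k 1 : n → ℕ) l) =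
        ∑ l ∈ Finset.univ.erase k, g l (x l) :=
      Finset.sum_congr rfl fun l hl => by
        simp [(Finset.ne_of_mem_erase hl)]
    have h3 : ∑ l ∈ Finset.univ.erase k, g l (x l) ≠ ⊤ := by
      refine (WithTop.sum_lt_top.2 fun l hl => ?_).ne
      rw [hxl l (Finset.ne_of_mem_erase hl)]
      exact lt_top_iff_ne_top.2 (hfin₁ l)
    rw [h2] at h1
    have h4 := (WithTop.add_le_add_iff_right h3).1 h1
    simpa [hxk] using h4
  have hAnti : ∀ k, Antitone (g k) := fun k => antitone_nat_of_succ_le (hanti k)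
  have hfinite : ∀ M, 0 < M → ∀ x : n → ℕ, IsOptimalCount f M x → ∑ l, g l (x l) ≠ ⊤ := by
    intro M hM x hx
    have h1 := (hfg _ _).1 (hx.2 (Pi.single k₀ M) (by simp))
    refine ne_top_of_le_ne_top ?_ h1
    refine (WithTop.sum_lt_top.2 fun l _ => lt_top_iff_ne_top.2 ?_).ne
    refine ne_top_of_le_ne_top (hfin₁ l) (hAnti l ?_)
    by_cases h : l = k₀
    · subst h; simpa using Nat.succ_le_of_lt hM
    · simp [h]
  -- Induction on the total shortfall of an optimal vector `x` relative to `q`.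
  suffices h : ∀ (d : ℕ) (x : n → ℕ), IsOptimalCount f (N + B) x → ∑ l, (q l - x l) ≤ d →
      ∃ q', IsOptimalCount f (N + B) q' ∧ q ≤ q' by
    obtain ⟨x, hx⟩ := exists_isOptimalCount f (N + B)
    exact h _ x hx le_rfl
  intro d
  induction d with
  | zero =>
    intro x hx hd
    refine ⟨x, hx, fun l => ?_⟩
    have := (Finset.sum_eq_zero_iff.1 (Nat.le_zero.1 hd)) l (Finset.mem_univ l)
    exact Nat.sub_eq_zero_iff_le.1 this
  | succ d ih =>
    intro x hx hd
    by_cases hle : q ≤ x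
    · exact ⟨x, hx, hle⟩
    obtain ⟨k, hk⟩ : ∃ k, x k < q k := by
      by_contra! hcon
      exact hle hcon
    obtain ⟨j, hj⟩ : ∃ j, q j < x j := by
      by_contra! hcon
      have := Finset.sum_lt_sum (fun l _ => hcon l) ⟨k, Finset.mem_univ k, hk⟩
      rw [hx.1, hq.1] at this
      omega
    have hkj : k ≠ j := by
      rintro rfl
      omega
    -- Both vectors move one observation between `j` and `k`, towards each other. By convexity the
    -- two sums together do not grow, and as `q` is optimal, `x₁` is as good as `x`, with a smaller
    -- shortfall.
    let q₁ : n → ℕ := fun l => if l = k then q l - 1 else if l = j then q l + 1 else q l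
    let x₁ : n → ℕ := fun l => if l = k then x l + 1 else if l = j then x l - 1 else x l
    have hq₁ : ∑ l, q₁ l = N := by
      have h1 : q₁ + Pi.single k 1 = q + Pi.single j 1 := by
        ext l
        simp only [q₁, Pi.add_apply, Pi.single_apply]
        split_ifs with h1 h2 <;> subst_vars <;> omega
      have h2 := congrArg (fun y => ∑ l, y l) h1
      simp only [sum_add_single] at h2
      rw [← hq.1]
      omega
    have hx₁ : ∑ l, x₁ l = N + B := by
      have h1 : x₁ + Pi.single j 1 = x + Pi.single k 1 := by
        ext l
        simp only [x₁, Pi.add_apply, Pi.single_apply]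
        split_ifs with h1 h2 <;> subst_vars <;> omega
      have h2 := congrArg (fun y => ∑ l, y l) h1
      simp only [sum_add_single] at h2
      rw [← hx.1]
      omega
    have hsum : ∑ l, g l (q₁ l) + ∑ l, g l (x₁ l) ≤ ∑ l, g l (q l) + ∑ l, g l (x l) := by
      rw [← Finset.sum_add_distrib, ← Finset.sum_add_distrib]
      refine Finset.sum_le_sum fun l _ => ?_
      by_cases h1 : l = k
      · subst h1
        simp only [q₁, x₁, if_true]
        rw [add_comm, add_comm (g l (q l))]
        exact WithTop.add_le_add_of_convex (hanti l) (hconv l) hk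
      · by_cases h2 : l = j
        · subst h2
          simp only [q₁, x₁, if_true, if_neg h1]
          exact WithTop.add_le_add_of_convex (hanti l) (hconv l) hj
        · simp only [q₁, x₁, if_neg h1, if_neg h2]
          exact le_rfl
    have h1 := (hfg _ _).1 (hq.2 q₁ hq₁)
    have h2 : ∑ l, g l (x₁ l) ≤ ∑ l, g l (x l) :=
      (WithTop.add_le_add_iff_left (hfinite N hN q hq)).1
        ((add_le_add_left h1 _).trans hsum)
    refine ih x₁ ⟨hx₁, fun y hy => ((hfg _ _).2 h2).trans (hx.2 y hy)⟩ ?_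
    have h3 : ∑ l, (q l - x₁ l) < ∑ l, (q l - x l) := by
      refine Finset.sum_lt_sum (fun l _ => ?_) ⟨k, Finset.mem_univ k, ?_⟩
      · simp only [x₁]
        split_ifs with h1 h2 <;> subst_vars <;> omega
      · simp only [x₁, if_true]
        omega
    omega

end Separable

/-! ### Optimality of myopic division vectors -/

namespace InfoGame

variable {K : ℕ} [NeZero K]

theorem Environment.Regular.posDef_transformed {E : Environment K} (hE : E.Regular) :
    ((E.coeff⁻¹)ᵀ * E.cov⁻¹ * E.coeff⁻¹).PosDef := by
  have h := hE.posDef.inv.conjTranspose_mul_mul_same (B := E.coeff⁻¹) (by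
    refine Matrix.mulVec_injective_of_isUnit ?_
    rw [Matrix.isUnit_nonsing_inv_iff]
    exact (Matrix.isUnit_iff_isUnit_det _).2 hE.invertible)
  rwa [Matrix.conjTranspose_eq_transpose_of_trivial] at h

/-- In the coordinates `Cθ` each signal observes one coordinate, the prior precision is the
transformed matrix, and `θ₁` has the first row of `C⁻¹` as its coefficients. -/
theorem Environment.Regular.posteriorVariance_eq_residualVariance {E : Environment K}
    (hE : E.Regular) (q : Fin K → ℕ) :
    E.posteriorVariance q =
      residualVariance ((E.coeff⁻¹)ᵀ * E.cov⁻¹ * E.coeff⁻¹) (E.coeff⁻¹ 0) q := by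
  set P := (E.coeff⁻¹)ᵀ * E.cov⁻¹ * E.coeff⁻¹ with hP
  set D := Matrix.diagonal fun k => (q k : ℝ)
  have h1 : E.coeff⁻¹ * E.coeff = 1 := Matrix.nonsing_inv_mul _ hE.invertible
  have h3 : E.coeffᵀ * (E.coeff⁻¹)ᵀ = 1 := by
    rw [← Matrix.transpose_mul, h1, Matrix.transpose_one]
  have h : E.cov⁻¹ + E.coeffᵀ * D * E.coeff = E.coeffᵀ * (P + D) * E.coeff := by
    rw [Matrix.mul_add, Matrix.add_mul, hP]
    congr 1
    calc E.cov⁻¹ = (E.coeffᵀ * (E.coeff⁻¹)ᵀ) * E.cov⁻¹ * (E.coeff⁻¹ * E.coeff) := by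
          rw [h1, h3, Matrix.one_mul, Matrix.mul_one]
      _ = _ := by simp only [Matrix.mul_assoc]
  rw [Environment.posteriorVariance, h, Matrix.mul_inv_rev, Matrix.mul_inv_rev,
    ← Matrix.transpose_nonsing_inv, residualVariance, ← Matrix.mul_assoc, Matrix.mul_apply,
    Matrix.dotProduct_mulVec]
  rfl

/-- For large block sizes, and for all block sizes in separable environments, optimal division
vectors of one period can be completed to optimal division vectors of the next one. -/
theorem Environment.Regular.exists_optimalCount_ge {E : Environment K} (hE : E.Regular) :
    ∃ B₀ : ℕ, ∀ B : ℕ, 0 < B → (B₀ ≤ B ∨ E.Separable) → ∀ (t : ℕ) (q : Fin K → ℕ),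
      IsOptimalCount E.posteriorVariance (t * B) q →
      ∃ q', IsOptimalCount E.posteriorVariance ((t + 1) * B) q' ∧ q ≤ q' := by
  have hP := hE.posDef_transformed
  set P := (E.coeff⁻¹)ᵀ * E.cov⁻¹ * E.coeff⁻¹ with hPdef
  have hf : E.posteriorVariance = residualVariance P (E.coeff⁻¹ 0) :=
    funext hE.posteriorVariance_eq_residualVariance
  obtain ⟨B₀, hB₀⟩ := exists_forall_optimalCount_le hP hE.nonredundant
  refine ⟨B₀, fun B hB hcase t q hq => ?_⟩
  -- The first period is separate: the lemmas on counts need a large, respectively positive, current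
  -- total, while the zero vector lies below everything.
  rcases Nat.eq_zero_or_pos t with rfl | ht
  · obtain ⟨q', hq'⟩ := exists_isOptimalCount E.posteriorVariance ((0 + 1) * B)
    refine ⟨q', hq', fun k => ?_⟩
    have h0 := hq.1
    rw [zero_mul] at h0
    rw [Finset.sum_eq_zero_iff.1 h0 k (Finset.mem_univ k)]
    exact Nat.zero_le _
  rw [Nat.add_mul, one_mul]
  have htB : B ≤ t * B := Nat.le_mul_of_pos_left B ht
  rcases hcase with hle | ⟨g, F, hconv, hmono, hFg⟩
  · obtain ⟨q', hq'⟩ := exists_isOptimalCount E.posteriorVariance (t * B + B)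
    rw [hf] at hq hq' ⊢
    exact ⟨q', hq', hB₀ (t * B) B (hle.trans htB) hle q q' hq hq'⟩
  · refine exists_optimalCount_ge_of_separable hconv ?_ ?_ ?_ (hB.trans_le htB) hq
    · intro q q'
      rw [hFg, hFg]
      exact hmono.le_iff_le ⟨q, rfl⟩ ⟨q', rfl⟩
    · rw [hf]
      exact residualVariance_add_single_le hP _
    · rw [hf]
      refine exists_residualVariance_single_lt hP fun h => ?_
      exact hE.nonredundant 0 (congrFun h 0)

variable {B : ℕ}

omit [NeZero K] in
theorem Acquisition.sum_count (c : Fin B → Fin K) : ∑ k, Acquisition.count c k = B := by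
  have := Finset.card_eq_sum_card_fiberwise (f := c) (s := Finset.univ) (t := Finset.univ)
    (fun _ _ => Finset.mem_univ _)
  simpa [Acquisition.count] using this.symm

omit [NeZero K] in
theorem Acquisition.exists_count_eq {v : Fin K → ℕ} (hv : ∑ k, v k = B) :
    ∃ c : Fin B → Fin K, Acquisition.count c = v := by
  let e : Fin B ≃ Σ k, Fin (v k) := Fintype.equivOfCardEq (by simp [hv])
  refine ⟨fun b => (e b).1, funext fun k => ?_⟩
  rw [Acquisition.count, ← Fintype.card_subtype, Fintype.card_congr
    (e.subtypeEquiv (q := fun x => x.1 = k) fun b => Iff.rfl)]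
  rw [Fintype.card_congr (Equiv.sigmaSubtype k)]
  simp

omit [NeZero K] in
theorem Acquisition.division_succ (S : Acquisition K B) {t : ℕ} (r : unitInterval)
    (h : History B (t + 1)) :
    S.division r h = S.division r (fun j : Fin t => h j.castSucc) +
      Acquisition.count (S.choose t r fun j => h j.castSucc) := by
  ext k
  rw [Acquisition.division, Fin.sum_univ_castSucc]
  rfl

omit [NeZero K] in
theorem Acquisition.sum_division (S : Acquisition K B) {t : ℕ} (r : unitInterval)
    (h : History B t) : ∑ k, S.division r h k = t * B := by
  simp only [Acquisition.division]
  rw [Finset.sum_comm]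
  simp [Acquisition.sum_count]

/-- Myopic acquisition leads to division vectors that are optimal in all periods. -/
theorem Acquisition.IsMyopic.isOptimalCount_division {E : Environment K}
    (h : ∀ (t : ℕ) (q : Fin K → ℕ), IsOptimalCount E.posteriorVariance (t * B) q →
      ∃ q', IsOptimalCount E.posteriorVariance ((t + 1) * B) q' ∧ q ≤ q')
    {S : Acquisition K B} (hS : S.IsMyopic E) (t : ℕ) (r : unitInterval) (x : History B t) :
    IsOptimalCount E.posteriorVariance (t * B) (S.division r x) := by
  induction t with
  | zero =>
    have h0 : ∀ q : Fin K → ℕ, ∑ k, q k = 0 * B → q = 0 := by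
      intro q hq
      rw [zero_mul] at hq
      exact funext fun k => Finset.sum_eq_zero_iff.1 hq k (Finset.mem_univ k)
    refine ⟨S.sum_division r x, fun q' hq' => ?_⟩
    rw [h0 _ hq', h0 _ (S.sum_division r x)]
  | succ t ih =>
    set x' : History B t := fun j => x j.castSucc
    -- The difference between `q'` and the current division vector is a feasible block, so the
    -- myopic block reaches at least the variance at `q'`.
    obtain ⟨q', hq', hle⟩ := h t _ (ih x')
    have hsum : ∑ k, (q' - S.division r x') k = B := by
      have h1 : ∑ k, (q' - S.division r x') k + ∑ k, S.division r x' k = ∑ k, q' k := by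
        rw [← Finset.sum_add_distrib]
        exact Finset.sum_congr rfl fun k _ => Nat.sub_add_cancel (hle k)
      rw [hq'.1, S.sum_division, Nat.add_mul, one_mul] at h1
      omega
    obtain ⟨c, hc⟩ := Acquisition.exists_count_eq hsum
    refine ⟨S.sum_division r x, fun y hy => ?_⟩
    rw [S.division_succ]
    refine (hS t r x' c).trans ?_
    rw [hc, add_tsub_cancel_of_le hle]
    exact hq'.2 y hy

end InfoGame

/-! ### Gaussian regression -/

section GaussianRegression

open WithLp

variable {n J : Type*} [Fintype n] [DecidableEq n] [Fintype J]

/-- The linear functional `(θ, e) ↦ ⟨u, θ⟩ + ⟨a, e⟩`. -/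
noncomputable def pairFunctional (u : n → ℝ) (a : J → ℝ) :
    EuclideanSpace ℝ n × EuclideanSpace ℝ J →L[ℝ] ℝ :=
  (innerSL ℝ (toLp 2 u)).comp (ContinuousLinearMap.fst ℝ _ _) +
    (innerSL ℝ (toLp 2 a)).comp (ContinuousLinearMap.snd ℝ _ _)

omit [DecidableEq n] in
theorem pairFunctional_apply (u : n → ℝ) (a : J → ℝ)
    (x : EuclideanSpace ℝ n × EuclideanSpace ℝ J) :
    pairFunctional u a x = ∑ l, u l * x.1 l + ∑ j, a j * x.2 j := by
  simp [pairFunctional, PiLp.inner_apply, mul_comm]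

theorem covariance_pairFunctional {m : EuclideanSpace ℝ n} {V : Matrix n n ℝ}
    (hV : V.PosSemidef) (u u' : n → ℝ) (a a' : J → ℝ) :
    cov[pairFunctional u a, pairFunctional u' a';
      (multivariateGaussian m V).prod (stdGaussian (EuclideanSpace ℝ J))] =
      u ⬝ᵥ V *ᵥ u' + a ⬝ᵥ a' := by
  classical
  set ν := (multivariateGaussian m V).prod (stdGaussian (EuclideanSpace ℝ J))
  have h1 : ∀ u : n → ℝ, MemLp (fun x => innerSL ℝ (toLp 2 u) x) 2 (multivariateGaussian m V) :=
    fun u => (IsGaussian.hasGaussianLaw_id.map (innerSL ℝ (toLp 2 u))).memLp_two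
  have h2 : ∀ a : J → ℝ,
      MemLp (fun x => innerSL ℝ (toLp 2 a) x) 2 (stdGaussian (EuclideanSpace ℝ J)) :=
    fun a => (IsGaussian.hasGaussianLaw_id.map (innerSL ℝ (toLp 2 a))).memLp_two
  have h1' : ∀ u : n → ℝ,
      MemLp (fun x : EuclideanSpace ℝ n × EuclideanSpace ℝ J => innerSL ℝ (toLp 2 u) x.1) 2 ν :=
    fun u => (h1 u).comp_fst _
  have h2' : ∀ a : J → ℝ,
      MemLp (fun x : EuclideanSpace ℝ n × EuclideanSpace ℝ J => innerSL ℝ (toLp 2 a) x.2) 2 ν :=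
    fun a => (h2 a).comp_snd _
  have e : ∀ (u : n → ℝ) (a : J → ℝ), ⇑(pairFunctional u a) =
      (fun x => innerSL ℝ (toLp 2 u) x.1) + fun x => innerSL ℝ (toLp 2 a) x.2 := fun u a => rfl
  rw [e, e, covariance_add_left (h1' u) (h2' a) ((h1' u').add (h2' a')),
    covariance_add_right (h1' u) (h1' u') (h2' a'), covariance_add_right (h2' a) (h1' u') (h2' a')]
  have c1 : cov[fun x : EuclideanSpace ℝ n × EuclideanSpace ℝ J => innerSL ℝ (toLp 2 u) x.1,
      fun x => innerSL ℝ (toLp 2 a') x.2; ν] = 0 := covariance_fst_snd_prod (h1 u) (h2 a')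
  have c2 : cov[fun x : EuclideanSpace ℝ n × EuclideanSpace ℝ J => innerSL ℝ (toLp 2 a) x.2,
      fun x => innerSL ℝ (toLp 2 u') x.1; ν] = 0 := by
    rw [covariance_comm]
    exact covariance_fst_snd_prod (h1 u') (h2 a)
  have c3 : cov[fun x : EuclideanSpace ℝ n × EuclideanSpace ℝ J => innerSL ℝ (toLp 2 u) x.1,
      fun x => innerSL ℝ (toLp 2 u') x.1; ν] = u ⬝ᵥ V *ᵥ u' := by
    have hm : ν.map Prod.fst = multivariateGaussian m V := by simp [ν]
    have := covariance_map_fun (μ := ν) (Z := Prod.fst) (X := fun x => innerSL ℝ (toLp 2 u) x)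
      (Y := fun x => innerSL ℝ (toLp 2 u') x)
      (by fun_prop) (by fun_prop) (by fun_prop)
    rw [← this, hm]
    have h := covarianceBilin_multivariateGaussian (μ := m) hV (toLp 2 u) (toLp 2 u')
    rw [covarianceBilin_apply_eq_cov IsGaussian.memLp_two_id] at h
    exact h
  have c4 : cov[fun x : EuclideanSpace ℝ n × EuclideanSpace ℝ J => innerSL ℝ (toLp 2 a) x.2,
      fun x => innerSL ℝ (toLp 2 a') x.2; ν] = a ⬝ᵥ a' := by
    have hm : ν.map Prod.snd = stdGaussian (EuclideanSpace ℝ J) := by simp [ν]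
    have := covariance_map_fun (μ := ν) (Z := Prod.snd) (X := fun x => innerSL ℝ (toLp 2 a) x)
      (Y := fun x => innerSL ℝ (toLp 2 a') x)
      (by fun_prop) (by fun_prop) (by fun_prop)
    rw [← this, hm, ← multivariateGaussian_zero_one]
    have h := covarianceBilin_multivariateGaussian (μ := 0) (S := (1 : Matrix J J ℝ))
      Matrix.PosSemidef.one (toLp 2 a) (toLp 2 a')
    rw [covarianceBilin_apply_eq_cov IsGaussian.memLp_two_id] at h
    simpa using h
  rw [c1, c2, c3, c4]
  ring

theorem integral_pairFunctional {m : EuclideanSpace ℝ n} {V : Matrix n n ℝ}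
    (u : n → ℝ) (a : J → ℝ) :
    ∫ x, pairFunctional u a x
      ∂((multivariateGaussian m V).prod (stdGaussian (EuclideanSpace ℝ J))) = ∑ l, u l * m l := by
  classical
  set ν := (multivariateGaussian m V).prod (stdGaussian (EuclideanSpace ℝ J))
  have hi : Integrable (fun x => x) ν := IsGaussian.integrable_id
  rw [ContinuousLinearMap.integral_comp_comm _ hi]
  have h : ∫ x, x ∂ν = (m, 0) := by
    refine Prod.ext ?_ ?_
    · rw [fst_integral hi]
      have := integral_fun_fst (μ := multivariateGaussian m V)
        (ν := stdGaussian (EuclideanSpace ℝ J)) (f := fun x => x)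
      simpa [ν] using this
    · rw [snd_integral hi]
      have := integral_fun_snd (μ := multivariateGaussian m V)
        (ν := stdGaussian (EuclideanSpace ℝ J)) (f := fun x => x)
      rw [integral_id_stdGaussian] at this
      simpa [ν] using this
  rw [h, pairFunctional_apply]
  simp

/-- Gaussian regression: if the functional `ξ` is uncorrelated with the functionals `X j`, then it
is independent of them and Gaussian. -/
theorem map_pairFunctional_prod {m : EuclideanSpace ℝ n} {V : Matrix n n ℝ} (hV : V.PosSemidef)
    (u : n → ℝ) (a : J → ℝ) (v : J → n → ℝ) (b : J → J → ℝ)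
    (h : ∀ j, u ⬝ᵥ V *ᵥ v j + a ⬝ᵥ b j = 0) :
    ((multivariateGaussian m V).prod (stdGaussian (EuclideanSpace ℝ J))).map
      (fun x => (pairFunctional u a x, fun j => pairFunctional (v j) (b j) x)) =
    (gaussianReal (∑ l, u l * m l) (u ⬝ᵥ V *ᵥ u + a ⬝ᵥ a).toNNReal).prod
      (((multivariateGaussian m V).prod (stdGaussian (EuclideanSpace ℝ J))).map
        fun x j => pairFunctional (v j) (b j) x) := by
  classical
  set ν := (multivariateGaussian m V).prod (stdGaussian (EuclideanSpace ℝ J))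
  have hg : HasGaussianLaw (fun x => (fun _ : Unit => pairFunctional u a x,
      fun j => pairFunctional (v j) (b j) x)) ν :=
    IsGaussian.hasGaussianLaw_id.map ((ContinuousLinearMap.pi fun _ : Unit =>
      pairFunctional u a).prod (ContinuousLinearMap.pi fun j => pairFunctional (v j) (b j)))
  have hind := hg.indepFun_of_covariance_eval (X := fun _ x => pairFunctional u a x)
    (Y := fun j x => pairFunctional (v j) (b j) x) (fun _ j => by
      rw [covariance_pairFunctional hV, h])
  have hind' : IndepFun (fun x => pairFunctional u a x)
      (fun x j => pairFunctional (v j) (b j) x) ν :=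
    hind.comp (φ := fun y : Unit → ℝ => y ()) (ψ := id) (by fun_prop) measurable_id
  rw [(indepFun_iff_map_prod_eq_prod_map_map (by fun_prop) (by fun_prop)).1 hind']
  congr 1
  have hlin : HasGaussianLaw (pairFunctional u a) ν := IsGaussian.hasGaussianLaw_id.map _
  rw [hlin.map_eq_gaussianReal, integral_pairFunctional, ← covariance_self (by fun_prop),
    covariance_pairFunctional hV]

end GaussianRegression

/-- Writing Gaussian laws through one standard normal variable includes variance zero and lets the
variance depend on the data under the integral. -/
theorem gaussianReal_map_standard (c : ℝ) {v : ℝ} (hv : 0 ≤ v) :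
    (gaussianReal 0 1).map (fun z => c + √v * z) = gaussianReal c v.toNNReal := by
  have h : (fun z => c + √v * z) = (fun x => c + x) ∘ fun z => √v * z := rfl
  rw [h, ← Measure.map_map (by fun_prop) (by fun_prop), gaussianReal_map_const_mul,
    gaussianReal_map_const_add]
  congr 1
  · simp
  · ext
    simp [Real.sq_sqrt hv, hv]

/-! ### The posterior for a fixed list of signals -/

namespace InfoGame

open Matrix

variable {K : ℕ}

theorem Environment.Regular.posteriorVariance_nonneg [NeZero K] {E : Environment K}
    (hE : E.Regular) (q : Fin K → ℕ) : 0 ≤ E.posteriorVariance q := by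
  rw [hE.posteriorVariance_eq_residualVariance]
  obtain ⟨y, hy, -⟩ := exists_solution hE.posDef_transformed q (E.coeff⁻¹ 0)
  rw [residualVariance_eq hE.posDef_transformed hy, ← hy, dotProduct_comm]
  exact dotProduct_mulVec_nonneg_of_posDef (posDef_add_diagonal hE.posDef_transformed q) y

/-- The observations of the signals `κ j` with the noise terms `e j`. -/
def Environment.observe {J : Type*} (E : Environment K) (κ : J → Fin K)
    (θ : EuclideanSpace ℝ (Fin K)) (e : J → ℝ) (j : J) : ℝ :=
  (∑ l, E.coeff (κ j) l * θ l) + e j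

theorem Environment.measurable_observe {J : Type*} (E : Environment K) (κ : J → Fin K) :
    Measurable fun p : EuclideanSpace ℝ (Fin K) × (J → ℝ) => E.observe κ p.1 p.2 := by
  unfold Environment.observe
  fun_prop

variable {J : Type*} [Fintype J]

theorem Environment.dotProduct_precision_mulVec (E : Environment K) (κ : J → Fin K)
    (x y : Fin K → ℝ) :
    x ⬝ᵥ (E.cov⁻¹ + E.coeffᵀ * diagonal (fun k =>
      (((Finset.univ.filter fun j => κ j = k).card : ℕ) : ℝ)) * E.coeff) *ᵥ y =
      x ⬝ᵥ E.cov⁻¹ *ᵥ y + ∑ j, (x ⬝ᵥ E.coeff (κ j)) * (E.coeff (κ j) ⬝ᵥ y) := by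
  rw [add_mulVec, dotProduct_add]
  congr 1
  rw [← mulVec_mulVec, ← mulVec_mulVec, dotProduct_mulVec, vecMul_transpose, dotProduct,
    ← Finset.sum_fiberwise_of_maps_to (s := Finset.univ) (t := Finset.univ) (g := κ)
      (fun _ _ => Finset.mem_univ _)]
  refine Finset.sum_congr rfl fun k _ => ?_
  rw [Finset.sum_congr rfl (g := fun _ => (x ⬝ᵥ E.coeff k) * (E.coeff k ⬝ᵥ y))
    (fun j hj => by rw [(Finset.mem_filter.1 hj).2]), Finset.sum_const, mulVec_diagonal,
    nsmul_eq_mul]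
  have h : (E.coeff *ᵥ x) k = x ⬝ᵥ E.coeff k := by rw [mulVec, dotProduct_comm]
  rw [h, mulVec]
  ring

/-- The posterior of the state of interest, for a fixed list of signals: it is Gaussian with a mean
that is a function of the observations and with the posterior variance of the environment. -/
theorem Environment.Regular.exists_posteriorMean [NeZero K] {E : Environment K} (hE : E.Regular)
    (m : EuclideanSpace ℝ (Fin K)) (κ : J → Fin K) :
    ∃ μ : (J → ℝ) → ℝ, Measurable μ ∧ ∀ F : ℝ × (J → ℝ) → ENNReal, Measurable F →
      ∫⁻ p, F (p.1 0, E.observe κ p.1 p.2)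
        ∂((multivariateGaussian m E.cov).prod (Measure.pi fun _ : J => gaussianReal 0 1)) =
      ∫⁻ p, ∫⁻ z, F (μ (E.observe κ p.1 p.2) +
          √(E.posteriorVariance fun k => (Finset.univ.filter fun j => κ j = k).card) * z,
          E.observe κ p.1 p.2) ∂(gaussianReal 0 1)
        ∂((multivariateGaussian m E.cov).prod (Measure.pi fun _ : J => gaussianReal 0 1)) := by
  classical
  set q : Fin K → ℕ := fun k => (Finset.univ.filter fun j => κ j = k).card with hq
  set A := E.cov⁻¹ + E.coeffᵀ * diagonal (fun k => (q k : ℝ)) * E.coeff with hA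
  have hApd : A.PosDef := by
    refine hE.posDef.inv.add_posSemidef ?_
    have := (PosSemidef.diagonal (n := Fin K) (d := fun k => (q k : ℝ))
      fun k => Nat.cast_nonneg (q k)).conjTranspose_mul_mul_same E.coeff
    rwa [conjTranspose_eq_transpose_of_trivial] at this
  have hAu : IsUnit A.det := (isUnit_iff_isUnit_det _).1 hApd.isUnit
  -- `ρ` is the first column of the posterior covariance matrix. The functional with coefficients
  -- `u` and `a` below is `θ₁` minus a linear function of the observations; it is uncorrelated with
  -- them and has variance `ρ 0`.
  set ρ : Fin K → ℝ := A⁻¹ *ᵥ Pi.single 0 1 with hρ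
  have hAρ : A *ᵥ ρ = Pi.single 0 1 := by
    rw [hρ, mulVec_mulVec, mul_nonsing_inv _ hAu, one_mulVec]
  have hρ0 : ρ 0 = E.posteriorVariance q := by
    rw [hρ, mulVec_single_one]
    rfl
  have hsymm : ∀ y, ρ ⬝ᵥ A *ᵥ y = y 0 := by
    intro y
    rw [dotProduct_mulVec_comm_of_posDef hApd, hAρ, single_one_dotProduct]
  have hVu : IsUnit E.cov.det := (isUnit_iff_isUnit_det _).1 hE.posDef.isUnit
  set u : Fin K → ℝ := ρ ᵥ* E.cov⁻¹ with hu
  set a : J → ℝ := fun j => -(ρ ⬝ᵥ E.coeff (κ j)) with ha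
  have huV : ∀ y, u ⬝ᵥ E.cov *ᵥ y = ρ ⬝ᵥ y := by
    intro y
    rw [hu, ← dotProduct_mulVec, mulVec_mulVec, nonsing_inv_mul _ hVu, one_mulVec]
  have hcov : ∀ j, u ⬝ᵥ E.cov *ᵥ E.coeff (κ j) + a ⬝ᵥ Pi.single j 1 = 0 := by
    intro j
    rw [huV, dotProduct_single_one, ha]
    ring
  have hvar : u ⬝ᵥ E.cov *ᵥ u + a ⬝ᵥ a = E.posteriorVariance q := by
    have h := E.dotProduct_precision_mulVec κ ρ ρ
    rw [hsymm, hρ0] at h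
    rw [h, huV, hu, dotProduct_comm ρ (ρ ᵥ* E.cov⁻¹), ← dotProduct_mulVec]
    congr 1
    refine Finset.sum_congr rfl fun j _ => ?_
    rw [ha, dotProduct_comm (E.coeff (κ j))]
    ring
  set G := (multivariateGaussian m E.cov).prod (stdGaussian (EuclideanSpace ℝ J)) with hG
  have hmap : (multivariateGaussian m E.cov).prod (Measure.pi fun _ : J => gaussianReal 0 1) =
      G.map (Prod.map id (WithLp.ofLp : EuclideanSpace ℝ J → J → ℝ)) := by
    have h2 : Measure.pi (fun _ : J => gaussianReal 0 1) =
        (stdGaussian (EuclideanSpace ℝ J)).map (WithLp.ofLp : EuclideanSpace ℝ J → J → ℝ) := by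
      rw [← map_pi_eq_stdGaussian, Measure.map_map (by fun_prop) (by fun_prop)]
      exact Measure.map_id.symm
    rw [h2, hG, ← Measure.map_prod_map _ _ measurable_id (by fun_prop), Measure.map_id]
  have hobs : ∀ x : EuclideanSpace ℝ (Fin K) × EuclideanSpace ℝ J,
      (fun j => pairFunctional (E.coeff (κ j)) (Pi.single j (1 : ℝ)) x) =
        E.observe κ x.1 x.2.ofLp := by
    intro x
    ext j
    rw [pairFunctional_apply, Environment.observe]
    simp [Pi.single_apply]
  have hθ : ∀ x : EuclideanSpace ℝ (Fin K) × EuclideanSpace ℝ J,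
      x.1 0 = pairFunctional u a x + ∑ j, -a j * E.observe κ x.1 x.2.ofLp j := by
    intro x
    have h := E.dotProduct_precision_mulVec κ ρ (x.1.ofLp)
    rw [hsymm] at h
    rw [pairFunctional_apply, h, dotProduct_mulVec, add_assoc, ← Finset.sum_add_distrib]
    congr 1
    refine Finset.sum_congr rfl fun j _ => ?_
    have h' : E.coeff (κ j) ⬝ᵥ x.1.ofLp = ∑ l, E.coeff (κ j) l * x.1 l := rfl
    rw [ha, Environment.observe, h']
    ring
  have hlaw := map_pairFunctional_prod (m := m) hE.posDef.posSemidef u a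
    (fun j => E.coeff (κ j)) (fun j => Pi.single j 1) hcov
  rw [hvar, ← gaussianReal_map_standard _ (hE.posteriorVariance_nonneg q)] at hlaw
  set c := ∑ l, u l * m l
  have hmeas := E.measurable_observe κ
  refine ⟨fun x => c + ∑ j, -a j * x j, by fun_prop, fun F hF => ?_⟩
  have hobs' : ∀ (x : EuclideanSpace ℝ (Fin K) × EuclideanSpace ℝ J) j,
      pairFunctional (E.coeff (κ j)) (Pi.single j (1 : ℝ)) x = E.observe κ x.1 x.2.ofLp j :=
    fun x j => congrFun (hobs x) j
  have hmo : Measurable fun x : EuclideanSpace ℝ (Fin K) × EuclideanSpace ℝ J =>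
      E.observe κ x.1 x.2.ofLp := by
    unfold Environment.observe
    fun_prop
  have hF' : Measurable fun y : ℝ × (J → ℝ) => F (y.1 + ∑ j, -a j * y.2 j, y.2) :=
    hF.comp (by fun_prop)
  have hF1 : Measurable fun p : EuclideanSpace ℝ (Fin K) × (J → ℝ) =>
      F (p.1 0, E.observe κ p.1 p.2) := by
    refine hF.comp (Measurable.prodMk ?_ hmeas)
    fun_prop
  have hF2 : Measurable fun p : EuclideanSpace ℝ (Fin K) × (J → ℝ) => ∫⁻ z,
      F (c + ∑ j, -a j * E.observe κ p.1 p.2 j + √(E.posteriorVariance q) * z,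
        E.observe κ p.1 p.2) ∂(gaussianReal 0 1) := by
    refine Measurable.lintegral_prod_right' (f := fun y : (EuclideanSpace ℝ (Fin K) × (J → ℝ)) × ℝ
      => F (c + ∑ j, -a j * E.observe κ y.1.1 y.1.2 j + √(E.posteriorVariance q) * y.2,
        E.observe κ y.1.1 y.1.2)) (hF.comp ?_)
    have : Measurable fun y : (EuclideanSpace ℝ (Fin K) × (J → ℝ)) × ℝ =>
        E.observe κ y.1.1 y.1.2 := hmeas.comp measurable_fst
    have h2 : ∀ j, Measurable fun y : (EuclideanSpace ℝ (Fin K) × (J → ℝ)) × ℝ =>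
      E.observe κ y.1.1 y.1.2 j := fun j => (measurable_pi_apply j).comp this
    exact Measurable.prodMk (by fun_prop) this
  rw [hmap, lintegral_map hF1 (by fun_prop), lintegral_map hF2 (by fun_prop)]
  calc ∫⁻ x, F (x.1 0, E.observe κ x.1 x.2.ofLp) ∂G
      = ∫⁻ x, (fun y : ℝ × (J → ℝ) => F (y.1 + ∑ j, -a j * y.2 j, y.2))
          (pairFunctional u a x,
            fun j => pairFunctional (E.coeff (κ j)) (Pi.single j (1 : ℝ)) x) ∂G := by
        refine lintegral_congr fun x => ?_
        simp only [hobs', ← hθ]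
    _ = _ := by
        rw [← lintegral_map hF' (by fun_prop), hlaw, lintegral_prod_symm' _ hF',
          lintegral_map (hF'.lintegral_prod_left') (by fun_prop)]
        refine lintegral_congr fun x => ?_
        simp only [hobs', Prod.map_fst, Prod.map_snd, id]
        rw [lintegral_map (by fun_prop) (by fun_prop)]
        refine lintegral_congr fun z => ?_
        congr 2
        ring

end InfoGame

/-! ### Histories and the posterior under adaptive acquisition -/

namespace InfoGame

namespace Acquisition

variable {K B : ℕ}

/-- The signals that are acquired along the history `h`. -/
def choices (S : Acquisition K B) {t : ℕ} (r : unitInterval) (h : History B t)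
    (p : Fin t × Fin B) : Fin K :=
  S.choose p.1 r (fun j => h (Fin.castLE p.1.isLt.le j)) p.2

theorem measurable_choices (S : Acquisition K B) (t : ℕ) :
    Measurable fun p : unitInterval × History B t => S.choices p.1 p.2 := by
  refine measurable_pi_lambda _ fun p => (measurable_pi_apply p.2).comp ?_
  exact (S.measurable_choose p.1).comp
    (f := fun y : unitInterval × History B t => (y.1, fun j => y.2 (Fin.castLE p.1.isLt.le j)))
    (by fun_prop)

theorem card_choices (S : Acquisition K B) {t : ℕ} (r : unitInterval) (h : History B t)
    (k : Fin K) :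
    (Finset.univ.filter fun p => S.choices r h p = k).card = S.division r h k := by
  rw [Finset.card_filter, Fintype.sum_prod_type]
  simp only [division, count, Finset.card_filter]
  rfl

theorem history_castLE (S : Acquisition K B) (E : Environment K) (θ : EuclideanSpace ℝ (Fin K))
    (r : unitInterval) (e : ℕ × Fin B → ℝ) {s t : ℕ} (hst : s ≤ t) :
    (fun j => S.history E θ r e t (Fin.castLE hst j)) = S.history E θ r e s := by
  induction t with
  | zero =>
    obtain rfl : s = 0 := by omega
    rfl
  | succ t ih =>
    rcases Nat.lt_or_ge t s with h | h
    · obtain rfl : s = t + 1 := by omega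
      rfl
    · rw [← ih h]
      ext j : 1
      have : Fin.castLE hst j = Fin.castSucc (Fin.castLE h j) := rfl
      rw [this, history, Fin.snoc_castSucc]

theorem history_apply (S : Acquisition K B) (E : Environment K) (θ : EuclideanSpace ℝ (Fin K))
    (r : unitInterval) (e : ℕ × Fin B → ℝ) {t : ℕ} (s : Fin t) (b : Fin B) :
    S.history E θ r e t s b =
      (∑ l, E.coeff (S.choose s r (S.history E θ r e s) b) l * θ l) + e (s, b) := by
  have h := congrFun (S.history_castLE E θ r e (Nat.succ_le_of_lt s.isLt)) (Fin.last _)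
  have h' : Fin.castLE (Nat.succ_le_of_lt s.isLt) (Fin.last _) = s := rfl
  rw [h'] at h
  rw [h, history, Fin.snoc_last]

theorem history_eq_observe (S : Acquisition K B) (E : Environment K)
    (θ : EuclideanSpace ℝ (Fin K)) (r : unitInterval) (e : ℕ × Fin B → ℝ) (t : ℕ) :
    S.history E θ r e t = fun s b => E.observe (S.choices r (S.history E θ r e t)) θ
      (fun p : Fin t × Fin B => e (p.1, p.2)) (s, b) := by
  ext s b
  rw [history_apply, Environment.observe, choices]
  simp only [history_castLE]

/-- Since choices depend only on the past, induction over periods shows that a history consistent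
with the choices it induces is unique. -/
theorem eq_history (S : Acquisition K B) (E : Environment K)
    (θ : EuclideanSpace ℝ (Fin K)) (r : unitInterval) (e : ℕ × Fin B → ℝ) {t : ℕ}
    {h : History B t}
    (hh : h = fun s b => E.observe (S.choices r h) θ
      (fun p : Fin t × Fin B => e (p.1, p.2)) (s, b)) :
    h = S.history E θ r e t := by
  have key : ∀ n : ℕ, ∀ hn : n < t, h ⟨n, hn⟩ = S.history E θ r e t ⟨n, hn⟩ := by
    intro n
    induction n using Nat.strong_induction_on with
    | _ n ih =>
      intro hn
      have htr : (fun j : Fin n => h (Fin.castLE hn.le j)) = S.history E θ r e n := by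
        rw [← S.history_castLE E θ r e hn.le]
        ext j : 1
        exact ih j j.isLt (j.isLt.trans hn)
      ext b
      rw [history_apply]
      conv_lhs => rw [hh]
      simp only [Environment.observe, choices, htr]
  ext s : 1
  exact key s s.isLt

theorem measurable_history (S : Acquisition K B) (E : Environment K) (t : ℕ) :
    Measurable fun x : EuclideanSpace ℝ (Fin K) × unitInterval × (ℕ × Fin B → ℝ) =>
      S.history E x.1 x.2.1 x.2.2 t := by
  induction t using Nat.strong_induction_on with
  | _ t ih =>
    refine measurable_pi_lambda _ fun s => measurable_pi_lambda _ fun b => ?_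
    simp only [history_apply]
    have h1 : Measurable fun x : EuclideanSpace ℝ (Fin K) × unitInterval × (ℕ × Fin B → ℝ) =>
        S.choose s x.2.1 (S.history E x.1 x.2.1 x.2.2 s) b :=
      (measurable_pi_apply b).comp ((S.measurable_choose s).comp
        (Measurable.prodMk (by fun_prop) (ih s s.isLt)))
    have h2 : ∀ l, Measurable fun x : EuclideanSpace ℝ (Fin K) × unitInterval ×
        (ℕ × Fin B → ℝ) => E.coeff (S.choose s x.2.1 (S.history E x.1 x.2.1 x.2.2 s) b) l :=
      fun l => (measurable_of_finite fun k => E.coeff k l).comp h1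
    fun_prop

/-- The outcome of the randomization device and the history of the first `t` periods. -/
def data (S : Acquisition K B) (E : Environment K) (t : ℕ)
    (x : EuclideanSpace ℝ (Fin K) × unitInterval × (ℕ × Fin B → ℝ)) :
    unitInterval × History B t :=
  (x.2.1, S.history E x.1 x.2.1 x.2.2 t)

theorem measurable_data (S : Acquisition K B) (E : Environment K) (t : ℕ) :
    Measurable (S.data E t) :=
  Measurable.prodMk (by fun_prop) (S.measurable_history E t)

end Acquisition

/-- The law of the randomization device and the noise terms of a player. -/
noncomputable abbrev deviceLaw (B : ℕ) : Measure (unitInterval × (ℕ × Fin B → ℝ)) :=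
  (volume : Measure unitInterval).prod (Measure.infinitePi fun _ : ℕ × Fin B => gaussianReal 0 1)

theorem map_noise (B t : ℕ) :
    (Measure.infinitePi fun _ : ℕ × Fin B => gaussianReal 0 1).map
      (fun e (p : Fin t × Fin B) => e ((p.1 : ℕ), p.2)) =
    Measure.pi fun _ : Fin t × Fin B => gaussianReal 0 1 := by
  have hinj : Function.Injective fun p : Fin t × Fin B => ((p.1 : ℕ), p.2) := by
    rintro ⟨a, b⟩ ⟨c, d⟩ h
    simp only [Prod.mk.injEq] at h
    exact Prod.ext (Fin.ext h.1) h.2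
  have := Measure.map_infinitePi_infinitePi_of_inj (P := fun _ : ℕ × Fin B => gaussianReal 0 1) hinj
  rw [← Measure.infinitePi_eq_pi]
  exact this

variable {K B : ℕ}

/-- There are finitely many lists `κ` of signals that can be acquired, and where `κ` is acquired the
history is the vector of observations of this fixed list. This reduces adaptive acquisition to
regression on fixed lists. -/
theorem Acquisition.lintegral_data [NeZero K] (S : Acquisition K B) (E : Environment K)
    (ν : Measure (EuclideanSpace ℝ (Fin K))) [IsProbabilityMeasure ν] (t : ℕ)
    {F : ℝ × (unitInterval × History B t) → ENNReal} (hF : Measurable F) :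
    ∫⁻ x, F (x.1 0, S.data E t x) ∂(ν.prod (deviceLaw B)) =
      ∑ κ : Fin t × Fin B → Fin K, ∫⁻ r : unitInterval, ∫⁻ p,
        (Set.indicator {y : ℝ × (unitInterval × History B t) | S.choices y.2.1 y.2.2 = κ} F)
          (p.1 0, (r, fun s b => E.observe κ p.1 p.2 (s, b)))
          ∂(ν.prod (Measure.pi fun _ : Fin t × Fin B => gaussianReal 0 1)) := by
  classical
  have hset : ∀ κ, MeasurableSet {y : ℝ × (unitInterval × History B t) |
      S.choices y.2.1 y.2.2 = κ} := fun κ =>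
    ((S.measurable_choices t).comp measurable_snd) (measurableSet_singleton κ)
  have hobs : ∀ κ : Fin t × Fin B → Fin K, Measurable fun p : unitInterval ×
      EuclideanSpace ℝ (Fin K) × (Fin t × Fin B → ℝ) =>
      ((p.2.1 0, (p.1, fun s b => E.observe κ p.2.1 p.2.2 (s, b))) :
        ℝ × (unitInterval × History B t)) := by
    intro κ
    unfold Environment.observe
    fun_prop
  have hFκ : ∀ κ, Measurable (Set.indicator {y : ℝ × (unitInterval × History B t) |
      S.choices y.2.1 y.2.2 = κ} F) := fun κ => hF.indicator (hset κ)
  set g : EuclideanSpace ℝ (Fin K) × unitInterval × (ℕ × Fin B → ℝ) →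
      unitInterval × EuclideanSpace ℝ (Fin K) × (Fin t × Fin B → ℝ) :=
    fun x => (x.2.1, x.1, fun p => x.2.2 ((p.1 : ℕ), p.2)) with hg
  have hgm : Measurable g := by fun_prop
  have hlaw : (ν.prod (deviceLaw B)).map g = (volume : Measure unitInterval).prod
      (ν.prod (Measure.pi fun _ : Fin t × Fin B => gaussianReal 0 1)) := by
    rw [← map_noise]
    have hr : MeasurePreserving (fun (e : ℕ × Fin B → ℝ) (p : Fin t × Fin B) => e ((p.1 : ℕ), p.2))
        (Measure.infinitePi fun _ : ℕ × Fin B => gaussianReal 0 1) _ := ⟨by fun_prop, rfl⟩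
    exact (((MeasurePreserving.id _).prod ((MeasurePreserving.id _).prod hr)).comp
      ((measurePreserving_prodAssoc _ _ _).comp
        ((Measure.measurePreserving_swap.prod (MeasurePreserving.id _)).comp
          (measurePreserving_prodAssoc ν volume _).symm))).map_eq
  have hpt : ∀ x : EuclideanSpace ℝ (Fin K) × unitInterval × (ℕ × Fin B → ℝ),
      F (x.1 0, S.data E t x) = ∑ κ : Fin t × Fin B → Fin K,
        (Set.indicator {y : ℝ × (unitInterval × History B t) | S.choices y.2.1 y.2.2 = κ} F)
          ((g x).2.1 0, ((g x).1, fun s b => E.observe κ (g x).2.1 (g x).2.2 (s, b))) := by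
    intro x
    rw [Finset.sum_eq_single (S.choices x.2.1 (S.history E x.1 x.2.1 x.2.2 t))]
    · have h := S.history_eq_observe E x.1 x.2.1 x.2.2 t
      simp only [hg]
      rw [← h, Set.indicator_of_mem (by simp), Acquisition.data]
    · intro κ _ hκ
      refine Set.indicator_of_notMem ?_ _
      intro hmem
      simp only [hg, Set.mem_ofPred_eq] at hmem
      refine hκ ?_
      rw [← S.eq_history E x.1 x.2.1 x.2.2
        (h := fun s b => E.observe κ x.1 (fun p => x.2.2 ((p.1 : ℕ), p.2)) (s, b)) ?_, hmem]
      rw [hmem]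
    · simp
  simp_rw [hpt]
  rw [lintegral_finsetSum _ fun κ _ => ?_]
  · refine Finset.sum_congr rfl fun κ _ => ?_
    have hm : Measurable fun p : unitInterval × EuclideanSpace ℝ (Fin K) × (Fin t × Fin B → ℝ) =>
        (Set.indicator {y : ℝ × (unitInterval × History B t) | S.choices y.2.1 y.2.2 = κ} F)
          (p.2.1 0, (p.1, fun s b => E.observe κ p.2.1 p.2.2 (s, b))) := (hFκ κ).comp (hobs κ)
    rw [← lintegral_map hm hgm, hlaw, lintegral_prod _ hm.aemeasurable]
  · exact (hFκ κ).comp ((hobs κ).comp hgm)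

/-- The posterior of the state of interest is Gaussian: its mean is a function of the data and its
variance is the posterior variance of the division vector. -/
theorem Environment.Regular.exists_posteriorMean_data [NeZero K] {E : Environment K}
    (hE : E.Regular) (m : EuclideanSpace ℝ (Fin K)) (S : Acquisition K B) (t : ℕ) :
    ∃ μ : unitInterval × History B t → ℝ, Measurable μ ∧
      ∀ F : ℝ × (unitInterval × History B t) → ENNReal, Measurable F →
        ∫⁻ x, F (x.1 0, S.data E t x) ∂((multivariateGaussian m E.cov).prod (deviceLaw B)) =
        ∫⁻ x, ∫⁻ z, F (μ (S.data E t x) +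
          √(E.posteriorVariance (S.division (S.data E t x).1 (S.data E t x).2)) * z,
          S.data E t x) ∂(gaussianReal 0 1)
          ∂((multivariateGaussian m E.cov).prod (deviceLaw B)) := by
  classical
  choose μ hμ hF0 using fun κ : Fin t × Fin B → Fin K => hE.exists_posteriorMean m κ
  have hset : ∀ κ, MeasurableSet {y : ℝ × (unitInterval × History B t) |
      S.choices y.2.1 y.2.2 = κ} := fun κ =>
    ((S.measurable_choices t).comp measurable_snd) (measurableSet_singleton κ)
  have hcm : Measurable fun y : unitInterval × History B t => S.choices y.1 y.2 :=
    S.measurable_choices t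
  have hμm : Measurable fun y : unitInterval × History B t =>
      μ (S.choices y.1 y.2) fun p => y.2 p.1 p.2 := by
    have : Measurable fun w : (Fin t × Fin B → Fin K) × (Fin t × Fin B → ℝ) => μ w.1 w.2 :=
      measurable_from_prod_countable_right fun κ => hμ κ
    exact this.comp (f := fun y : unitInterval × History B t =>
      (S.choices y.1 y.2, fun p : Fin t × Fin B => y.2 p.1 p.2)) (by fun_prop)
  have hvm : Measurable fun y : unitInterval × History B t =>
      √(E.posteriorVariance (S.division y.1 y.2)) := by
    have : (fun y : unitInterval × History B t =>
        √(E.posteriorVariance (S.division y.1 y.2))) = (fun κ : Fin t × Fin B → Fin K =>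
        √(E.posteriorVariance fun k => (Finset.univ.filter fun p => κ p = k).card)) ∘
        fun y => S.choices y.1 y.2 := by
      ext y
      simp only [Function.comp, S.card_choices]
    rw [this]
    exact (measurable_of_finite _).comp hcm
  refine ⟨fun y => μ (S.choices y.1 y.2) fun p => y.2 p.1 p.2, hμm, fun F hF => ?_⟩
  have hG : Measurable fun y : ℝ × (unitInterval × History B t) => ∫⁻ z,
      F (μ (S.choices y.2.1 y.2.2) (fun p => y.2.2 p.1 p.2) +
        √(E.posteriorVariance (S.division y.2.1 y.2.2)) * z, y.2) ∂(gaussianReal 0 1) := by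
    refine Measurable.lintegral_prod_right' (f := fun w : (ℝ × (unitInterval × History B t)) × ℝ =>
      F (μ (S.choices w.1.2.1 w.1.2.2) (fun p => w.1.2.2 p.1 p.2) +
        √(E.posteriorVariance (S.division w.1.2.1 w.1.2.2)) * w.2, w.1.2)) (hF.comp ?_)
    refine Measurable.prodMk (Measurable.add ?_ (Measurable.mul ?_ (by fun_prop))) (by fun_prop)
    · exact hμm.comp (f := fun w : (ℝ × (unitInterval × History B t)) × ℝ => w.1.2) (by fun_prop)
    · exact hvm.comp (f := fun w : (ℝ × (unitInterval × History B t)) × ℝ => w.1.2) (by fun_prop)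
  rw [S.lintegral_data E _ t hF, S.lintegral_data E _ t hG]
  -- For fixed `κ` and `r`, the event that `κ` is acquired depends on the observations alone, so its
  -- indicator can be absorbed into the test function of the regression.
  refine Finset.sum_congr rfl fun κ _ => lintegral_congr fun r => ?_
  have hc : Measurable fun y : ℝ × (Fin t × Fin B → ℝ) =>
      ((y.1, (r, fun s b => y.2 (s, b))) : ℝ × (unitInterval × History B t)) := by fun_prop
  rw [hF0 κ (fun y => (Set.indicator {y : ℝ × (unitInterval × History B t) |
    S.choices y.2.1 y.2.2 = κ} F) (y.1, (r, fun s b => y.2 (s, b))))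
    ((hF.indicator (hset κ)).comp hc)]
  refine lintegral_congr fun p => ?_
  by_cases h : S.choices r (fun s b => E.observe κ p.1 p.2 (s, b)) = κ
  · rw [Set.indicator_of_mem (by simpa using h)]
    refine lintegral_congr fun z => ?_
    rw [Set.indicator_of_mem (by simpa using h)]
    have hd : S.division r (fun s b => E.observe κ p.1 p.2 (s, b)) =
        fun k => (Finset.univ.filter fun p => κ p = k).card :=
      funext fun k => by rw [← S.card_choices, h]
    simp only [h, hd]
  · rw [Set.indicator_of_notMem (by simpa using h)]
    rw [← lintegral_zero (μ := gaussianReal 0 1)]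
    refine lintegral_congr fun z => ?_
    rw [Set.indicator_of_notMem (by simpa using h)]

end InfoGame

/-! ### Garbling by deconvolution and disintegration -/

section Garbling

/-- Deconvolution: a finite measure is determined by the measure that results when independent
Gaussian noise is added to the first component. -/
theorem eq_of_forall_lintegral_add_gaussian {Y : Type*} [MeasurableSpace Y] {Q₁ Q₂ : Measure (ℝ × Y)}
    [IsFiniteMeasure Q₁] [IsFiniteMeasure Q₂] {v : ℝ} (hv : 0 ≤ v)
    (h : ∀ F : ℝ × Y → ENNReal, Measurable F →
      ∫⁻ p, ∫⁻ z, F (p.1 + √v * z, p.2) ∂(gaussianReal 0 1) ∂Q₁ =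
      ∫⁻ p, ∫⁻ z, F (p.1 + √v * z, p.2) ∂(gaussianReal 0 1) ∂Q₂) : Q₁ = Q₂ := by
  refine Measure.ext_prod fun {s A} hs hA => ?_
  have hset : ∀ Q : Measure (ℝ × Y), (Q.restrict (Prod.snd ⁻¹' A)).map Prod.fst s = Q (s ×ˢ A) := by
    intro Q
    rw [Measure.map_apply measurable_fst hs, Measure.restrict_apply (measurable_fst hs)]
    rfl
  rw [← hset, ← hset]
  congr 1
  have hconv : ∀ (Q : Measure (ℝ × Y)) [IsFiniteMeasure Q] (G : ℝ → ENNReal), Measurable G →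
      ∫⁻ x, G x ∂((Q.restrict (Prod.snd ⁻¹' A)).map Prod.fst ∗ gaussianReal 0 v.toNNReal) =
      ∫⁻ p, ∫⁻ z, (Set.indicator (Prod.snd ⁻¹' A) fun y : ℝ × Y => G y.1) (p.1 + √v * z, p.2)
        ∂(gaussianReal 0 1) ∂Q := by
    intro Q _ G hG
    rw [Measure.lintegral_conv hG, lintegral_map ?_ measurable_fst,
      ← lintegral_indicator (measurable_snd hA)]
    · refine lintegral_congr fun p => ?_
      by_cases hp : p.2 ∈ A
      · rw [Set.indicator_of_mem (by exact hp), ← gaussianReal_map_standard 0 hv,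
          lintegral_map (by fun_prop) (by fun_prop)]
        refine lintegral_congr fun z => ?_
        rw [Set.indicator_of_mem (by exact hp), zero_add]
      · rw [Set.indicator_of_notMem (by exact hp), ← lintegral_zero (μ := gaussianReal 0 1)]
        refine lintegral_congr fun z => ?_
        rw [Set.indicator_of_notMem (by exact hp)]
    · exact Measurable.lintegral_prod_right' (f := fun p : ℝ × ℝ => G (p.1 + p.2)) (by fun_prop)
  have heq : (Q₁.restrict (Prod.snd ⁻¹' A)).map Prod.fst ∗ gaussianReal 0 v.toNNReal =
      (Q₂.restrict (Prod.snd ⁻¹' A)).map Prod.fst ∗ gaussianReal 0 v.toNNReal := by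
    refine Measure.ext_of_lintegral _ fun G hG => ?_
    rw [hconv Q₁ G hG, hconv Q₂ G hG]
    exact h _ ((hG.comp measurable_fst).indicator (measurable_snd hA))
  -- The characteristic function of the Gaussian never vanishes and can be cancelled.
  refine Measure.ext_of_charFun ?_
  ext t
  have ht := congrArg (fun Q => charFun Q t) heq
  simp only [charFun_conv, charFun_gaussianReal] at ht
  exact mul_right_cancel₀ (Complex.exp_ne_zero _) ht

theorem lintegral_gaussian_add (G : ℝ → ENNReal) (hG : Measurable G) (c : ℝ) {a b : ℝ}
    (ha : 0 ≤ a) (hb : 0 ≤ b) :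
    ∫⁻ w, ∫⁻ z, G (c + √a * w + √b * z) ∂(gaussianReal 0 1) ∂(gaussianReal 0 1) =
      ∫⁻ z, G (c + √(a + b) * z) ∂(gaussianReal 0 1) := by
  have h := gaussianReal_conv_gaussianReal (m₁ := c) (m₂ := 0) (v₁ := a.toNNReal)
    (v₂ := b.toNNReal)
  rw [add_zero, ← Real.toNNReal_add ha hb, ← gaussianReal_map_standard _ (add_nonneg ha hb)] at h
  have h' := congrArg (fun Q => ∫⁻ x, G x ∂Q) h
  rw [lintegral_map hG (by fun_prop), Measure.lintegral_conv hG,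
    ← gaussianReal_map_standard _ ha, ← gaussianReal_map_standard _ hb,
    lintegral_map ?_ (by fun_prop)] at h'
  · rw [← h']
    refine lintegral_congr fun w => ?_
    rw [lintegral_map (by fun_prop) (by fun_prop)]
    simp only [zero_add]
  · exact Measurable.lintegral_prod_right' (f := fun p : ℝ × ℝ => G (p.1 + p.2)) (by fun_prop)

/-- A Gaussian signal with the constant posterior variance `f`, together with an independent
uniform randomization device, can be garbled into any signal with posterior variances above `f`. -/
theorem exists_garbling {X Y : Type*} [MeasurableSpace X] [MeasurableSpace Y] [StandardBorelSpace Y]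
    [Nonempty Y] {P : Measure X} [IsProbabilityMeasure P] {θ M : X → ℝ} {r : X → unitInterval}
    {D : X → Y} {μ v : Y → ℝ} {f : ℝ} (hM : Measurable M) (hr : Measurable r)
    (hD : Measurable D) (hμ : Measurable μ) (hv : Measurable v) (hf : 0 ≤ f)
    (hfv : ∀ x, f ≤ v (D x))
    (hMr : ∀ F : ℝ × unitInterval → ENNReal, Measurable F →
      ∫⁻ x, F (θ x, r x) ∂P = ∫⁻ x, ∫⁻ z, F (M x + √f * z, r x) ∂(gaussianReal 0 1) ∂P)
    (hDv : ∀ F : ℝ × Y → ENNReal, Measurable F →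
      ∫⁻ x, F (θ x, D x) ∂P =
        ∫⁻ x, ∫⁻ z, F (μ (D x) + √(v (D x)) * z, D x) ∂(gaussianReal 0 1) ∂P)
    (hind : ∀ F : ℝ × unitInterval → ENNReal, Measurable F →
      ∫⁻ x, F (θ x, r x) ∂P = ∫⁻ ρ, ∫⁻ x, F (θ x, ρ) ∂P) :
    ∃ φ : ℝ → unitInterval → Y, Measurable (Function.uncurry φ) ∧
      ∀ F : ℝ × Y → ENNReal, Measurable F →
        ∫⁻ x, ∫⁻ z, F (M x + √f * z, φ (M x) (r x)) ∂(gaussianReal 0 1) ∂P =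
          ∫⁻ x, F (θ x, D x) ∂P := by
  -- Noise of variance `v - f` is added to the posterior mean given `D`. A further noise of variance
  -- `f` then restores the joint law of `θ` and `D`.
  set Γ : Measure (ℝ × Y) := (P.prod (gaussianReal 0 1)).map
    fun p => (μ (D p.1) + √(v (D p.1) - f) * p.2, D p.1) with hΓ
  have hg : Measurable fun p : X × ℝ =>
    ((μ (D p.1) + √(v (D p.1) - f) * p.2, D p.1) : ℝ × Y) := by fun_prop
  have : IsProbabilityMeasure Γ := Measure.isProbabilityMeasure_map hg.aemeasurable
  have hsm : ∀ F : ℝ × Y → ENNReal, Measurable F →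
      Measurable fun p : ℝ × Y => ∫⁻ z, F (p.1 + √f * z, p.2) ∂(gaussianReal 0 1) := fun F hF =>
    Measurable.lintegral_prod_right' (f := fun y : (ℝ × Y) × ℝ => F (y.1.1 + √f * y.2, y.1.2))
      (by fun_prop)
  have hA : ∀ F : ℝ × Y → ENNReal, Measurable F →
      ∫⁻ p, ∫⁻ z, F (p.1 + √f * z, p.2) ∂(gaussianReal 0 1) ∂Γ = ∫⁻ x, F (θ x, D x) ∂P := by
    intro F hF
    rw [hDv F hF, hΓ, lintegral_map (hsm F hF) hg, lintegral_prod _ (by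
      exact ((hsm F hF).comp hg).aemeasurable)]
    refine lintegral_congr fun x => ?_
    have := lintegral_gaussian_add (fun y => F (y, D x)) (by fun_prop) (μ (D x))
      (sub_nonneg.2 (hfv x)) hf
    rw [sub_add_cancel] at this
    exact this
  obtain ⟨φ, hφ, hφκ⟩ := Kernel.exists_measurable_map_eq_unitInterval Γ.condKernel
  refine ⟨φ, hφ, fun F hF => ?_⟩
  -- Deconvolution: with noise of variance `f` both sides give the law of `θ` and `r`. In particular
  -- `r` is uniform and independent of `M`, so it can drive the simulation even if it was already
  -- used in acquiring the data.
  have hQ : P.map (fun x => (M x, r x)) = Γ.fst.prod volume := by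
    have : IsProbabilityMeasure (P.map fun x => (M x, r x)) :=
      Measure.isProbabilityMeasure_map (by fun_prop)
    refine eq_of_forall_lintegral_add_gaussian hf fun G hG => ?_
    have hGm : Measurable fun p : ℝ × unitInterval =>
        ∫⁻ z, G (p.1 + √f * z, p.2) ∂(gaussianReal 0 1) :=
      Measurable.lintegral_prod_right'
        (f := fun y : (ℝ × unitInterval) × ℝ => G (y.1.1 + √f * y.2, y.1.2)) (by fun_prop)
    rw [lintegral_map hGm (by fun_prop), ← hMr G hG, hind G hG,
      lintegral_prod_symm _ hGm.aemeasurable]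
    refine lintegral_congr fun ρ => ?_
    rw [← hA (fun p => G (p.1, ρ)) (by fun_prop), Measure.fst, lintegral_map (by fun_prop)
      measurable_fst]
  have hφs : ∀ m, Measurable (φ m) := fun m =>
    hφ.comp (by fun_prop : Measurable fun ρ : unitInterval => (m, ρ))
  rw [← hA F hF]
  have hφm : Measurable fun p : ℝ × unitInterval => ((p.1, φ p.1 p.2) : ℝ × Y) :=
    measurable_fst.prodMk hφ
  have hφF : Measurable fun p : ℝ × unitInterval =>
      ∫⁻ z, F (p.1 + √f * z, φ p.1 p.2) ∂(gaussianReal 0 1) := (hsm F hF).comp hφm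
  have hmF : ∀ m, Measurable fun y => ∫⁻ z, F (m + √f * z, y) ∂(gaussianReal 0 1) := fun m =>
    (hsm F hF).comp (by fun_prop : Measurable fun y : Y => (m, y))
  calc ∫⁻ x, ∫⁻ z, F (M x + √f * z, φ (M x) (r x)) ∂(gaussianReal 0 1) ∂P
      = ∫⁻ p, ∫⁻ z, F (p.1 + √f * z, φ p.1 p.2) ∂(gaussianReal 0 1)
          ∂(P.map fun x => (M x, r x)) := by
        rw [lintegral_map hφF (by fun_prop)]
    _ = ∫⁻ m, ∫⁻ ρ, ∫⁻ z, F (m + √f * z, φ m ρ) ∂(gaussianReal 0 1) ∂volume ∂Γ.fst := by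
        rw [hQ, lintegral_prod _ hφF.aemeasurable]
    _ = ∫⁻ m, ∫⁻ y, ∫⁻ z, F (m + √f * z, y) ∂(gaussianReal 0 1) ∂(Γ.condKernel m) ∂Γ.fst := by
        refine lintegral_congr fun m => ?_
        rw [← hφκ m, lintegral_map (hmF m) (hφs m)]
    _ = ∫⁻ p, ∫⁻ z, F (p.1 + √f * z, p.2) ∂(gaussianReal 0 1) ∂Γ := by
        conv_rhs => rw [← Measure.disintegrate Γ Γ.condKernel]
        rw [Measure.lintegral_compProd (hsm F hF)]

end Garbling

/-! ### Garbling of players' data -/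

namespace InfoGame

variable {K B : ℕ} [NeZero K]

theorem Acquisition.measurable_posteriorVariance_division (S : Acquisition K B)
    (E : Environment K) (t : ℕ) : Measurable fun y : unitInterval × History B t =>
      E.posteriorVariance (S.division y.1 y.2) := by
  have : (fun y : unitInterval × History B t => E.posteriorVariance (S.division y.1 y.2)) =
      (fun κ : Fin t × Fin B → Fin K =>
        E.posteriorVariance fun k => (Finset.univ.filter fun p => κ p = k).card) ∘
      fun y => S.choices y.1 y.2 := by
    ext y
    simp only [Function.comp, S.card_choices]
  rw [this]
  exact (measurable_of_finite _).comp (S.measurable_choices t)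

/-- The data of an acquisition strategy with minimal posterior variances can be garbled into
the data of any other acquisition strategy. -/
theorem Environment.Regular.exists_garbling {E : Environment K} (hE : E.Regular) {t : ℕ}
    {S : Acquisition K B}
    (hS : ∀ r (h : History B t), IsOptimalCount E.posteriorVariance (t * B) (S.division r h))
    (τ : Acquisition K B) (m : EuclideanSpace ℝ (Fin K)) :
    ∃ ψ : unitInterval × History B t → unitInterval × History B t, Measurable ψ ∧
      ∀ F : ℝ × (unitInterval × History B t) → ENNReal, Measurable F →
        ∫⁻ x, F (x.1 0, ψ (S.data E t x)) ∂((multivariateGaussian m E.cov).prod (deviceLaw B)) =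
        ∫⁻ x, F (x.1 0, τ.data E t x) ∂((multivariateGaussian m E.cov).prod (deviceLaw B)) := by
  obtain ⟨μ, hμ, hμF⟩ := hE.exists_posteriorMean_data m S t
  obtain ⟨μ', hμ', hμF'⟩ := hE.exists_posteriorMean_data m τ t
  set π := (multivariateGaussian m E.cov).prod (deviceLaw B)
  -- The zero data are an arbitrary reference point: the minimal variance is the same along all
  -- histories.
  set f := E.posteriorVariance (S.division 0 (0 : History B t)) with hf
  have hSf : ∀ r (h : History B t), E.posteriorVariance (S.division r h) = f := fun r h =>
    le_antisymm ((hS r h).2 _ (S.sum_division _ _)) ((hS 0 0).2 _ (S.sum_division _ _))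
  simp only [hSf] at hμF
  obtain ⟨φ, hφ, hφF⟩ := _root_.exists_garbling (P := π) (θ := fun x => x.1 0)
    (M := fun x => μ (S.data E t x)) (r := fun x => x.2.1) (D := τ.data E t) (μ := μ')
    (v := fun y => E.posteriorVariance (τ.division y.1 y.2)) (f := f)
    (hμ.comp (S.measurable_data E t)) (by fun_prop) (τ.measurable_data E t) hμ'
    (τ.measurable_posteriorVariance_division E t) (hE.posteriorVariance_nonneg _)
    (fun x => (hS 0 0).2 _ (τ.sum_division _ _))
    (fun F hF => hμF (fun p => F (p.1, p.2.1)) (by fun_prop)) hμF' (fun F hF => by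
      have h1 : Measurable fun p : EuclideanSpace ℝ (Fin K) × unitInterval × (ℕ × Fin B → ℝ) =>
        F (p.1 0, p.2.1) := by fun_prop
      have h2 : Measurable fun ρ => ∫⁻ x : EuclideanSpace ℝ (Fin K), F (x 0, ρ)
          ∂(multivariateGaussian m E.cov) := Measurable.lintegral_prod_left'
        (f := fun y : EuclideanSpace ℝ (Fin K) × unitInterval => F (y.1 0, y.2)) (by fun_prop)
      rw [lintegral_prod_symm _ h1.aemeasurable]
      refine (measurePreserving_fst.lintegral_comp h2).trans (lintegral_congr fun ρ => ?_)
      exact (measurePreserving_fst.lintegral_comp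
        (by fun_prop : Measurable fun x : EuclideanSpace ℝ (Fin K) => F (x 0, ρ))).symm)
  have hψ : Measurable fun y : unitInterval × History B t => φ (μ y) y.1 :=
    hφ.comp (hμ.prodMk measurable_fst)
  refine ⟨fun y => φ (μ y) y.1, hψ, fun F hF => ?_⟩
  rw [← hφF F hF]
  exact hμF (fun p => F (p.1, φ (μ p.2) p.2.1))
    (hF.comp (measurable_fst.prodMk (hψ.comp measurable_snd)))

end InfoGame

/-! ### From garbling to dominance in the game -/

/-- Replacing one coordinate of a product measure by an independent copy. -/
theorem measurePreserving_update {ι : Type*} [Fintype ι] [DecidableEq ι] {X : ι → Type*}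
    [∀ i, MeasurableSpace (X i)] (μ : ∀ i, Measure (X i)) [∀ i, IsProbabilityMeasure (μ i)]
    (i : ι) :
    MeasurePreserving (fun p : (∀ j, X j) × X i => Function.update p.1 i p.2)
      ((Measure.pi μ).prod (μ i)) (Measure.pi μ) := by
  have hm : Measurable fun p : (∀ j, X j) × X i => Function.update p.1 i p.2 := by
    refine measurable_pi_lambda _ fun j => ?_
    by_cases h : j = i
    · subst h
      simpa using measurable_snd
    · simp only [Function.update_of_ne h]
      fun_prop
  refine ⟨hm, (Measure.pi_eq fun s hs => ?_).symm⟩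
  have hpre : (fun p : (∀ j, X j) × X i => Function.update p.1 i p.2) ⁻¹' Set.univ.pi s =
      (Set.univ.pi (Function.update s i Set.univ)) ×ˢ s i := by
    ext ⟨x, y⟩
    simp only [Set.mem_preimage, Set.mem_pi, Set.mem_univ, true_imp_iff, Set.mem_prod]
    constructor
    · refine fun h => ⟨fun j => ?_, by simpa using h i⟩
      by_cases hj : j = i
      · subst hj
        simp
      · simpa [hj] using h j
    · rintro ⟨h, h'⟩ j
      by_cases hj : j = i
      · subst hj
        simpa using h'
      · simpa [hj] using h j
  rw [Measure.map_apply hm (MeasurableSet.univ_pi hs), hpre, Measure.prod_prod, Measure.pi_pi,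
    ← Finset.mul_prod_erase _ _ (Finset.mem_univ i),
    ← Finset.mul_prod_erase _ (fun j => μ j (s j)) (Finset.mem_univ i), mul_comm]
  simp only [Function.update_self, measure_univ, one_mul]
  congr 1
  refine Finset.prod_congr rfl fun j hj => ?_
  rw [Function.update_of_ne (Finset.ne_of_mem_erase hj)]

/-- Given `k`, the conditional law of `W` is unaffected by also knowing `θ`; so `W` can be
integrated out by a kernel in `k` alone. -/
theorem lintegral_eq_lintegral_condDistrib {Ω 𝒲 T : Type*} [MeasurableSpace Ω]
    [StandardBorelSpace Ω] [MeasurableSpace 𝒲] [StandardBorelSpace 𝒲] [Nonempty 𝒲]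
    [MeasurableSpace T] [StandardBorelSpace T] [Nonempty T] {P : Measure Ω} [IsFiniteMeasure P]
    {W : Ω → 𝒲} {θ : Ω → T} {k : Ω → ℝ} (hW : Measurable W) (hθ : Measurable θ)
    (hk : Measurable k)
    (h : CondIndepFun (MeasurableSpace.comap k inferInstance) hk.comap_le W θ P)
    {G : 𝒲 × T → ENNReal} (hG : Measurable G) :
    ∫⁻ x, G (W x, θ x) ∂P = ∫⁻ x, ∫⁻ w, G (w, θ x) ∂(condDistrib W k P (k x)) ∂P := by
  have h1 := (condIndepFun_iff_condDistrib_prod_ae_eq_prodMkRight hW hθ hk).1 h.symm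
  rw [condDistrib_ae_eq_iff_measure_eq_compProd _ hW.aemeasurable] at h1
  have hG1 : Measurable fun p : (ℝ × T) × 𝒲 => G (p.2, p.1.2) := by fun_prop
  have h2 := congrArg (fun Q => ∫⁻ p, G (p.2, p.1.2) ∂Q) h1
  have hm : Measurable fun x => (k x, θ x) := by fun_prop
  rw [lintegral_map hG1 (by fun_prop), Measure.lintegral_compProd hG1, lintegral_map ?_ hm] at h2
  · exact h2
  · exact hG1.lintegral_kernel_prod_right'

namespace InfoGame

variable {ι : Type*} [Fintype ι] [DecidableEq ι] {K B : ℕ} [NeZero K]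

omit [DecidableEq ι] in
/-- The law of the data of a player, jointly with the payoff-relevant state and the states of the
other players, depends only on the joint law of the data and the state of interest. -/
theorem IsCommonPrior.lintegral_congr_data {E : ι → Environment K} {P : Measure (States ι K)}
    [IsProbabilityMeasure P] (hP : IsCommonPrior E P) (i : ι)
    {m : EuclideanSpace ℝ (Fin K)}
    (hm : P.map (fun x => x.2 i) = multivariateGaussian m (E i).cov)
    {Y Z : Type*} [MeasurableSpace Y] [MeasurableSpace Z] {ν : Measure Z} [IsProbabilityMeasure ν]
    {D D' : EuclideanSpace ℝ (Fin K) × Z → Y} (hD : Measurable D) (hD' : Measurable D')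
    (h : ∀ F : ℝ × Y → ENNReal, Measurable F →
      ∫⁻ x, F (x.1 0, D x) ∂((multivariateGaussian m (E i).cov).prod ν) =
      ∫⁻ x, F (x.1 0, D' x) ∂((multivariateGaussian m (E i).cov).prod ν))
    {R : (ℝ × ({j // j ≠ i} → EuclideanSpace ℝ (Fin K))) × Y → ENNReal} (hR : Measurable R) :
    ∫⁻ x, ∫⁻ z, R ((x.1, fun j => x.2 j), D (x.2 i, z)) ∂ν ∂P =
      ∫⁻ x, ∫⁻ z, R ((x.1, fun j => x.2 j), D' (x.2 i, z)) ∂ν ∂P := by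
  -- Integrating out `ω` and the other state vectors by their law given `θ₁` leaves a test function
  -- of `θ₁` and the data only.
  set κ := condDistrib (fun x : States ι K => (x.1, fun j : {j // j ≠ i} => x.2 j))
    (fun x => x.2 i 0) P with hκ
  suffices key : ∀ D : EuclideanSpace ℝ (Fin K) × Z → Y, Measurable D →
      ∫⁻ x, ∫⁻ z, R ((x.1, fun j => x.2 j), D (x.2 i, z)) ∂ν ∂P =
      ∫⁻ x, (fun y : ℝ × Y => ∫⁻ w, R (w, y.2) ∂(κ y.1)) (x.1 0, D x)
        ∂((multivariateGaussian m (E i).cov).prod ν) by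
    rw [key D hD, key D' hD']
    refine h (fun y => ∫⁻ w, R (w, y.2) ∂(κ y.1)) ?_
    exact Measurable.lintegral_kernel_prod_right' (κ := κ.prodMkRight Y)
      (f := fun p : (ℝ × Y) × (ℝ × ({j // j ≠ i} → EuclideanSpace ℝ (Fin K))) =>
        R (p.2, p.1.2)) (by fun_prop)
  intro D hD
  have hG : Measurable fun p : (ℝ × ({j // j ≠ i} → EuclideanSpace ℝ (Fin K))) ×
      EuclideanSpace ℝ (Fin K) => ∫⁻ z, R (p.1, D (p.2, z)) ∂ν :=
    Measurable.lintegral_prod_right' (f := fun y : ((ℝ × ({j // j ≠ i} →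
      EuclideanSpace ℝ (Fin K))) × EuclideanSpace ℝ (Fin K)) × Z => R (y.1.1, D (y.1.2, y.2)))
      (by fun_prop)
  have h1 := lintegral_eq_lintegral_condDistrib (P := P)
    (W := fun x : States ι K => (x.1, fun j : {j // j ≠ i} => x.2 j))
    (θ := fun x => x.2 i) (k := fun x => x.2 i 0) (by fun_prop) (by fun_prop) (by fun_prop)
    (hP.condIndep i) hG
  refine h1.trans ?_
  have hF : Measurable fun y : ℝ × Y => ∫⁻ w, R (w, y.2) ∂(κ y.1) :=
    Measurable.lintegral_kernel_prod_right' (κ := κ.prodMkRight Y)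
      (f := fun p : (ℝ × Y) × (ℝ × ({j // j ≠ i} → EuclideanSpace ℝ (Fin K))) =>
        R (p.2, p.1.2)) (by fun_prop)
  have hF' : Measurable fun x : EuclideanSpace ℝ (Fin K) × Z =>
      ∫⁻ w, R (w, D x) ∂(κ (x.1 0)) :=
    hF.comp (f := fun x : EuclideanSpace ℝ (Fin K) × Z => (x.1 0, D x)) (by fun_prop)
  rw [lintegral_prod _ hF'.aemeasurable, ← hm, lintegral_map ?_ (by fun_prop)]
  · refine lintegral_congr fun x => ?_
    rw [lintegral_lintegral_swap]
    exact (by fun_prop : Measurable fun p : (ℝ × ({j // j ≠ i} → EuclideanSpace ℝ (Fin K))) × Z =>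
      R (p.1, D (x.2 i, p.2))).aemeasurable
  · exact hF'.lintegral_prod_right'

end InfoGame

namespace InfoGame

variable {ι : Type*} [Fintype ι] [DecidableEq ι] {K B : ℕ} [NeZero K]
  {A : ι → Type*} [∀ i, MeasurableSpace (A i)]

omit [Fintype ι] [DecidableEq ι] [NeZero K] in
theorem measurable_finalAction_of_period (E : ι → Environment K) (σ : ∀ i, Strategy K B (A i))
    (t : ℕ) : Measurable fun p : States ι K × (ι → unitInterval × (ℕ × Fin B → ℝ)) =>
      finalAction E σ (t, p) := by
  refine measurable_pi_lambda _ fun j => ?_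
  exact ((σ j).decision.measurable_act t).comp (((σ j).acquisition.measurable_data (E j) t).comp
    (f := fun p : States ι K × (ι → unitInterval × (ℕ × Fin B → ℝ)) => (p.1.2 j, p.2 j))
    (by fun_prop))

omit [Fintype ι] [DecidableEq ι] [NeZero K] in
theorem measurable_finalAction (E : ι → Environment K) (σ : ∀ i, Strategy K B (A i)) :
    Measurable (finalAction E σ) :=
  measurable_from_prod_countable_right fun t => measurable_finalAction_of_period E σ t

omit [Fintype ι] [NeZero K] in
-- The opponents' actions do not involve the state vector, device or noise of `i`, so in their part
-- the state vector of `i` can be overwritten by the default `0`.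
theorem finalAction_update {E : ι → Environment K} {σ σ' : ∀ i, Strategy K B (A i)} {i : ι}
    (h : ∀ j ≠ i, σ' j = σ j) (t : ℕ) (x : States ι K)
    (d : ι → unitInterval × (ℕ × Fin B → ℝ)) (y : unitInterval × (ℕ × Fin B → ℝ)) :
    finalAction E σ' (t, x, Function.update d i y) =
      Function.update (finalAction E σ (t, (x.1, Function.update x.2 i 0), d)) i
        ((σ' i).decision.act t ((σ' i).acquisition.data (E i) t (x.2 i, y)).1
          ((σ' i).acquisition.data (E i) t (x.2 i, y)).2) := by
  funext j
  by_cases hj : j = i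
  · subst hj
    simp [finalAction, Acquisition.data]
  · simp [finalAction, hj, h j hj]

/-- If the data of player `i` can be garbled into those of another acquisition strategy,
then the joint law of the actions and of the payoff-relevant state can be kept. -/
theorem IsCommonPrior.exists_decision_lintegral_eq {E : ι → Environment K}
    {P : Measure (States ι K)} [IsProbabilityMeasure P] (hP : IsCommonPrior E P) {i : ι}
    (hE : (E i).Regular) {S : Acquisition K B}
    (hS : ∀ t r (h : History B t),
      IsOptimalCount (E i).posteriorVariance (t * B) (S.division r h))
    (final : PMF ℕ) (σ : ∀ j, Strategy K B (A j)) :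
    ∃ δ : Decision B (A i), ∀ H : (∀ j, A j) × ℝ → ENNReal, Measurable H →
      ∫⁻ x, H (finalAction E (Function.update σ i ⟨S, δ⟩) x, x.2.1.1) ∂(nature B final P) =
      ∫⁻ x, H (finalAction E σ x, x.2.1.1) ∂(nature B final P) := by
  obtain ⟨m, hm⟩ := hP.gaussian i
  choose ψ hψ hψF using fun t => hE.exists_garbling (hS t) (σ i).acquisition m
  -- The original decision rule is applied to simulated data, including a simulated device.
  let δ : Decision B (A i) :=
    ⟨fun t r h => (σ i).decision.act t (ψ t (r, h)).1 (ψ t (r, h)).2,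
      fun t => ((σ i).decision.measurable_act t).comp (hψ t)⟩
  refine ⟨δ, fun H hH => ?_⟩
  have hmeas : ∀ σ : ∀ j, Strategy K B (A j), Measurable fun x : Outcome ι K B =>
      H (finalAction E σ x, x.2.1.1) := fun σ =>
    hH.comp ((measurable_finalAction E σ).prodMk (by fun_prop))
  rw [nature, lintegral_prod _ (hmeas _).aemeasurable, lintegral_prod _ (hmeas _).aemeasurable]
  refine lintegral_congr fun t => ?_
  have hmt : ∀ σ : ∀ j, Strategy K B (A j), Measurable fun
      p : States ι K × (ι → unitInterval × (ℕ × Fin B → ℝ)) =>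
      H (finalAction E σ (t, p), p.1.1) := fun σ =>
    hH.comp ((measurable_finalAction_of_period E σ t).prodMk (by fun_prop))
  rw [lintegral_prod_symm _ (hmt _).aemeasurable, lintegral_prod_symm _ (hmt _).aemeasurable]
  -- An independent copy of the device and noise of `i` is resampled, so that the data of `i` can be
  -- exchanged with everything about the opponents fixed.
  have hsplit : ∀ σ' : ∀ j, Strategy K B (A j), (∀ j ≠ i, σ' j = σ j) →
      ∫⁻ d, ∫⁻ x, H (finalAction E σ' (t, x, d), x.1) ∂P ∂(Measure.pi fun _ : ι => deviceLaw B) =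
      ∫⁻ d, ∫⁻ x, ∫⁻ y, H (Function.update (finalAction E σ
          (t, (x.1, Function.update x.2 i 0), d)) i
        ((σ' i).decision.act t ((σ' i).acquisition.data (E i) t (x.2 i, y)).1
          ((σ' i).acquisition.data (E i) t (x.2 i, y)).2), x.1) ∂(deviceLaw B) ∂P
        ∂(Measure.pi fun _ : ι => deviceLaw B) := by
    intro σ' hσ'
    have h1 : Measurable fun d : ι → unitInterval × (ℕ × Fin B → ℝ) =>
        ∫⁻ x, H (finalAction E σ' (t, x, d), x.1) ∂P := (hmt σ').lintegral_prod_left'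
    have hpres := measurePreserving_update (fun _ : ι => deviceLaw B) i
    have h2 : Measurable fun p : (ι → unitInterval × (ℕ × Fin B → ℝ)) ×
        (unitInterval × (ℕ × Fin B → ℝ)) =>
        ∫⁻ x, H (finalAction E σ' (t, x, Function.update p.1 i p.2), x.1) ∂P :=
      h1.comp hpres.measurable
    rw [← hpres.lintegral_comp h1, lintegral_prod _ h2.aemeasurable]
    refine lintegral_congr fun d => ?_
    rw [lintegral_lintegral_swap]
    · simp only [finalAction_update hσ']
    · refine ((hmt σ').comp (f := fun p : (unitInterval × (ℕ × Fin B → ℝ)) × States ι K =>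
        (p.2, Function.update d i p.1)) (Measurable.prodMk (by fun_prop) ?_)).aemeasurable
      exact (measurable_update d).comp measurable_fst
  rw [hsplit σ fun _ _ => rfl, hsplit _ fun j hj => Function.update_of_ne hj _ _]
  refine lintegral_congr fun d => ?_
  simp only [Function.update_self]
  set ext : ({j // j ≠ i} → EuclideanSpace ℝ (Fin K)) → ι → EuclideanSpace ℝ (Fin K) :=
    fun w j => if h : j ≠ i then w ⟨j, h⟩ else 0 with hext
  have hextm : Measurable ext := by
    refine measurable_pi_lambda _ fun j => ?_
    by_cases h : j ≠ i
    · simp only [hext, h, ne_eq, not_false_eq_true, dif_pos]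
      fun_prop
    · simp only [hext, h, dif_neg, not_false_eq_true]
      fun_prop
  have hextu : ∀ x : ι → EuclideanSpace ℝ (Fin K),
      ext (fun j => x j) = Function.update x i 0 := by
    intro x
    funext j
    by_cases h : j = i
    · subst h
      simp [hext]
    · simp [hext, h]
  have hR : Measurable fun p : (ℝ × ({j // j ≠ i} → EuclideanSpace ℝ (Fin K))) × A i =>
      H (Function.update (finalAction E σ (t, (p.1.1, ext p.1.2), d)) i p.2, p.1.1) := by
    refine hH.comp (Measurable.prodMk ?_ (by fun_prop))
    exact measurable_update'.comp (Measurable.prodMk ((measurable_finalAction_of_period E σ t).comp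
      (Measurable.prodMk (Measurable.prodMk (by fun_prop)
        (hextm.comp (by fun_prop))) measurable_const)) measurable_snd)
  have hact := (σ i).decision.measurable_act t
  have hact' := δ.measurable_act t
  have := hP.lintegral_congr_data i hm (ν := deviceLaw B)
    (hact'.comp (S.measurable_data (E i) t))
    (hact.comp ((σ i).acquisition.measurable_data (E i) t)) (fun F hF =>
      hψF t (fun p => F (p.1, (σ i).decision.act t p.2.1 p.2.2))
        (hF.comp (measurable_fst.prodMk (hact.comp measurable_snd)))) hR
  simp only [hextu] at this
  exact this

omit [DecidableEq ι] [NeZero K] in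
theorem expectedPayoff_congr {E : ι → Environment K} {P : Measure (States ι K)}
    {G : Payoffs A} {σ σ' : ∀ j, Strategy K B (A j)} {i : ι}
    (h : ∀ H : (∀ j, A j) × ℝ → ENNReal, Measurable H →
      ∫⁻ x, H (finalAction E σ x, x.2.1.1) ∂(nature B G.final P) =
      ∫⁻ x, H (finalAction E σ' x, x.2.1.1) ∂(nature B G.final P)) :
    expectedPayoff E P G σ i = expectedPayoff E P G σ' i := by
  have hu := G.measurable_u i
  have h1 := h (fun p => ENNReal.ofReal (G.u i p.1 p.2)) (by fun_prop)
  have h2 := h (fun p => ENNReal.ofReal (-G.u i p.1 p.2)) (by fun_prop)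
  simp only [expectedPayoff, realizedPayoff, h1, h2]

theorem IsCommonPrior.isDominant {E : ι → Environment K}
    {P : Measure (States ι K)} [IsProbabilityMeasure P] (hP : IsCommonPrior E P) (G : Payoffs A)
    {i : ι} (hE : (E i).Regular) {S : Acquisition K B}
    (hS : ∀ t r (h : History B t),
      IsOptimalCount (E i).posteriorVariance (t * B) (S.division r h)) :
    IsDominant E P G i S := by
  intro σ
  obtain ⟨δ, hδ⟩ := hP.exists_decision_lintegral_eq hE hS G.final σ
  exact ⟨δ, (expectedPayoff_congr hδ).ge⟩

omit [NeZero K] in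
-- Dominance turns a deviation `τ` into one that keeps the acquisition strategy and is no worse;
-- that is a deviation in decisions.
theorem IsDecisionEquilibrium.isNash {E : ι → Environment K} {P : Measure (States ι K)}
    {G : Payoffs A} {σ : ∀ j, Strategy K B (A j)} (hσ : IsDecisionEquilibrium E P G σ)
    (h : ∀ i, IsDominant E P G i (σ i).acquisition) : IsNash E P G σ := by
  refine fun i => ⟨(hσ i).1, fun τ => ?_⟩
  obtain ⟨δ, hδ⟩ := h i (Function.update σ i τ)
  rw [Function.update_idem] at hδ
  exact hδ.trans ((hσ i).2 δ)

end InfoGame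

/-! ### Square integrable densities of Gaussian signals -/

section GaussianShift

theorem withDensity_gaussianReal_standard (a : ℝ) :
    (gaussianReal 0 1).withDensity (fun z => ENNReal.ofReal (Real.exp (a * z - a ^ 2 / 2))) =
      gaussianReal a 1 := by
  rw [gaussianReal_of_var_ne_zero 0 one_ne_zero, gaussianReal_of_var_ne_zero a one_ne_zero,
    ← withDensity_mul _ (measurable_gaussianPDF 0 1) (by fun_prop)]
  congr 1
  ext z
  rw [Pi.mul_apply, gaussianPDF, gaussianPDF, ← ENNReal.ofReal_mul (gaussianPDFReal_nonneg _ _ _),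
    gaussianPDFReal, gaussianPDFReal, mul_assoc, ← Real.exp_add]
  congr 3
  simp
  ring

theorem integrable_gaussianShift (a : ℝ) :
    Integrable (fun z => Real.exp (a * z - a ^ 2 / 2)) (gaussianReal 0 1) := by
  have : (fun z => Real.exp (a * z - a ^ 2 / 2)) =
      fun z => Real.exp (a * z) * Real.exp (-(a ^ 2 / 2)) := by
    ext z
    rw [← Real.exp_add, sub_eq_add_neg]
  rw [this]
  exact (integrable_exp_mul_gaussianReal a).mul_const _

variable {J : Type*} [Fintype J]

/-- The density of the Gaussian vector with independent components of variance one and with the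
mean `x`, relative to the standard one. -/
noncomputable def gaussianShift (x h : J → ℝ) : ℝ := ∏ p, Real.exp (x p * h p - x p ^ 2 / 2)

theorem gaussianShift_nonneg (x h : J → ℝ) : 0 ≤ gaussianShift x h :=
  Finset.prod_nonneg fun _ _ => (Real.exp_pos _).le

theorem measurable_gaussianShift :
    Measurable fun p : (J → ℝ) × (J → ℝ) => gaussianShift p.1 p.2 := by
  unfold gaussianShift
  fun_prop

theorem measurable_gaussianShift_right (x : J → ℝ) : Measurable (gaussianShift x) :=
  measurable_gaussianShift.comp (by fun_prop : Measurable fun h => (x, h))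

theorem map_add_pi_gaussianReal (x : J → ℝ) :
    (Measure.pi fun _ : J => gaussianReal 0 1).map (fun e p => x p + e p) =
      (Measure.pi fun _ : J => gaussianReal 0 1).withDensity
        fun h => ENNReal.ofReal (gaussianShift x h) := by
  have h1 : (Measure.pi fun _ : J => gaussianReal 0 1).map (fun e p => x p + e p) =
      Measure.pi fun p => gaussianReal (x p) 1 := by
    rw [Measure.pi_map_pi (f := fun p z => x p + z) (fun p => by fun_prop)]
    congr 1
    ext p : 1
    rw [gaussianReal_map_const_add, zero_add]
  rw [h1]
  refine (Measure.pi_eq fun s hs => ?_)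
  rw [withDensity_apply _ (MeasurableSet.univ_pi hs), Measure.restrict_pi_pi]
  have hint : ∀ p, Integrable (fun z => Real.exp (x p * z - x p ^ 2 / 2))
      ((gaussianReal 0 1).restrict (s p)) := fun p => (integrable_gaussianShift (x p)).restrict
  unfold gaussianShift
  rw [← ofReal_integral_eq_lintegral_ofReal (Integrable.fintype_prod hint)
    (ae_of_all _ fun h => Finset.prod_nonneg fun _ _ => (Real.exp_pos _).le), integral_fintype_prod_eq_prod (f := fun p z => Real.exp (x p * z - x p ^ 2 / 2)),
    ENNReal.ofReal_prod_of_nonneg fun p _ => integral_nonneg fun z => (Real.exp_pos _).le]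
  refine Finset.prod_congr rfl fun p _ => ?_
  rw [ofReal_integral_eq_lintegral_ofReal (hint p) (ae_of_all _ fun z => (Real.exp_pos _).le),
    ← withDensity_apply _ (hs p), withDensity_gaussianReal_standard]

theorem integral_add_pi_gaussianReal (x : J → ℝ) {s : (J → ℝ) → ℝ} (hs : Measurable s) :
    ∫ e, s (fun p => x p + e p) ∂(Measure.pi fun _ : J => gaussianReal 0 1) =
      ∫ h, s h * gaussianShift x h ∂(Measure.pi fun _ : J => gaussianReal 0 1) := by
  have hm : Measurable fun (e : J → ℝ) p => x p + e p := by fun_prop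
  rw [← integral_map hm.aemeasurable hs.aestronglyMeasurable, map_add_pi_gaussianReal,
    integral_withDensity_eq_integral_toReal_smul
      (measurable_gaussianShift_right x).ennreal_ofReal
      (ae_of_all _ fun _ => ENNReal.ofReal_lt_top)]
  refine integral_congr_ae (ae_of_all _ fun h => ?_)
  simp only
  rw [ENNReal.toReal_ofReal (gaussianShift_nonneg x h), smul_eq_mul, mul_comm]

/-- The square factorizes into exponentials, which have finite Gaussian moments. Membership in `L²`
is what lets weak-* functionals act on the density. -/
theorem memLp_gaussianShift (x : J → ℝ) :
    MemLp (gaussianShift x) 2 (Measure.pi fun _ : J => gaussianReal 0 1) := by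
  rw [memLp_two_iff_integrable_sq (measurable_gaussianShift_right x).aestronglyMeasurable]
  have : (fun h => gaussianShift x h ^ 2) = fun h : J → ℝ =>
      ∏ p, (fun z => Real.exp (2 * x p * z) * Real.exp (-(x p ^ 2))) (h p) := by
    ext h
    rw [gaussianShift, ← Finset.prod_pow]
    refine Finset.prod_congr rfl fun p _ => ?_
    simp only
    rw [← Real.exp_add, ← Real.exp_nat_mul]
    congr 1
    push_cast
    ring
  rw [this]
  exact Integrable.fintype_prod (f := fun p z => Real.exp (2 * x p * z) * Real.exp (-(x p ^ 2)))
    fun p => (integrable_exp_mul_gaussianReal _).mul_const _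

/-- The density `gaussianShift x` as an element of `L²`. -/
noncomputable def gaussianShiftLp (x : J → ℝ) :
    Lp ℝ 2 (Measure.pi fun _ : J => gaussianReal 0 1) :=
  (memLp_gaussianShift x).toLp _

theorem coeFn_gaussianShiftLp (x : J → ℝ) :
    gaussianShiftLp x =ᵐ[Measure.pi fun _ : J => gaussianReal 0 1] gaussianShift x :=
  (memLp_gaussianShift x).coeFn_toLp

theorem gaussianShiftLp_nonneg (x : J → ℝ) : 0 ≤ gaussianShiftLp x := by
  rw [← Lp.coeFn_nonneg]
  filter_upwards [coeFn_gaussianShiftLp x] with h hh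
  rw [hh]
  exact gaussianShift_nonneg x h

theorem integral_gaussianShiftLp_mul (x : J → ℝ) {s : (J → ℝ) → ℝ} (hs : Measurable s) :
    ∫ h, s h * gaussianShiftLp x h ∂(Measure.pi fun _ : J => gaussianReal 0 1) =
      ∫ e, s (fun p => x p + e p) ∂(Measure.pi fun _ : J => gaussianReal 0 1) := by
  rw [integral_add_pi_gaussianReal x hs]
  refine integral_congr_ae ?_
  filter_upwards [coeFn_gaussianShiftLp x] with h hh
  rw [hh]

theorem integral_gaussianShiftLp (x : J → ℝ) :
    ∫ h, gaussianShiftLp x h ∂(Measure.pi fun _ : J => gaussianReal 0 1) = 1 := by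
  have := integral_gaussianShiftLp_mul x (s := fun _ => 1) measurable_const
  simpa using this

/-- By Riesz representation the value is a parametric integral with a jointly measurable integrand.
-/
theorem measurable_apply_gaussianShiftLp
    (ψ : WeakDual ℝ (Lp ℝ 2 (Measure.pi fun _ : J => gaussianReal 0 1))) :
    Measurable fun x => ψ (gaussianShiftLp x) := by
  set f := (InnerProductSpace.toDual ℝ _).symm (WeakDual.toStrongDual ψ) with hf
  have h : ∀ g, ψ g = inner ℝ f g := fun g => by
    rw [hf, InnerProductSpace.toDual_symm_apply]
    rfl
  have h' : (fun x => ψ (gaussianShiftLp x)) = fun x : J → ℝ =>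
      ∫ y, f y * gaussianShift x y ∂(Measure.pi fun _ : J => gaussianReal 0 1) := by
    ext x
    rw [h, L2.inner_def]
    refine integral_congr_ae ?_
    filter_upwards [coeFn_gaussianShiftLp x] with y hy
    rw [hy]
    simp [mul_comm]
  rw [h']
  have hfm : Measurable fun y => f y := (Lp.stronglyMeasurable f).measurable
  have hsm : StronglyMeasurable fun p : (J → ℝ) × (J → ℝ) => f p.2 * gaussianShift p.1 p.2 :=
    ((hfm.comp measurable_snd).mul measurable_gaussianShift).stronglyMeasurable
  exact hsm.integral_prod_right'.measurable

end GaussianShift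

/-! ### Deterministic myopic paths and behavior strategies -/

namespace InfoGame

section Path

variable {K B : ℕ}

/-- The acquisition strategy that ignores all data and follows the path `c`. -/
def Acquisition.ofPath (c : ℕ → Fin B → Fin K) : Acquisition K B :=
  ⟨fun t _ _ => c t, fun _ => measurable_const⟩

/-- The myopic criterion sees the data only through the division vector, so a greedy recursion on
division vectors gives a path that needs no data. -/
theorem Acquisition.exists_isMyopic_ofPath [NeZero K] (E : Environment K) (B : ℕ) :
    ∃ c : ℕ → Fin B → Fin K, (Acquisition.ofPath c).IsMyopic E := by
  choose g hg using fun q : Fin K → ℕ =>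
    Finite.exists_min fun c : Fin B → Fin K => E.posteriorVariance (q + count c)
  let q : ℕ → Fin K → ℕ := fun t => Nat.rec 0 (fun _ q => q + count (g q)) t
  have hq : ∀ t, q (t + 1) = q t + count (g (q t)) := fun t => rfl
  refine ⟨fun t => g (q t), fun t r h c => ?_⟩
  have hdiv : (Acquisition.ofPath fun t => g (q t)).division r h = q t := by
    funext k
    change ∑ s : Fin t, count (g (q s)) k = q t k
    clear h
    induction t with
    | zero => rfl
    | succ t ih =>
      rw [Fin.sum_univ_castSucc, hq, Pi.add_apply]
      simp only [Fin.val_castSucc, Fin.val_last, ih]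
  rw [hdiv]
  exact hg (q t) c

/-- The means of the signals that are acquired along the path `c`. -/
def signalMean (E : Environment K) (c : ℕ → Fin B → Fin K) (t : ℕ)
    (θ : EuclideanSpace ℝ (Fin K)) (p : Fin t × Fin B) : ℝ :=
  ∑ l, E.coeff (c p.1 p.2) l * θ l

theorem measurable_signalMean (E : Environment K) (c : ℕ → Fin B → Fin K) (t : ℕ) :
    Measurable (signalMean E c t) := by
  unfold signalMean
  fun_prop

theorem Acquisition.history_ofPath (E : Environment K) (c : ℕ → Fin B → Fin K)
    (θ : EuclideanSpace ℝ (Fin K)) (r : unitInterval) (e : ℕ × Fin B → ℝ) (t : ℕ) :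
    (Acquisition.ofPath c).history E θ r e t =
      fun s b => signalMean E c t θ (s, b) + e ((s : ℕ), b) := by
  ext s b
  rw [history_apply]
  rfl

end Path

section Behavior

variable {B : ℕ} {A : Type*} [MeasurableSpace A]

/-- The probabilities of the actions in period `t`, given the realizations. -/
noncomputable def Decision.behavior (δ : Decision B A) (t : ℕ) (h : Fin t × Fin B → ℝ) (a : A) :
    ℝ :=
  (volume : Measure unitInterval).real {r | δ.act t r (fun s b => h (s, b)) = a}

variable [MeasurableSingletonClass A]

theorem Decision.measurableSet_act (δ : Decision B A) (t : ℕ) (a : A) :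
    MeasurableSet {p : (Fin t × Fin B → ℝ) × unitInterval |
      δ.act t p.2 (fun s b => p.1 (s, b)) = a} :=
  ((δ.measurable_act t).comp (f := fun p : (Fin t × Fin B → ℝ) × unitInterval =>
    (p.2, fun s b => p.1 (s, b))) (by fun_prop)) (measurableSet_singleton a)

theorem Decision.measurable_behavior (δ : Decision B A) (t : ℕ) : Measurable (δ.behavior t) := by
  refine measurable_pi_lambda _ fun a => Measurable.ennreal_toReal ?_
  exact measurable_measure_prodMk_left (δ.measurableSet_act t a)

theorem Decision.sum_behavior [Fintype A] (δ : Decision B A) (t : ℕ) (h : Fin t × Fin B → ℝ) :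
    ∑ a, δ.behavior t h a = 1 := by
  have := sum_measureReal_preimage_singleton (μ := (volume : Measure unitInterval)) Finset.univ
    (f := fun r => δ.act t r (fun s b => h (s, b)))
    (fun a _ => measurable_prodMk_left (δ.measurableSet_act t a))
  rw [Finset.coe_univ, Set.preimage_univ, probReal_univ] at this
  exact this

/-- Every behavior strategy is induced by a decision strategy that uses the randomization
device. -/
theorem exists_decision_behavior_eq [Fintype A] [Nonempty A]
    {s : ∀ t, (Fin t × Fin B → ℝ) → A → ℝ} (hs : ∀ t, Measurable (s t))
    (h0 : ∀ t h a, 0 ≤ s t h a) (h1 : ∀ t h, ∑ a, s t h a = 1) :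
    ∃ δ : Decision B A, ∀ t h a, δ.behavior t h a = s t h a := by
  classical
  have key : ∀ t, ∃ f : (Fin t × Fin B → ℝ) → unitInterval → A, Measurable (Function.uncurry f) ∧
      ∀ h a, (volume : Measure unitInterval).real {r | f h r = a} = s t h a := by
    intro t
    let κ : Kernel (Fin t × Fin B → ℝ) A :=
      ⟨fun h => ∑ a, ENNReal.ofReal (s t h a) • Measure.dirac a, by
        refine Measure.measurable_of_measurable_coe _ fun U _ => ?_
        simp only [Measure.coe_finsetSum, Finset.sum_apply, Measure.smul_apply, smul_eq_mul]
        have := fun a => measurable_pi_iff.1 (hs t) a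
        fun_prop⟩
    have hκ : ∀ h, κ h = ∑ a, ENNReal.ofReal (s t h a) • Measure.dirac a := fun h => rfl
    have : IsMarkovKernel κ := ⟨fun h => ⟨by
      rw [hκ]
      simp only [Measure.coe_finsetSum, Finset.sum_apply, Measure.smul_apply, smul_eq_mul,
        measure_univ, mul_one]
      rw [← ENNReal.ofReal_sum_of_nonneg fun a _ => h0 t h a, h1, ENNReal.ofReal_one]⟩⟩
    obtain ⟨f, hf, hfκ⟩ := Kernel.exists_measurable_map_eq_unitInterval κ
    refine ⟨f, hf, fun h a => ?_⟩
    have hfm : Measurable (f h) :=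
      hf.comp (by fun_prop : Measurable fun r : unitInterval => (h, r))
    have := congrArg (fun μ => μ.real {a}) (hfκ h)
    simp only [map_measureReal_apply hfm (measurableSet_singleton a)] at this
    refine this.trans ?_
    rw [hκ, measureReal_def, Measure.coe_finsetSum, Finset.sum_apply, Finset.sum_eq_single a]
    · simp [h0]
    · intro b _ hb
      simp [hb]
    · simp
  choose f hf hfs using key
  refine ⟨⟨fun t r h => f t (fun p => h p.1 p.2) r, fun t => ?_⟩, fun t h a => hfs t h a⟩
  exact (hf t).comp (f := fun p : unitInterval × History B t =>
    ((fun q : Fin t × Fin B => p.2 q.1 q.2), p.1)) (by fun_prop)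

variable {K : ℕ}

/-- The probability of an action, given the state vector of the player. -/
theorem integral_indicator_act (E : Environment K) (c : ℕ → Fin B → Fin K) (δ : Decision B A)
    (t : ℕ) (θ : EuclideanSpace ℝ (Fin K)) (a : A) :
    ∫ y, Set.indicator {a} (fun _ => (1 : ℝ))
      (δ.act t y.1 ((Acquisition.ofPath c).history E θ y.1 y.2 t)) ∂(deviceLaw B) =
    ∫ h, δ.behavior t h a * gaussianShiftLp (signalMean E c t θ) h
      ∂(Measure.pi fun _ : Fin t × Fin B => gaussianReal 0 1) := by
  have hb : Measurable fun e : Fin t × Fin B → ℝ =>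
      δ.behavior t (fun p => signalMean E c t θ p + e p) a :=
    (measurable_pi_iff.1 (δ.measurable_behavior t) a).comp
      (f := fun (e : Fin t × Fin B → ℝ) p => signalMean E c t θ p + e p) (by fun_prop)
  have hn : Measurable fun (e : ℕ × Fin B → ℝ) (p : Fin t × Fin B) => e ((p.1 : ℕ), p.2) := by
    fun_prop
  rw [integral_gaussianShiftLp_mul _ (measurable_pi_iff.1 (δ.measurable_behavior t) a),
    ← map_noise, integral_map hn.aemeasurable hb.aestronglyMeasurable]
  have hmeas : Measurable fun y : unitInterval × (ℕ × Fin B → ℝ) =>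
      δ.act t y.1 ((Acquisition.ofPath c).history E θ y.1 y.2 t) :=
    (δ.measurable_act t).comp (((Acquisition.ofPath c).measurable_data E t).comp
      (f := fun y => (θ, y)) (by fun_prop))
  have hi : Integrable (fun y => Set.indicator {a} (fun _ => (1 : ℝ))
      (δ.act t y.1 ((Acquisition.ofPath c).history E θ y.1 y.2 t))) (deviceLaw B) := by
    refine Integrable.of_bound (C := 1) ?_ (ae_of_all _ fun y => ?_)
    · exact ((measurable_const.indicator (measurableSet_singleton a)).comp
        hmeas).aestronglyMeasurable
    · exact (norm_indicator_le_norm_self _ _).trans (by simp)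
  -- With the noise fixed, the history along a path does not depend on the device; integrating over
  -- the device first yields the action probability.
  rw [integral_prod_symm _ hi]
  refine integral_congr_ae (ae_of_all _ fun e => ?_)
  simp only [Acquisition.history_ofPath]
  have hset : MeasurableSet {r | δ.act t r
      (fun s b => signalMean E c t θ (s, b) + e ((s : ℕ), b)) = a} :=
    measurable_prodMk_left (x := fun p : Fin t × Fin B => signalMean E c t θ p + e ((p.1 : ℕ), p.2))
      (δ.measurableSet_act t a)
  exact integral_indicator_one hset

end Behavior

end InfoGame

/-! ### Existence of equilibria in decisions -/

namespace InfoGame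

variable {ι : Type*} [Fintype ι] {K B : ℕ} {A : ι → Type*} [∀ i, MeasurableSpace (A i)]

theorem expectedPayoff_eq_integral {E : ι → Environment K} {P : Measure (States ι K)}
    {G : Payoffs A} {σ : ∀ j, Strategy K B (A j)} {i : ι}
    (h : Integrable (realizedPayoff E G σ i) (nature B G.final P)) :
    expectedPayoff E P G σ i = (∫ x, realizedPayoff E G σ i x ∂(nature B G.final P) : ℝ) := by
  rw [integral_eq_lintegral_pos_part_sub_lintegral_neg_part h, expectedPayoff, EReal.coe_sub]
  have h1 : ∫⁻ x, ENNReal.ofReal (realizedPayoff E G σ i x) ∂(nature B G.final P) ≠ ⊤ :=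
    h.lintegral_lt_top.ne
  have h2 : ∫⁻ x, ENNReal.ofReal (-realizedPayoff E G σ i x) ∂(nature B G.final P) ≠ ⊤ :=
    h.neg.lintegral_lt_top.ne
  rw [← EReal.toReal_coe_ennreal, ← EReal.toReal_coe_ennreal, EReal.coe_toReal (by simpa using h1)
    (by simp), EReal.coe_toReal (by simpa using h2) (by simp)]

theorem integrable_realizedPayoff [∀ i, Fintype (A i)] [DecidableEq ι] (E : ι → Environment K)
    {P : Measure (States ι K)} [IsProbabilityMeasure P] {G : Payoffs A} {i : ι}
    (hu : ∀ a, Integrable (fun x : States ι K => G.u i a x.1) P)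
    (σ : ∀ j, Strategy K B (A j)) :
    Integrable (realizedPayoff E G σ i) (nature B G.final P) := by
  have hsum : Integrable (fun x : States ι K => ∑ a, |G.u i a x.1|) P :=
    integrable_finsetSum _ fun a _ => (hu a).abs
  have hmp : MeasurePreserving (fun x : Outcome ι K B => x.2.1) (nature B G.final P) P := by
    unfold nature
    exact measurePreserving_fst.comp measurePreserving_snd
  refine (hmp.integrable_comp_of_integrable hsum).mono' ?_ (ae_of_all _ fun x => ?_)
  · exact ((G.measurable_u i).comp ((measurable_finalAction E σ).prodMk
      (by fun_prop))).aestronglyMeasurable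
  · rw [Real.norm_eq_abs, realizedPayoff]
    exact Finset.single_le_sum (f := fun a => |G.u i a x.2.1.1|) (fun a _ => abs_nonneg _)
      (Finset.mem_univ _)

/-- The density of the realizations of the first `t` periods along the path `c`. -/
noncomputable def signalDensity (E : ι → Environment K) (c : ι → ℕ → Fin B → Fin K) (t : ℕ)
    (j : ι) (x : States ι K) : Lp ℝ 2 (Measure.pi fun _ : Fin t × Fin B => gaussianReal 0 1) :=
  gaussianShiftLp (signalMean (E j) (c j) t (x.2 j))

/-- Given the states, devices and noise are independent across players, so the probability of an
action profile is a product of the individual action probabilities. -/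
theorem integral_payoff_eq_signalPayoff [DecidableEq ι] [∀ i, Fintype (A i)]
    [∀ i, MeasurableSingletonClass (A i)] (E : ι → Environment K)
    {P : Measure (States ι K)} [IsProbabilityMeasure P] {G : Payoffs A} {i : ι}
    (hu : ∀ a, Integrable (fun x : States ι K => G.u i a x.1) P)
    (c : ι → ℕ → Fin B → Fin K) (δ : ∀ j, Decision B (A j)) (t : ℕ)
    {φ : ∀ j, A j → WeakDual ℝ (Lp ℝ 2 (Measure.pi fun _ : Fin t × Fin B => gaussianReal 0 1))}
    {χ : A i → WeakDual ℝ (Lp ℝ 2 (Measure.pi fun _ : Fin t × Fin B => gaussianReal 0 1))}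
    (hφ : ∀ j ≠ i, ∀ a g, φ j a g =
      ∫ h, (δ j).behavior t h a * g h ∂(Measure.pi fun _ : Fin t × Fin B => gaussianReal 0 1))
    (hχ : ∀ a g, χ a g =
      ∫ h, (δ i).behavior t h a * g h ∂(Measure.pi fun _ : Fin t × Fin B => gaussianReal 0 1)) :
    ∫ p, realizedPayoff E G (fun j => ⟨Acquisition.ofPath (c j), δ j⟩) i (t, p)
      ∂(P.prod (Measure.pi fun _ : ι => deviceLaw B)) =
    signalPayoff P (signalDensity E c t) (fun i a x => G.u i a x.1) i φ χ := by
  classical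
  set σ : ∀ j, Strategy K B (A j) := fun j => ⟨Acquisition.ofPath (c j), δ j⟩ with hσ
  have hint : Integrable (fun p => realizedPayoff E G σ i (t, p))
      (P.prod (Measure.pi fun _ : ι => deviceLaw B)) := by
    have hsum : Integrable (fun x : States ι K => ∑ a, |G.u i a x.1|) P :=
      integrable_finsetSum _ fun a _ => (hu a).abs
    have hsum' := measurePreserving_fst.integrable_comp_of_integrable
      (μ := P.prod (Measure.pi fun _ : ι => deviceLaw B)) hsum
    refine hsum'.mono' ?_ (ae_of_all _ fun x => ?_)
    · exact ((G.measurable_u i).comp ((measurable_finalAction_of_period E σ t).prodMk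
        (by fun_prop))).aestronglyMeasurable
    · rw [Real.norm_eq_abs, realizedPayoff]
      exact Finset.single_le_sum (f := fun a => |G.u i a x.1.1|) (fun a _ => abs_nonneg _)
        (Finset.mem_univ _)
  rw [integral_prod _ hint, signalPayoff]
  refine integral_congr_ae (ae_of_all _ fun x => ?_)
  simp only
  set act : ∀ j, unitInterval × (ℕ × Fin B → ℝ) → A j := fun j y =>
    (δ j).act t y.1 ((Acquisition.ofPath (c j)).history (E j) (x.2 j) y.1 y.2 t) with hact
  have hactm : ∀ j, Measurable (act j) := fun j =>
    ((δ j).measurable_act t).comp (((Acquisition.ofPath (c j)).measurable_data (E j) t).comp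
      (f := fun y => (x.2 j, y)) (by fun_prop))
  have hexp : ∀ d, realizedPayoff E G σ i (t, x, d) =
      ∑ a, G.u i a x.1 * ∏ j, Set.indicator {a j} (fun _ => (1 : ℝ)) (act j (d j)) := by
    intro d
    rw [Finset.sum_eq_single fun j => act j (d j)]
    · simp only [Set.mem_singleton_iff, Set.indicator_of_mem, Finset.prod_const_one, mul_one]
      rfl
    · intro a _ ha
      obtain ⟨j, hj⟩ := Function.ne_iff.1 ha
      rw [Finset.prod_eq_zero (Finset.mem_univ j), mul_zero]
      exact Set.indicator_of_notMem (fun h => hj (by simpa using h.symm)) _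
    · simp
  have hprod : ∀ a : ∀ j, A j, ∫ d, ∏ j, Set.indicator {a j} (fun _ => (1 : ℝ)) (act j (d j))
      ∂(Measure.pi fun _ : ι => deviceLaw B) =
      χ (a i) (signalDensity E c t i x) *
        ∏ j ∈ Finset.univ.erase i, φ j (a j) (signalDensity E c t j x) := by
    intro a
    rw [integral_fintype_prod_eq_prod
      (f := fun j y => Set.indicator {a j} (fun _ => (1 : ℝ)) (act j y)),
      ← Finset.mul_prod_erase _ _ (Finset.mem_univ i)]
    congr 1
    · rw [hχ]
      exact integral_indicator_act _ _ _ _ _ _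
    · refine Finset.prod_congr rfl fun j hj => ?_
      rw [hφ j (Finset.ne_of_mem_erase hj)]
      exact integral_indicator_act _ _ _ _ _ _
  simp only [hexp]
  rw [integral_finsetSum]
  · refine Finset.sum_congr rfl fun a _ => ?_
    rw [integral_const_mul, hprod]
  · intro a _
    refine Integrable.const_mul (Integrable.fintype_prod
      (f := fun j y => Set.indicator {a j} (fun _ => (1 : ℝ)) (act j y)) fun j => ?_) _
    refine Integrable.of_bound (C := 1) ?_ (ae_of_all _ fun y => ?_)
    · exact ((measurable_const.indicator (measurableSet_singleton (a j))).comp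
        (hactm j)).aestronglyMeasurable
    · exact (norm_indicator_le_norm_self _ _).trans (by simp)

/-- Existence of equilibria in decisions, for acquisition along exogenous paths. -/
theorem exists_isDecisionEquilibrium_ofPath [DecidableEq ι] [∀ i, Fintype (A i)]
    [∀ i, Nonempty (A i)]
    [∀ i, MeasurableSingletonClass (A i)] (E : ι → Environment K)
    {P : Measure (States ι K)} [IsProbabilityMeasure P] {G : Payoffs A}
    (hu : ∀ i a, Integrable (fun x : States ι K => G.u i a x.1) P)
    (c : ι → ℕ → Fin B → Fin K) :
    ∃ δ : ∀ j, Decision B (A j),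
      IsDecisionEquilibrium E P G fun j => ⟨Acquisition.ofPath (c j), δ j⟩ := by
  -- There is one equilibrium for each possible final period `t`; decisions at different `t` are
  -- separate choices, so these combine into one strategy per player.
  choose φ hφ heq using fun t => exists_signal_equilibrium (P := P)
    (ℓ := signalDensity E c t) (g := fun i a x => G.u i a x.1)
    (fun j x => gaussianShiftLp_nonneg _) (fun j x => integral_gaussianShiftLp _)
    (fun j ψ => (measurable_apply_gaussianShiftLp ψ).comp
      ((measurable_signalMean (E j) (c j) t).comp (by fun_prop))) hu
  choose s hs h0 h1 hsφ using fun j t => mixedFunctionals.exists_behavior (hφ t j)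
  choose δ hδ using fun j => exists_decision_behavior_eq (B := B) (hs j) (h0 j) (h1 j)
  refine ⟨δ, fun i => ⟨integrable_realizedPayoff E (hu i) _, fun δ' => ?_⟩⟩
  have hupd : Function.update (fun j => (⟨Acquisition.ofPath (c j), δ j⟩ : Strategy K B (A j))) i
      ⟨Acquisition.ofPath (c i), δ'⟩ =
      fun j => ⟨Acquisition.ofPath (c j), Function.update δ i δ' j⟩ := by
    funext j
    by_cases hj : j = i
    · subst hj
      simp
    · simp [hj]
  rw [hupd, expectedPayoff_eq_integral (integrable_realizedPayoff E (hu i) _),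
    expectedPayoff_eq_integral (integrable_realizedPayoff E (hu i) _), EReal.coe_le_coe_iff]
  have hint := fun σ : ∀ j, Strategy K B (A j) =>
    integrable_realizedPayoff (B := B) E (P := P) (G := G) (hu i) σ
  unfold nature at hint ⊢
  rw [integral_prod _ (hint _), integral_prod _ (hint _)]
  refine integral_mono (hint _).integral_prod_left (hint _).integral_prod_left fun t => ?_
  simp only
  obtain ⟨χ, hχ, hχs⟩ := mixedFunctionals.exists_of_behavior
    (lam := Measure.pi fun _ : Fin t × Fin B => gaussianReal 0 1) (δ'.behavior t)
    (δ'.measurable_behavior t) (fun _ _ => measureReal_nonneg) (δ'.sum_behavior t)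
  rw [integral_payoff_eq_signalPayoff E (hu i) c (Function.update δ i δ') t (φ := φ t) (χ := χ)
    (fun j hj a g => by rw [Function.update_of_ne hj, hsφ]; simp only [hδ])
    (fun a g => by rw [Function.update_self, hχs]),
    integral_payoff_eq_signalPayoff E (hu i) c δ t (φ := φ t) (χ := φ t i)
    (fun j hj a g => by rw [hsφ]; simp only [hδ]) (fun a g => by rw [hsφ]; simp only [hδ])]
  exact heq t i χ hχ

end InfoGame

/-! ### Conclusion -/

open InfoGame
theorem corollary1 {ι : Type*} [Fintype ι] [DecidableEq ι] {K : ℕ} [NeZero K]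
    (E : ι → Environment K) (hE : ∀ i, (E i).Regular) :
    ∃ B₀ : ℕ, ∀ B : ℕ, 0 < B → (B₀ ≤ B ∨ ∀ i, (E i).Separable) →
      ∀ (P : Measure (States ι K)) [IsProbabilityMeasure P], IsCommonPrior E P →
      ∀ (A : ι → Type*) [∀ i, MeasurableSpace (A i)] (G : Payoffs A),
        (∀ (i : ι) (S : Acquisition K B), S.IsMyopic (E i) → IsDominant E P G i S) ∧
        (∀ σ : ∀ i, Strategy K B (A i), (∀ i, (σ i).acquisition.IsMyopic (E i)) →
          IsDecisionEquilibrium E P G σ → IsNash E P G σ) ∧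
        ((∀ i, Finite (A i) ∧ Nonempty (A i) ∧ MeasurableSingletonClass (A i)) →
          (∀ (i : ι) (a : ∀ j, A j), Integrable (fun x : States ι K => G.u i a x.1) P) →
          ∃ σ : ∀ i, Strategy K B (A i),
            (∀ i, (σ i).acquisition.IsMyopic (E i)) ∧ IsNash E P G σ) := by
  choose B₁ hB₁ using fun i => (hE i).exists_optimalCount_ge
  -- The bound is the largest of the players' thresholds, which depend on their environments only.
  refine ⟨Finset.univ.sup B₁, fun B hB hsep P _ hP A _ G => ?_⟩
  have hopt : ∀ i (S : Acquisition K B), S.IsMyopic (E i) → ∀ t r (h : History B t),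
      IsOptimalCount (E i).posteriorVariance (t * B) (S.division r h) := fun i S hS =>
    hS.isOptimalCount_division (hB₁ i B hB
      (hsep.imp (fun h => (Finset.le_sup (Finset.mem_univ i)).trans h) fun h => h i))
  have hdom : ∀ i (S : Acquisition K B), S.IsMyopic (E i) → IsDominant E P G i S :=
    fun i S hS => hP.isDominant G (hE i) (hopt i S hS)
  refine ⟨hdom, fun σ hσ hdec => hdec.isNash fun i => hdom i _ (hσ i), fun hA hu => ?_⟩
  have := fun i => (hA i).1
  have := fun i => (hA i).2.1
  have := fun i => (hA i).2.2
  have := fun i => Fintype.ofFinite (A i)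
  choose c hc using fun i => Acquisition.exists_isMyopic_ofPath (E i) B
  obtain ⟨δ, hδ⟩ := exists_isDecisionEquilibrium_ofPath E hu c
  exact ⟨fun j => ⟨Acquisition.ofPath (c j), δ j⟩, hc, hδ.isNash fun i => hdom i _ (hc i)⟩
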